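/- **Setting.** Let $a>0$, $b,c,\theta_1,\theta_2\in\mathbb R$, $0<h_m<h_M$, and $\mathcal H=L^2(0,1)$ (real-valued functions) with its usual inner product $\langle\cdot,\cdot\rangle$ and norm $\|\cdot\|$. On $H^2(0,1)$ put $\mathcal A f=af''+bf$, $\mathcal A_c f=\mathcal A f+cf$ and $\mathcal Bf=(\cos\theta_1 f(0)-\sin\theta_1 f'(0),\ \cos\theta_2 f(1)+\sin\theta_2 f'(1))\in\mathbb R^2$. Let $\mathcal A_0$, $\mathcal A_{c,0}$ be the restrictions of $\mathcal A$, $\mathcal A_c$ to $H^2(0,1)\cap\ker\mathcal B$, let $S(t)$ be the $C_0$-semigroup on $\mathcal H$ generated by $\mathcal A_0$, let $\lambda_1>\lambda_2>\cdots$ be the eigenvalues of $\mathcal A_{c,0}$, and let $e_n$ be a unit eigenvector of $\mathcal A_{c,0}$ for $\lambda_n$. Fix an integer $k\ge2$ with $\cos\theta_m+k\sin\theta_m\ne0$ for $m=1,2$, and for $u\in\mathbb R^2$ let $$[L_ku](x)=\frac{u_1(1-x)^k}{\cos\theta_1+k\sin\theta_1}+\frac{u_2x^k}{\cos\theta_2+k\sin\theta_2}.$$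 For $N_0\ge1$ let $A=\mathrm{diag}(\lambda_1,\dots,\lambda_{N_0})$ and $B=(b_{n,m})\in\mathbb R^{N_0\times2}$ with $b_{n,m}=-\lambda_n\langle L_kf_m,e_n\rangle+\langle\mathcal A_cL_kf_m,e_n\rangle$, where $(f_1,f_2)$ is the canonical basis of $\mathbb R^2$. Consider the delayed boundary control system $$\dot X(t)=\mathcal AX(t)+cX(t-h(t))+p(t),\qquad \mathcal BX(t)=u(t)\quad(t>0),\qquad X(\tau)=\Phi(\tau)\quad(\tau\in[-h_M,0]),$$ that is, $y_t=ay_{xx}+by+cy(t-h(t),\cdot)+d$ with $X(t)=y(t,\cdot)$, $p(t)=d(t,\cdot)$, $\Phi(\tau)=\phi(\tau,\cdot)$ and Robin boundary inputs $u=(u_1,u_2)$. For $K\in\mathbb R^{2\times N_0}$, a mild solution of this system in closed loop with $u=KY$, $Y(t)=(\langle X(t),e_1\rangle,\dots,\langle X(t),e_{N_0}\rangle)^\top$, is a function $X$ on $[-h_M,\infty)$, continuous on $[0,\infty)$ with values in $\mathcal H$, with $X=\Phi$ on $[-h_M,0]$, such that $u=KY$ is absolutely continuous on every compact interval of $[0,\infty)$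 and, for all $t\ge0$, $$X(t)=S(t)\{\Phi(0)-L_ku(0)\}+L_ku(t)+\int_0^tS(t-s)\{\mathcal AL_ku(s)-L_k\dot u(s)+cX(s-h(s))+p(s)\}\,ds.$$ **Theorem.** Let $N_0\ge1$ be such that $\lambda_{N_0+1}<-2\sqrt5\,|c|$, and let $K\in\mathbb R^{2\times N_0}$ be such that the eigenvalues $\mu_1,\dots,\mu_{N_0}\in\mathbb C$ of $A+BK$ are simple and satisfy $\operatorname{Re}\mu_n<-3|c|$ for all $1\le n\le N_0$. Then there exist constants $\kappa,C_0,C_1>0$ such that, for every $\Phi\in\mathcal C^0([-h_M,0];\mathcal H)$, every $p\in L^\infty_{\mathrm{loc}}(\mathbb R_+;\mathcal H)$ and every continuous $h:\mathbb R_+\to\mathbb R$ with $h_m\le h\le h_M$, the closed-loop system with $u=KY$ has a unique mild solution $X$, and for all $t\ge0$ $$\|X(t)\|\le C_0e^{-\kappa t}\sup_{\tau\in[-h_M,0]}\|\Phi(\tau)\|+C_1\operatorname*{ess\,sup}_{\tau\in[0,t]}e^{-\kappa(t-\tau)}\|p(\tau)\|,$$ $$\|u(t)\|\le C_0\|K\|e^{-\kappa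 t}\sup_{\tau\in[-h_M,0]}\|\Phi(\tau)\|+C_1\|K\|\operatorname*{ess\,sup}_{\tau\in[0,t]}e^{-\kappa(t-\tau)}\|p(\tau)\|,$$ where $\mathbb R^2$ carries the Euclidean norm and $\|K\|$ is the induced matrix norm. -/

import Mathlib

open MeasureTheory Set Filter Topology
open scoped Matrix.Norms.L2Operator

namespace DelayRD

noncomputable section

/-- Lebesgue measure on the open interval `(0,1)`. -/
abbrev unitMeasure : Measure ℝ := volume.restrict (Ioo (0 : ℝ) 1)

/-- The real Hilbert space `L²(0,1)`. -/
abbrev L2 : Type := Lp ℝ 2 unitMeasure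

theorem memLp_of_continuous {f : ℝ → ℝ} (hf : Continuous f) : MemLp f 2 unitMeasure := by
  obtain ⟨M, hM⟩ := (isCompact_Icc (a := (0 : ℝ)) (b := 1)).exists_bound_of_continuousOn
    hf.continuousOn
  refine MemLp.of_bound hf.aestronglyMeasurable M ?_
  filter_upwards [ae_restrict_mem measurableSet_Ioo] with x hx
  exact hM x (Ioo_subset_Icc_self hx)

/-- The class in `L²(0,1)` of a continuous function. -/
def ofContinuous (f : ℝ → ℝ) (hf : Continuous f) : L2 := (memLp_of_continuous hf).toLp f

/-- Coefficients of `y_t = a y_xx + b y + c y(t - h(t)) + d`, with the Robin conditions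
`cos θ₁ y(0) - sin θ₁ y_x(0) = u₁` and `cos θ₂ y(1) + sin θ₂ y_x(1) = u₂`. -/
structure Coeffs where
  a : ℝ
  b : ℝ
  c : ℝ
  θ₁ : ℝ
  θ₂ : ℝ
  a_pos : 0 < a

/-- `f ∈ H²(0,1)`, with continuously differentiable representative `v` on `[0,1]`, absolutely
continuous first derivative `w`, and second derivative `q ∈ L²(0,1)`. -/
def IsH2 (f : L2) (v w : ℝ → ℝ) (q : L2) : Prop :=
  f =ᵐ[unitMeasure] v ∧
  (∀ x ∈ Icc (0 : ℝ) 1, v x = v 0 + ∫ s in (0 : ℝ)..x, w s) ∧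
  (∀ x ∈ Icc (0 : ℝ) 1, w x = w 0 + ∫ s in (0 : ℝ)..x, q s)

/-- The graph of `f ↦ a f'' + r f` on `{f ∈ H²(0,1) | ℬ f = 0}`, where
`ℬ f = (cos θ₁ f(0) - sin θ₁ f'(0), cos θ₂ f(1) + sin θ₂ f'(1))`. It is the graph of `𝒜₀` for
`r = b` and the graph of `𝒜_{c,0} = 𝒜₀ + c I` for `r = b + c`. -/
def RobinGraph (P : Coeffs) (r : ℝ) (f g : L2) : Prop :=
  ∃ (v w : ℝ → ℝ) (q : L2), IsH2 f v w q ∧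
    Real.cos P.θ₁ * v 0 - Real.sin P.θ₁ * w 0 = 0 ∧
    Real.cos P.θ₂ * v 1 + Real.sin P.θ₂ * w 1 = 0 ∧
    g = P.a • q + r • f

/-- The set of eigenvalues of `𝒜_{c,0}`. -/
def eigenvalues (P : Coeffs) : Set ℝ :=
  {μ | ∃ f : L2, f ≠ 0 ∧ RobinGraph P (P.b + P.c) f (μ • f)}

/-- The eigenvalues of `𝒜_{c,0}` in strictly decreasing order: `lam P n` is `λ_{n+1}`. -/
def lam (P : Coeffs) : ℕ → ℝ
  | 0 => sSup (eigenvalues P)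
  | n + 1 => sSup {μ | μ ∈ eigenvalues P ∧ μ < lam P n}

/-- `f` is a unit eigenvector of `𝒜_{c,0}` for the eigenvalue `μ`. -/
def IsUnitEigenvector (P : Coeffs) (μ : ℝ) (f : L2) : Prop :=
  ‖f‖ = 1 ∧ RobinGraph P (P.b + P.c) f (μ • f)

/-- `k` is an admissible exponent of the lifting operator `L_k`. -/
def IsLiftExponent (P : Coeffs) (k : ℕ) : Prop :=
  2 ≤ k ∧ Real.cos P.θ₁ + k * Real.sin P.θ₁ ≠ 0 ∧ Real.cos P.θ₂ + k * Real.sin P.θ₂ ≠ 0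

/-- The function `x ↦ [L_k u](x)`. -/
def liftFun (P : Coeffs) (k : ℕ) (u : EuclideanSpace ℝ (Fin 2)) (x : ℝ) : ℝ :=
  u 0 * (1 - x) ^ k / (Real.cos P.θ₁ + k * Real.sin P.θ₁) +
    u 1 * x ^ k / (Real.cos P.θ₂ + k * Real.sin P.θ₂)

theorem contDiff_liftFun (P : Coeffs) (k : ℕ) (u : EuclideanSpace ℝ (Fin 2)) :
    ContDiff ℝ 2 (liftFun P k u) := by
  unfold liftFun
  fun_prop

/-- `L_k u` as an element of `L²(0,1)`. -/
def lift (P : Coeffs) (k : ℕ) (u : EuclideanSpace ℝ (Fin 2)) : L2 :=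
  ofContinuous (liftFun P k u) (contDiff_liftFun P k u).continuous

theorem continuous_opLiftFun (P : Coeffs) (r : ℝ) (k : ℕ) (u : EuclideanSpace ℝ (Fin 2)) :
    Continuous fun x => P.a * iteratedDeriv 2 (liftFun P k u) x + r * liftFun P k u x :=
  (continuous_const.mul ((contDiff_liftFun P k u).continuous_iteratedDeriv 2 le_rfl)).add
    (continuous_const.mul (contDiff_liftFun P k u).continuous)

/-- `a (L_k u)'' + r L_k u`: this is `𝒜 L_k u` for `r = b` and `𝒜_c L_k u` for `r = b + c`. -/
def opLift (P : Coeffs) (r : ℝ) (k : ℕ) (u : EuclideanSpace ℝ (Fin 2)) : L2 :=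
  ofContinuous (fun x => P.a * iteratedDeriv 2 (liftFun P k u) x + r * liftFun P k u x)
    (continuous_opLiftFun P r k u)

/-- A strongly continuous semigroup of bounded operators; only times `t ≥ 0` matter. -/
structure IsC0Semigroup (S : ℝ → L2 →L[ℝ] L2) : Prop where
  zero : S 0 = ContinuousLinearMap.id ℝ L2
  add : ∀ s t, 0 ≤ s → 0 ≤ t → S (s + t) = (S s).comp (S t)
  cont : ∀ f, ContinuousOn (fun t => S t f) (Ici 0)

/-- `S` is the `C₀`-semigroup whose infinitesimal generator is the operator with graph `G`. -/
def IsGeneratedBy (S : ℝ → L2 →L[ℝ] L2) (G : L2 → L2 → Prop) : Prop :=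
  IsC0Semigroup S ∧
    ∀ f g, G f g ↔ Tendsto (fun t : ℝ => t⁻¹ • (S t f - f)) (𝓝[>] 0) (𝓝 g)

/-- `X` is a mild solution of
`X'(t) = 𝒜 X(t) + c X(t - h(t)) + p(t)`, `ℬ X(t) = u(t)`, `X = Φ` on `[-h_M, 0]`,
for the locally absolutely continuous boundary input `u`; here `S` is the semigroup generated
by `𝒜₀`, which its generator determines. -/
def IsMildSolution (P : Coeffs) (k : ℕ) (hM : ℝ) (h : ℝ → ℝ) (Φ p : ℝ → L2)
    (u : ℝ → EuclideanSpace ℝ (Fin 2)) (X : ℝ → L2) : Prop :=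
  ContinuousOn X (Ici 0) ∧ EqOn X Φ (Icc (-hM) 0) ∧
  (∀ T, 0 ≤ T → AbsolutelyContinuousOnInterval u 0 T) ∧
  ∃ S : ℝ → L2 →L[ℝ] L2, IsGeneratedBy S (RobinGraph P P.b) ∧
    ∀ t, 0 ≤ t →
      X t = S t (Φ 0 - lift P k (u 0)) + lift P k (u t) +
        ∫ s in (0 : ℝ)..t, S (t - s)
          (opLift P P.b k (u s) - lift P k (deriv u s) + P.c • X (s - h s) + p s)

/-- `A = diag(λ₁, …, λ_{N₀})`. -/
def matA (P : Coeffs) (N₀ : ℕ) : Matrix (Fin N₀) (Fin N₀) ℝ :=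
  Matrix.diagonal fun i => lam P i

/-- `B = (b_{n,m})`, with `b_{n,m} = -λ_n ⟨L_k f_m, e_n⟩ + ⟨𝒜_c L_k f_m, e_n⟩` and `(f₁, f₂)` the
canonical basis of `ℝ²`. -/
def matB (P : Coeffs) (k : ℕ) {N₀ : ℕ} (e : Fin N₀ → L2) : Matrix (Fin N₀) (Fin 2) ℝ :=
  Matrix.of fun n m =>
    -lam P n * inner ℝ (lift P k (EuclideanSpace.single m 1)) (e n) +
      inner ℝ (opLift P (P.b + P.c) k (EuclideanSpace.single m 1)) (e n)

/-- The feedback `u = K Y`, with `Y(t) = (⟨X(t), e₁⟩, …, ⟨X(t), e_{N₀}⟩)`. -/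
def feedback {N₀ : ℕ} (e : Fin N₀ → L2) (K : Matrix (Fin 2) (Fin N₀) ℝ) (X : ℝ → L2) (t : ℝ) :
    EuclideanSpace ℝ (Fin 2) :=
  WithLp.toLp 2 (K.mulVec fun i => inner ℝ (X t) (e i))

/-- `ess sup_{τ ∈ [0,t]} e^{-κ(t-τ)} ‖p(τ)‖`. -/
def fadingEssSup (κ : ℝ) (p : ℝ → L2) (t : ℝ) : ℝ :=
  (eLpNorm (fun τ => Real.exp (-κ * (t - τ)) • p τ) ⊤ (volume.restrict (Icc 0 t))).toReal

/-- `sup_{τ ∈ [-h_M,0]} ‖Φ(τ)‖`. -/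
def supHistory (hM : ℝ) (Φ : ℝ → L2) : ℝ :=
  sSup ((fun τ => ‖Φ τ‖) '' Icc (-hM) 0)

end

end DelayRD

/-!
For a mild solution `X` with input `u`, the function `Z = X - L_k u` satisfies homogeneous Robin
conditions. Under these conditions `𝒜₀` has a compact symmetric resolvent (the Green operator), so
it is diagonal in an orthonormal basis, with eigenvalues `λ_n - c`. Hence every mode of `X` obeys a
scalar delay equation forced by `u`, and the output of the closed loop solves an equation of its
own, `Y' = (A + B K - c) Y + c Y(t - h) + (⟨p, e_n⟩)_n`. Since `h ≥ h_m > 0`, the method of steps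
solves this equation, and then the equation of `Z` with `u = K Y` known.

For the decay, choose `α > |c|` such that the eigenvalues of `A + B K - c` and the eigenvalues
`λ_n - c`, `n > N₀`, have real part at most `-α`. For `κ > 0` small, the delayed term has gain
`|c| e^{κ h_M} / (α - κ) < 1` in the norm weighted by `e^{κ t}`, which settles a scalar equation and
the tail of `Z`. The system for `Y` is reduced to scalar equations by splitting off the roots of the
characteristic polynomial one at a time, which ends at `0` by the Cayley–Hamilton theorem. The
remaining modes of `X` are read off from `Y`.
-/

namespace DelayRD

noncomputable section

/-! ### Primitives of integrable functions -/

section Primitive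

variable {E F : Type*} [NormedAddCommGroup E] [NormedSpace ℝ E]
  [NormedAddCommGroup F] [NormedSpace ℝ F] {a b : ℝ}

/-- `y` is a primitive of the integrable function `φ` on the interval with endpoints `a` and `b`.
This is the meaning given to the differential equation `y' = φ`: `φ` need only be defined almost
everywhere, and it is not required to be the derivative of `y` at any given point. -/
structure IsPrimitiveOn (y φ : ℝ → E) (a b : ℝ) : Prop where
  intervalIntegrable : IntervalIntegrable φ volume a b
  eq_add_integral : ∀ t ∈ uIcc a b, y t = y a + ∫ s in a..t, φ s

theorem absolutelyContinuousOnInterval_of_dist_le {X Y : Type*} [PseudoMetricSpace X]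
    [PseudoMetricSpace Y] {f : ℝ → X} {g : ℝ → Y} (hg : AbsolutelyContinuousOnInterval g a b)
    (hfg : ∀ s ∈ uIcc a b, ∀ t ∈ uIcc a b, dist (f s) (f t) ≤ dist (g s) (g t)) :
    AbsolutelyContinuousOnInterval f a b := by
  rw [absolutelyContinuousOnInterval_iff] at hg ⊢
  intro ε hε
  obtain ⟨δ, hδ, hsum⟩ := hg ε hε
  refine ⟨δ, hδ, fun I hI hIδ => (Finset.sum_le_sum fun i hi => ?_).trans_lt (hsum I hI hIδ)⟩
  exact hfg _ (hI.1 i hi).1 _ (hI.1 i hi).2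

theorem absolutelyContinuousOnInterval_clm_apply {G : ℝ → E →L[ℝ] F} {y : ℝ → E}
    (hG : AbsolutelyContinuousOnInterval G a b) (hy : AbsolutelyContinuousOnInterval y a b) :
    AbsolutelyContinuousOnInterval (fun t => G t (y t)) a b := by
  obtain ⟨C, hC⟩ := hG.exists_bound
  obtain ⟨D, hD⟩ := hy.exists_bound
  rw [AbsolutelyContinuousOnInterval] at hG hy ⊢
  refine squeeze_zero' (Eventually.of_forall fun _ => Finset.sum_nonneg fun _ _ => dist_nonneg) ?_
    (by simpa using (hy.const_mul C).add (hG.const_mul D))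
  rw [eventually_inf_principal]
  refine Eventually.of_forall fun I hI => ?_
  rw [Finset.mul_sum, Finset.mul_sum, ← Finset.sum_add_distrib]
  refine Finset.sum_le_sum fun i hi => ?_
  obtain ⟨hs, ht⟩ := hI.1 i hi
  set s := (I.2 i).1
  set t := (I.2 i).2
  have hsplit : G s (y s) - G t (y t) = G s (y s - y t) + (G s - G t) (y t) := by simp
  rw [dist_eq_norm, dist_eq_norm, dist_eq_norm, hsplit, mul_comm D]
  exact (norm_add_le _ _).trans (add_le_add ((G s).le_of_opNorm_le (hC s hs) _)
    ((G s - G t).le_opNorm_of_le (hD t ht)))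

theorem IsPrimitiveOn.dist_le {y φ : ℝ → E} (hy : IsPrimitiveOn y φ a b) {s t : ℝ}
    (hs : s ∈ uIcc a b) (ht : t ∈ uIcc a b) :
    dist (y s) (y t) ≤ dist (∫ r in a..s, ‖φ r‖) (∫ r in a..t, ‖φ r‖) := by
  have hint : ∀ r ∈ uIcc a b, IntervalIntegrable φ volume a r := fun r hr =>
    hy.intervalIntegrable.mono_set (uIcc_subset_uIcc left_mem_uIcc hr)
  rw [hy.eq_add_integral s hs, hy.eq_add_integral t ht, dist_add_left, dist_eq_norm,
    Real.dist_eq, intervalIntegral.integral_interval_sub_left (hint s hs) (hint t ht),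
    intervalIntegral.integral_interval_sub_left (hint s hs).norm (hint t ht).norm]
  exact intervalIntegral.norm_integral_le_abs_integral_norm

theorem IsPrimitiveOn.absolutelyContinuousOnInterval {y φ : ℝ → E} (hy : IsPrimitiveOn y φ a b) :
    AbsolutelyContinuousOnInterval y a b :=
  absolutelyContinuousOnInterval_of_dist_le
    (hy.intervalIntegrable.norm.absolutelyContinuousOnInterval_intervalIntegral left_mem_uIcc)
    fun _ hs _ ht => hy.dist_le hs ht

theorem IsPrimitiveOn.continuousOn {y φ : ℝ → E} (hy : IsPrimitiveOn y φ a b) :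
    ContinuousOn y (uIcc a b) :=
  hy.absolutelyContinuousOnInterval.continuousOn

theorem isPrimitiveOn_const_add_integral {φ : ℝ → E} (hφ : IntervalIntegrable φ volume a b)
    (v : E) : IsPrimitiveOn (fun t => v + ∫ s in a..t, φ s) φ a b :=
  ⟨hφ, fun t _ => by rw [intervalIntegral.integral_same, add_zero]⟩

theorem IsPrimitiveOn.congr_ae {y z φ ψ : ℝ → E} (hy : IsPrimitiveOn y φ a b)
    (hyz : EqOn z y (uIcc a b)) (hφψ : ∀ᵐ t, t ∈ uIoc a b → ψ t = φ t) :
    IsPrimitiveOn z ψ a b where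
  intervalIntegrable := hy.intervalIntegrable.congr_ae <| by
    filter_upwards [ae_restrict_of_ae hφψ, ae_restrict_mem measurableSet_uIoc] with s hs hmem
    exact (hs hmem).symm
  eq_add_integral t ht := by
    rw [hyz ht, hyz left_mem_uIcc, hy.eq_add_integral t ht]
    congr 1
    refine intervalIntegral.integral_congr_ae ?_
    filter_upwards [hφψ] with s hs hmem
    exact (hs (uIoc_subset_uIoc_of_uIcc_subset_uIcc (uIcc_subset_uIcc_left ht) hmem)).symm

theorem IsPrimitiveOn.congr {y z φ ψ : ℝ → E} (hy : IsPrimitiveOn y φ a b)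
    (hyz : EqOn z y (uIcc a b)) (hφψ : EqOn ψ φ (uIcc a b)) : IsPrimitiveOn z ψ a b :=
  hy.congr_ae hyz (ae_of_all _ fun _ hs => hφψ (uIoc_subset_uIcc hs))

theorem IsPrimitiveOn.add {y z φ ψ : ℝ → E} (hy : IsPrimitiveOn y φ a b)
    (hz : IsPrimitiveOn z ψ a b) :
    IsPrimitiveOn (fun t => y t + z t) (fun t => φ t + ψ t) a b where
  intervalIntegrable := hy.intervalIntegrable.add hz.intervalIntegrable
  eq_add_integral t ht := by
    have hsub := uIcc_subset_uIcc_left ht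
    rw [intervalIntegral.integral_add (hy.intervalIntegrable.mono_set hsub)
      (hz.intervalIntegrable.mono_set hsub), hy.eq_add_integral t ht, hz.eq_add_integral t ht]
    abel

theorem intervalIntegrable_clm_apply {G : ℝ → E →L[ℝ] F} {φ : ℝ → E}
    (hG : ContinuousOn G (uIcc a b)) (hφ : IntervalIntegrable φ volume a b) :
    IntervalIntegrable (fun s => G s (φ s)) volume a b := by
  obtain ⟨C, hC⟩ := isCompact_uIcc.exists_bound_of_continuousOn hG
  refine (hφ.norm.const_mul C).mono_fun' ?_ ?_
  · exact isBoundedBilinearMap_apply.continuous.comp_aestronglyMeasurable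
      (((hG.mono uIoc_subset_uIcc).aestronglyMeasurable measurableSet_uIoc).prodMk
        hφ.aestronglyMeasurable_restrict_uIoc)
  · filter_upwards [ae_restrict_mem measurableSet_uIoc] with s hs
    exact (G s).le_of_opNorm_le (hC s (uIoc_subset_uIcc hs)) _

variable [CompleteSpace E] [CompleteSpace F]

theorem IsPrimitiveOn.clm_comp {y φ : ℝ → E} (hy : IsPrimitiveOn y φ a b) (L : E →L[ℝ] F) :
    IsPrimitiveOn (fun t => L (y t)) (fun t => L (φ t)) a b where
  intervalIntegrable := ⟨L.integrable_comp hy.intervalIntegrable.1,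
    L.integrable_comp hy.intervalIntegrable.2⟩
  eq_add_integral t ht := by
    rw [L.intervalIntegral_comp_comm
      (hy.intervalIntegrable.mono_set (uIcc_subset_uIcc_left ht)), ← map_add,
      ← hy.eq_add_integral t ht]

theorem IsPrimitiveOn.ae_hasDerivAt {y φ : ℝ → E} (hy : IsPrimitiveOn y φ a b) :
    ∀ᵐ t, t ∈ uIcc a b → HasDerivAt y (φ t) t := by
  filter_upwards [hy.intervalIntegrable.ae_hasDerivAt_integral,
    Measure.ae_ne volume (min a b), Measure.ae_ne volume (max a b)] with t hderiv hmin hmax ht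
  refine ((hderiv ht a left_mem_uIcc).const_add (y a)).congr_of_eventuallyEq ?_
  filter_upwards [Ioo_mem_nhds (lt_of_le_of_ne ht.1 hmin.symm) (lt_of_le_of_ne ht.2 hmax)]
    with s hs using hy.eq_add_integral s (Ioo_subset_Icc_self hs)

theorem IsPrimitiveOn.ae_eq {y φ ψ : ℝ → E} (hφ : IsPrimitiveOn y φ a b)
    (hψ : IsPrimitiveOn y ψ a b) : ∀ᵐ t, t ∈ uIcc a b → φ t = ψ t := by
  filter_upwards [hφ.ae_hasDerivAt, hψ.ae_hasDerivAt] with t hφt hψt ht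
  exact (hφt ht).unique (hψt ht)

theorem isPrimitiveOn_of_ae_hasDerivAt {y φ : ℝ → E} (hy : AbsolutelyContinuousOnInterval y a b)
    (hφ : IntervalIntegrable φ volume a b)
    (hderiv : ∀ᵐ t, t ∈ uIcc a b → HasDerivAt y (φ t) t) : IsPrimitiveOn y φ a b := by
  have hΦ := isPrimitiveOn_const_add_integral hφ (0 : E)
  obtain ⟨C, hC⟩ : ∃ C, ∀ t ∈ uIcc a b, y t - (0 + ∫ s in a..t, φ s) = C := by
    refine (hy.sub hΦ.absolutelyContinuousOnInterval).const_of_ae_hasDerivAt_zero ?_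
    filter_upwards [hderiv, hΦ.ae_hasDerivAt] with t h₁ h₂ ht
    simpa using (h₁ ht).sub (h₂ ht)
  refine ⟨hφ, fun t ht => ?_⟩
  have ha := hC a left_mem_uIcc
  rw [intervalIntegral.integral_same, add_zero, sub_zero] at ha
  rw [ha, ← hC t ht]
  abel

theorem IsPrimitiveOn.clm_apply {G G' : ℝ → E →L[ℝ] F} {y φ : ℝ → E}
    (hG : ∀ t, HasDerivAt G (G' t) t) (hG' : Continuous G') (hy : IsPrimitiveOn y φ a b) :
    IsPrimitiveOn (fun t => G t (y t)) (fun t => G' t (y t) + G t (φ t)) a b := by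
  have hG_cont : Continuous G := continuous_iff_continuousAt.2 fun t => (hG t).continuousAt
  have hG_smooth : ContDiff ℝ 1 G := by
    rw [contDiff_one_iff_deriv]
    exact ⟨fun t => (hG t).differentiableAt, by rwa [funext fun t => (hG t).deriv]⟩
  refine isPrimitiveOn_of_ae_hasDerivAt (absolutelyContinuousOnInterval_clm_apply
    hG_smooth.contDiffOn.absolutelyContinuousOnInterval hy.absolutelyContinuousOnInterval) ?_ ?_
  · exact (hG'.continuousOn.clm_apply hy.continuousOn).intervalIntegrable.add
      (intervalIntegrable_clm_apply hG_cont.continuousOn hy.intervalIntegrable)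
  · filter_upwards [hy.ae_hasDerivAt] with t hyt ht using (hG t).clm_apply (hyt ht)

theorem isPrimitiveOn_deriv_of_absolutelyContinuousOnInterval {ι : Type*} [Fintype ι]
    {u : ℝ → EuclideanSpace ℝ ι} (hu : AbsolutelyContinuousOnInterval u a b) :
    IsPrimitiveOn u (deriv u) a b := by
  have hcoord : ∀ i, AbsolutelyContinuousOnInterval (fun t => u t i) a b := fun i =>
    absolutelyContinuousOnInterval_of_dist_le hu fun s _ t _ => by
      rw [dist_eq_norm, dist_eq_norm]
      exact PiLp.norm_apply_le (u s - u t) i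
  have hdiff : ∀ᵐ t, t ∈ uIcc a b → HasDerivAt u (deriv u t) t := by
    filter_upwards [ae_all_iff.2 fun i => (hcoord i).ae_differentiableAt] with t ht hmem
    exact (differentiableAt_euclidean.2 fun i => ht i hmem).hasDerivAt
  refine isPrimitiveOn_of_ae_hasDerivAt hu ?_ hdiff
  refine (IntervalIntegrable.sum Finset.univ
    fun i _ => (hcoord i).intervalIntegrable_deriv.norm).mono_fun'
    (aestronglyMeasurable_deriv u _) ?_
  rw [EventuallyLE, ae_restrict_iff' measurableSet_uIoc]
  filter_upwards [hdiff] with t ht hmem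
  have hderiv : ∀ i, deriv (fun s => u s i) t = deriv u t i := fun i =>
    ((EuclideanSpace.proj (𝕜 := ℝ) i).hasFDerivAt.comp_hasDerivAt t
      (ht (uIoc_subset_uIcc hmem))).deriv
  simp only [Finset.sum_apply, hderiv]
  rw [EuclideanSpace.norm_eq]
  refine Real.sqrt_le_iff.2 ⟨Finset.sum_nonneg fun i _ => norm_nonneg _, ?_⟩
  exact Finset.sum_sq_le_sq_sum_of_nonneg fun i _ => norm_nonneg _

theorem isPrimitiveOn_euclideanSpace {ι : Type*} [Fintype ι] {y φ : ℝ → EuclideanSpace ℝ ι}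
    (hy : ∀ i, IsPrimitiveOn (fun t => y t i) (fun t => φ t i) a b) : IsPrimitiveOn y φ a b := by
  have hφ : IntervalIntegrable φ volume a b :=
    ⟨Integrable.of_eval_piLp fun i => (hy i).intervalIntegrable.1,
      Integrable.of_eval_piLp fun i => (hy i).intervalIntegrable.2⟩
  refine ⟨hφ, fun t ht => PiLp.ext fun i => ?_⟩
  rw [PiLp.add_apply, (hy i).eq_add_integral t ht]
  exact congrArg _ ((EuclideanSpace.proj (𝕜 := ℝ) i).intervalIntegral_comp_comm
    (hφ.mono_set (uIcc_subset_uIcc_left ht)))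

end Primitive

/-! ### Strongly continuous families of operators -/

section StronglyContinuous

theorem intervalIntegrable_indicator_Ici {E : Type*} [NormedAddCommGroup E]
    {f : ℝ → E} (hf : ∀ T, 0 ≤ T → IntervalIntegrable f volume 0 T)
    (a b : ℝ) : IntervalIntegrable ((Ici 0).indicator f) volume a b := by
  have hzero : ∀ t, IntervalIntegrable ((Ici 0).indicator f) volume 0 t := fun t => by
    rcases le_total 0 t with ht | ht
    · exact (intervalIntegrable_congr fun s hs => (indicator_of_mem
        (uIoc_of_le ht ▸ hs).1.le f).symm).1 (hf t ht)
    · refine (intervalIntegrable_congr_uIoo fun s hs => (indicator_of_notMem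
        ?_ f).symm).1 (intervalIntegrable_const (c := (0 : E)))
      rw [uIoo_of_ge ht] at hs
      exact notMem_Ici.2 hs.2
  exact (hzero a).symm.trans (hzero b)

variable {X E F : Type*} [TopologicalSpace X] [NormedAddCommGroup E] [NormedSpace ℝ E]
  [CompleteSpace E] [NormedAddCommGroup F] [NormedSpace ℝ F]

theorem exists_bound_of_strongly_continuousOn {U : X → E →L[ℝ] F} {s : Set X} (hs : IsCompact s)
    (hU : ∀ v, ContinuousOn (fun t => U t v) s) : ∃ C, ∀ t ∈ s, ‖U t‖ ≤ C := by
  obtain ⟨C, hC⟩ := banach_steinhaus (g := fun t : s => U t) fun v => by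
    obtain ⟨C, hC⟩ := hs.exists_bound_of_continuousOn (hU v)
    exact ⟨C, fun t => hC t t.2⟩
  exact ⟨C, fun t ht => hC ⟨t, ht⟩⟩

theorem continuous_uncurry_of_strongly_continuous [WeaklyLocallyCompactSpace X]
    {U : X → E →L[ℝ] F} (hU : ∀ v, Continuous fun t => U t v) :
    Continuous fun q : X × E => U q.1 q.2 := by
  rw [continuous_iff_continuousAt]
  rintro ⟨t, v⟩
  obtain ⟨s, hs, hst⟩ := exists_compact_mem_nhds t
  obtain ⟨C, hC⟩ := exists_bound_of_strongly_continuousOn hs fun v => (hU v).continuousOn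
  have hlim : Tendsto (fun q : X × E => C * ‖q.2 - v‖ + ‖U q.1 v - U t v‖) (𝓝 (t, v)) (𝓝 0) := by
    have hcont := (hU v).comp (continuous_fst (X := X) (Y := E))
    simp only [Function.comp_def] at hcont
    exact Continuous.tendsto' (by fun_prop) _ _ (by simp)
  refine tendsto_iff_norm_sub_tendsto_zero.2
    (squeeze_zero' (Eventually.of_forall fun _ => norm_nonneg _) ?_ hlim)
  filter_upwards [continuous_fst.continuousAt.eventually_mem hst] with q hq
  have hsplit : U q.1 q.2 - U t v = U q.1 (q.2 - v) + (U q.1 v - U t v) := by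
    rw [map_sub]
    abel
  rw [hsplit]
  exact (norm_add_le _ _).trans (by gcongr; exact (U q.1).le_of_opNorm_le (hC _ hq) _)

variable {U : ℝ → E →L[ℝ] F} {f : ℝ → E}

theorem intervalIntegrable_convolution (hU : ∀ v, Continuous fun t => U t v) {a b : ℝ}
    (hf : IntervalIntegrable f volume a b) (t : ℝ) :
    IntervalIntegrable (fun s => U (t - s) (f s)) volume a b := by
  have hUt : ∀ v, Continuous fun s => U (t - s) v := fun v =>
    (hU v).comp (continuous_const.sub continuous_id)
  obtain ⟨C, hC⟩ := exists_bound_of_strongly_continuousOn (isCompact_uIcc (a := a) (b := b))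
    fun v => (hUt v).continuousOn
  refine (hf.norm.const_mul C).mono_fun' ?_ ?_
  · exact (continuous_uncurry_of_strongly_continuous hUt).comp_aestronglyMeasurable
      (continuous_id.aestronglyMeasurable.prodMk hf.aestronglyMeasurable_restrict_uIoc)
  · filter_upwards [ae_restrict_mem measurableSet_uIoc] with s hs
    exact (U (t - s)).le_of_opNorm_le (hC s (uIoc_subset_uIcc hs)) _

theorem continuous_convolution (hU : ∀ v, Continuous fun t => U t v)
    (hf : ∀ a b, IntervalIntegrable f volume a b) :
    Continuous fun t => ∫ s in (0 : ℝ)..t, U (t - s) (f s) := by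
  refine continuous_iff_continuousAt.2 fun t => ?_
  obtain ⟨a, ha⟩ := exists_lt (min 0 t)
  obtain ⟨b, hb⟩ := exists_gt (max 0 t)
  rw [lt_min_iff] at ha
  rw [max_lt_iff] at hb
  obtain ⟨C, hC⟩ := exists_bound_of_strongly_continuousOn
    (isCompact_Icc (a := t - 1 - b) (b := t + 1 - a)) fun v => (hU v).continuousOn
  have hprim : ContinuousAt (fun q : ℝ × ℝ => ∫ s in (0 : ℝ)..q.2, U (q.1 - s) (f s)) (t, t) := by
    refine intervalIntegral.continuousAt_parametric_primitive_of_dominated (fun s => C * ‖f s‖) a b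
      (fun r => (intervalIntegrable_convolution hU (hf a b) r).aestronglyMeasurable_restrict_uIoc)
      ?_ ((hf a b).norm.const_mul C) ?_ ⟨ha.1, hb.1⟩ ⟨ha.2, hb.2⟩ (measure_singleton t)
    · filter_upwards [Icc_mem_nhds (sub_one_lt t) (lt_add_one t)] with r hr
      filter_upwards [ae_restrict_mem measurableSet_uIoc] with s hs
      rw [uIoc_of_le (ha.1.trans hb.1).le] at hs
      exact (U (r - s)).le_of_opNorm_le
        (hC _ ⟨by linarith [hr.1, hs.2], by linarith [hr.2, hs.1]⟩) _
    · exact Eventually.of_forall fun s =>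
        ((hU (f s)).comp (continuous_id.sub continuous_const)).continuousAt
  exact hprim.comp (f := fun r => (r, r)) (continuous_id.prodMk continuous_id).continuousAt

theorem continuousOn_convolution (hU : ∀ v, Continuous fun t => U t v)
    (hf : ∀ T, 0 ≤ T → IntervalIntegrable f volume 0 T) :
    ContinuousOn (fun t => ∫ s in (0 : ℝ)..t, U (t - s) (f s)) (Ici 0) := by
  refine (continuous_convolution hU (intervalIntegrable_indicator_Ici hf)).continuousOn.congr
    fun t ht => intervalIntegral.integral_congr fun s hs => ?_
  rw [uIcc_of_le ht] at hs
  simp only [indicator_of_mem (mem_Ici.2 hs.1)]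

end StronglyContinuous

/-! ### Variation of constants -/

section VariationOfConstants

variable {E : Type*} [NormedAddCommGroup E] [NormedSpace ℝ E]

/-- The solution operator `e^{tN}` of the linear equation `y' = N y`. -/
def expFlow (N : E →L[ℝ] E) (t : ℝ) : E →L[ℝ] E := NormedSpace.exp (t • N)

theorem expFlow_zero (N : E →L[ℝ] E) : expFlow N 0 = 1 := by
  rw [expFlow, zero_smul, NormedSpace.exp_zero]

theorem expFlow_lsmul_apply {𝕜 : Type*} [RCLike 𝕜] [NormedSpace 𝕜 E] [IsScalarTower ℝ 𝕜 E]
    (ν : 𝕜) (v : E) (t : ℝ) :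
    expFlow (ContinuousLinearMap.lsmul ℝ 𝕜 ν) t v = NormedSpace.exp (t • ν) • v := by
  let _ : NormedAlgebra ℚ (E →L[ℝ] E) := NormedAlgebra.restrictScalars ℚ ℝ _
  let L : 𝕜 →+* (E →L[ℝ] E) :=
    { toFun := ContinuousLinearMap.lsmul ℝ 𝕜
      map_one' := by ext; simp
      map_mul' := fun x y => by ext w; simp [mul_smul]
      map_zero' := map_zero _
      map_add' := map_add _ }
  have hexp : L (NormedSpace.exp (t • ν)) = NormedSpace.exp (L (t • ν)) :=
    NormedSpace.map_exp L (ContinuousLinearMap.lsmul ℝ 𝕜).continuous _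
  have hsmul : L (t • ν) = t • ContinuousLinearMap.lsmul ℝ 𝕜 ν :=
    map_smul (ContinuousLinearMap.lsmul ℝ 𝕜) t ν
  rw [expFlow, ← hsmul, ← hexp]
  rfl

variable [CompleteSpace E]

theorem hasDerivAt_expFlow (N : E →L[ℝ] E) (t : ℝ) :
    HasDerivAt (expFlow N) (N * expFlow N t) t :=
  hasDerivAt_exp_smul_const' N t

theorem hasDerivAt_expFlow_neg (N : E →L[ℝ] E) (t : ℝ) :
    HasDerivAt (fun s => expFlow N (-s)) (-(expFlow N (-t) * N)) t := by
  simpa [Function.comp_def, expFlow] using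
    (hasDerivAt_exp_smul_const N (-t)).scomp t (hasDerivAt_neg t)

theorem continuous_expFlow (N : E →L[ℝ] E) : Continuous (expFlow N) :=
  continuous_iff_continuousAt.2 fun t => (hasDerivAt_expFlow N t).continuousAt

theorem expFlow_add (N : E →L[ℝ] E) (s t : ℝ) : expFlow N (s + t) = expFlow N s * expFlow N t := by
  let _ : NormedAlgebra ℚ (E →L[ℝ] E) := NormedAlgebra.restrictScalars ℚ ℝ _
  rw [expFlow, add_smul, NormedSpace.exp_add_of_commute
    (((Commute.refl N).smul_left s).smul_right t), expFlow, expFlow]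

theorem expFlow_neg_apply_expFlow (N : E →L[ℝ] E) (t : ℝ) (v : E) :
    expFlow N (-t) (expFlow N t v) = v := by
  rw [← mul_apply_eq_comp, ← expFlow_add, neg_add_cancel, expFlow_zero,
    one_apply_eq_self]

theorem expFlow_apply_expFlow_neg (N : E →L[ℝ] E) (t : ℝ) (v : E) :
    expFlow N t (expFlow N (-t) v) = v := by
  simpa using expFlow_neg_apply_expFlow N (-t) v

variable {N : E →L[ℝ] E} {f y : ℝ → E} {T : ℝ}

theorem expFlow_apply_const_add_integral (hf : IntervalIntegrable f volume 0 T) {t : ℝ}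
    (ht : t ∈ uIcc 0 T) (v : E) :
    expFlow N t (v + ∫ s in (0 : ℝ)..t, expFlow N (-s) (f s)) =
      expFlow N t v + ∫ s in (0 : ℝ)..t, expFlow N (t - s) (f s) := by
  have hint : IntervalIntegrable (fun s => expFlow N (-s) (f s)) volume 0 t :=
    intervalIntegrable_clm_apply ((continuous_expFlow N).comp continuous_neg).continuousOn
      (hf.mono_set (uIcc_subset_uIcc_left ht))
  rw [map_add, ← (expFlow N t).intervalIntegral_comp_comm hint]
  simp_rw [sub_eq_add_neg, expFlow_add, mul_apply_eq_comp]

theorem IsPrimitiveOn.eq_variation_of_constants (hf : IntervalIntegrable f volume 0 T)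
    (hy : IsPrimitiveOn y (fun t => N (y t) + f t) 0 T) {t : ℝ} (ht : t ∈ uIcc 0 T) :
    y t = expFlow N t (y 0) + ∫ s in (0 : ℝ)..t, expFlow N (t - s) (f s) := by
  have hflow : Continuous fun s => expFlow N (-s) := (continuous_expFlow N).comp continuous_neg
  have hpull : IsPrimitiveOn (fun s => expFlow N (-s) (y s)) (fun s => expFlow N (-s) (f s)) 0 T :=
    (hy.clm_apply (hasDerivAt_expFlow_neg N) (hflow.mul continuous_const).neg).congr
      (fun _ _ => rfl) fun s _ => by simp
  rw [← expFlow_apply_const_add_integral hf ht, ← expFlow_apply_expFlow_neg N t (y t),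
    hpull.eq_add_integral t ht, neg_zero, expFlow_zero, one_apply_eq_self]

theorem isPrimitiveOn_of_eq_variation_of_constants (hf : IntervalIntegrable f volume 0 T)
    (hy : ∀ t ∈ uIcc 0 T,
      y t = expFlow N t (y 0) + ∫ s in (0 : ℝ)..t, expFlow N (t - s) (f s)) :
    IsPrimitiveOn y (fun t => N (y t) + f t) 0 T := by
  set v : ℝ → E := fun t => y 0 + ∫ s in (0 : ℝ)..t, expFlow N (-s) (f s)
  have hyv : ∀ t ∈ uIcc 0 T, y t = expFlow N t (v t) := fun t ht =>
    (hy t ht).trans (expFlow_apply_const_add_integral hf ht (y 0)).symm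
  have hv_prim : IsPrimitiveOn v (fun s => expFlow N (-s) (f s)) 0 T :=
    isPrimitiveOn_const_add_integral (intervalIntegrable_clm_apply
      ((continuous_expFlow N).comp continuous_neg).continuousOn hf) (y 0)
  refine (hv_prim.clm_apply (hasDerivAt_expFlow N)
    (continuous_const.mul (continuous_expFlow N))).congr hyv fun t ht => ?_
  simp only [hyv t ht, expFlow_apply_expFlow_neg, mul_apply_eq_comp]

end VariationOfConstants

/-! ### The method of steps -/

theorem exists_fixedPoint_of_delay {α : Type*} {N : (ℝ → α) → ℝ → α} {δ : ℝ} (hδ : 0 < δ)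
    (hN₀ : ∀ X X', EqOn (N X) (N X') (Iic 0))
    (hN : ∀ X X' τ, EqOn X X' (Iic τ) → EqOn (N X) (N X') (Iic (τ + δ))) (X₀ : ℝ → α) :
    ∃ X, N X = X ∧ ∀ T, ∃ n, EqOn X (N^[n] X₀) (Iic T) := by
  have hstep (n : ℕ) : EqOn (N^[n + 1] X₀) (N^[n + 2] X₀) (Iic (n * δ)) := by
    induction n with
    | zero => simpa using hN₀ X₀ (N X₀)
    | succ n ih =>
      rw [Function.iterate_succ_apply' N (n + 1), Function.iterate_succ_apply' N (n + 2)]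
      simpa only [Nat.cast_add_one, add_one_mul] using hN _ _ _ ih
  have hstable (n m : ℕ) (hnm : n ≤ m) :
      EqOn (N^[n + 1] X₀) (N^[m + 1] X₀) (Iic (n * δ)) := by
    induction m, hnm using Nat.le_induction with
    | base => exact fun t _ => rfl
    | succ m hnm ih =>
      exact ih.trans ((hstep m).mono (Iic_subset_Iic.2 (by gcongr)))
  set X : ℝ → α := fun t => N^[⌈t / δ⌉₊ + 1] X₀ t
  have hXn (n : ℕ) : EqOn X (N^[n + 1] X₀) (Iic (n * δ)) := fun t ht =>
    hstable _ _ (Nat.ceil_le.2 ((div_le_iff₀ hδ).2 ht)) ((div_le_iff₀ hδ).1 (Nat.le_ceil _))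
  have hlarge (T : ℝ) : ∃ n : ℕ, T ≤ n * δ :=
    ⟨⌈T / δ⌉₊, (div_le_iff₀ hδ).1 (Nat.le_ceil _)⟩
  refine ⟨X, funext fun t => ?_, fun T => ?_⟩
  · obtain ⟨n, hn⟩ := hlarge t
    rw [hN _ _ _ (hXn n) (show t ≤ n * δ + δ by linarith), ← Function.iterate_succ_apply' N,
      hXn (n + 1) (show t ≤ (n + 1 : ℕ) * δ by push_cast; linarith)]
  · obtain ⟨n, hn⟩ := hlarge T
    exact ⟨n + 1, (hXn n).mono (Iic_subset_Iic.2 hn)⟩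

theorem eqOn_of_delay {α : Type*} {X X' : ℝ → α} {δ hM : ℝ} (hδ : 0 < δ)
    (hhist : EqOn X X' (Icc (-hM) 0))
    (hstep : ∀ t, 0 ≤ t → EqOn X X' (Icc (-hM) (t - δ)) → X t = X' t) :
    EqOn X X' (Ici (-hM)) := by
  have key (n : ℕ) : EqOn X X' (Icc (-hM) (n * δ)) := by
    induction n with
    | zero => simpa using hhist
    | succ n ih =>
      rintro t ⟨ht, htn⟩
      rcases le_total t 0 with ht0 | ht0
      · exact hhist ⟨ht, ht0⟩
      · refine hstep t ht0 (ih.mono (Icc_subset_Icc_right ?_))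
        push_cast at htn
        linarith
  exact fun t ht => key ⌈t / δ⌉₊ ⟨ht, (div_le_iff₀ hδ).1 (Nat.le_ceil _)⟩

/-! ### Evolution equations with a delay bounded away from zero -/

/-- A continuous time-varying delay on `[0, ∞)` with values in `[hm, hM]`, bounded away from
zero. -/
structure IsDelay (hm hM : ℝ) (h : ℝ → ℝ) : Prop where
  pos : 0 < hm
  continuousOn : ContinuousOn h (Ici 0)
  bounds : ∀ t, 0 ≤ t → hm ≤ h t ∧ h t ≤ hM

section Delay
variable {h : ℝ → ℝ} {hm hM : ℝ}

theorem IsDelay.hM_pos (hh : IsDelay hm hM h) : 0 < hM :=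
  hh.pos.trans_le ((hh.bounds 0 le_rfl).1.trans (hh.bounds 0 le_rfl).2)

theorem IsDelay.sub_mem_Icc (hh : IsDelay hm hM h) {s t τ : ℝ} (hs : s ∈ Icc 0 t)
    (hτ : t ≤ τ + hm) : s - h s ∈ Icc (-hM) τ :=
  have hb := hh.bounds s hs.1
  ⟨by linarith [hs.1], by linarith [hs.2]⟩

theorem IsDelay.integral_congr {α F : Type*} [NormedAddCommGroup F] [NormedSpace ℝ F]
    (hh : IsDelay hm hM h) {X X' : ℝ → α} {Ξ : ℝ → α → F} {t τ : ℝ} (ht : 0 ≤ t)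
    (hτ : t ≤ τ + hm) (hX : EqOn X X' (Icc (-hM) τ)) :
    ∫ s in (0 : ℝ)..t, Ξ s (X (s - h s)) = ∫ s in (0 : ℝ)..t, Ξ s (X' (s - h s)) := by
  refine intervalIntegral.integral_congr fun s hs => congrArg (Ξ s) (hX ?_)
  rw [uIcc_of_le ht] at hs
  exact hh.sub_mem_Icc hs hτ

variable {E : Type*} [NormedAddCommGroup E]

theorem IsDelay.continuousOn_comp {X : ℝ → E} (hh : IsDelay hm hM h)
    (hX : ContinuousOn X (Ici (-hM))) : ContinuousOn (fun s => X (s - h s)) (Ici 0) :=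
  hX.comp (continuousOn_id.sub hh.continuousOn) fun s (hs : 0 ≤ s) =>
    show -hM ≤ s - h s by linarith [hh.bounds s hs]

theorem continuousOn_ite_le {Φ G : ℝ → E} (hΦ : ContinuousOn Φ (Icc (-hM) 0))
    (hG : ContinuousOn G (Ici 0)) (h0 : G 0 = Φ 0) :
    ContinuousOn (fun t => if t ≤ 0 then Φ t else G t) (Ici (-hM)) := by
  refine ContinuousOn.if (fun t ht => ?_) (hΦ.mono ?_) (hG.mono ?_)
  · obtain rfl : t = 0 := by simpa only [Iic_def, frontier_Iic, mem_singleton_iff] using ht.2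
    exact h0.symm
  · rintro t ⟨ht, ht'⟩
    exact ⟨ht, isClosed_Iic.closure_eq.subset ht'⟩
  · rintro t ⟨-, ht⟩
    simpa only [not_le, Ioi_def, closure_Ioi] using ht

theorem intervalIntegrable_of_continuousOn_Ici {f : ℝ → E} (hf : ContinuousOn f (Ici 0)) {T : ℝ}
    (hT : 0 ≤ T) : IntervalIntegrable f volume 0 T :=
  (hf.mono (uIcc_of_le hT ▸ Icc_subset_Ici_self)).intervalIntegrable

variable [NormedSpace ℝ E]

theorem IsDelay.intervalIntegrable_smul_comp {X : ℝ → E} (hh : IsDelay hm hM h)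
    (hX : ContinuousOn X (Ici (-hM))) (c : ℝ) {T : ℝ} (hT : 0 ≤ T) :
    IntervalIntegrable (fun s => c • X (s - h s)) volume 0 T :=
  intervalIntegrable_of_continuousOn_Ici ((hh.continuousOn_comp hX).const_smul c) hT

variable [CompleteSpace E]

/-- The right-hand side of the Volterra equation `X t = g t + ∫₀ᵗ U (t - s) (c X (s - h s)) ds`
with history `Φ`, as an operator on all functions `X`. -/
def volterraStep (U : ℝ → E →L[ℝ] E) (g Φ : ℝ → E) (h : ℝ → ℝ) (c : ℝ) (X : ℝ → E) (t : ℝ) : E :=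
  if t ≤ 0 then Φ t else g t + ∫ s in (0 : ℝ)..t, U (t - s) (c • X (s - h s))

theorem continuousOn_volterraStep (hh : IsDelay hm hM h) {U : ℝ → E →L[ℝ] E}
    (hU : ∀ v, Continuous fun t => U t v) {g Φ : ℝ → E} (c : ℝ) (hg : ContinuousOn g (Ici 0))
    (hΦ : ContinuousOn Φ (Icc (-hM) 0)) (hg0 : g 0 = Φ 0) {X : ℝ → E}
    (hX : ContinuousOn X (Ici (-hM))) :
    ContinuousOn (volterraStep U g Φ h c X) (Ici (-hM)) :=
  continuousOn_ite_le hΦ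
    (hg.add (continuousOn_convolution hU fun _ hT => hh.intervalIntegrable_smul_comp hX c hT))
    (by simp [hg0])

theorem exists_delay_volterra (hh : IsDelay hm hM h) {U : ℝ → E →L[ℝ] E}
    (hU : ∀ v, Continuous fun t => U t v) {g Φ : ℝ → E} (c : ℝ) (hg : ContinuousOn g (Ici 0))
    (hΦ : ContinuousOn Φ (Icc (-hM) 0)) (hg0 : g 0 = Φ 0) :
    ∃ X : ℝ → E, ContinuousOn X (Ici (-hM)) ∧ EqOn X Φ (Icc (-hM) 0) ∧
      ∀ t, 0 ≤ t → X t = g t + ∫ s in (0 : ℝ)..t, U (t - s) (c • X (s - h s)) := by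
  obtain ⟨X, hX, hXn⟩ := exists_fixedPoint_of_delay (N := volterraStep U g Φ h c) hh.pos
    (fun X X' t (ht : t ≤ 0) => by simp only [volterraStep, if_pos ht])
    (fun X X' τ hXX' t (ht : t ≤ τ + hm) => by
      rcases le_or_gt t 0 with h0 | h0
      · simp only [volterraStep, if_pos h0]
      · simp only [volterraStep, if_neg h0.not_ge]
        exact congrArg _ (hh.integral_congr (Ξ := fun s v => U (t - s) (c • v)) h0.le ht
          (hXX'.mono Icc_subset_Iic_self))) 0
  refine ⟨X, fun t ht => ?_, fun t ht => ?_, fun t ht => ?_⟩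
  · have hcont (n : ℕ) : ContinuousOn ((volterraStep U g Φ h c)^[n] 0) (Ici (-hM)) := by
      induction n with
      | zero => exact continuousOn_const
      | succ n ih =>
        rw [Function.iterate_succ_apply']
        exact continuousOn_volterraStep hh hU c hg hΦ hg0 ih
    obtain ⟨n, hn⟩ := hXn (t + 1)
    exact (hcont n t ht).congr_of_eventuallyEq
      ((hn.eventuallyEq_of_mem (Iic_mem_nhds (lt_add_one t))).filter_mono nhdsWithin_le_nhds)
      (hn (lt_add_one t).le)
  · rw [← hX]
    exact if_pos ht.2
  · rcases ht.eq_or_lt with rfl | ht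
    · rw [intervalIntegral.integral_same, add_zero, hg0, ← hX]
      exact if_pos le_rfl
    · nth_rewrite 1 [← hX]
      exact if_neg ht.not_ge

end Delay

/-! ### Linear delay differential equations -/

section DelaySolution
variable {E F : Type*} [NormedAddCommGroup E] [NormedSpace ℝ E] [NormedAddCommGroup F]
  [NormedSpace ℝ F] {h : ℝ → ℝ} {c hm hM : ℝ} {N : E →L[ℝ] E} {w Y : ℝ → E}

/-- `Y` is a locally absolutely continuous solution of `Y'(t) = N Y(t) + c Y(t - h(t)) + w(t)` for
`t ≥ 0`, its history being the restriction of `Y` to `[-hM, 0]`. -/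
structure IsDelaySolution (N : E →L[ℝ] E) (c hM : ℝ) (h : ℝ → ℝ) (w Y : ℝ → E) : Prop where
  continuousOn : ContinuousOn Y (Ici (-hM))
  isPrimitiveOn : ∀ T, 0 ≤ T → IsPrimitiveOn Y (fun t => N (Y t) + (c • Y (t - h t) + w t)) 0 T

theorem IsDelaySolution.intervalIntegrable (hY : IsDelaySolution N c hM h w Y)
    (hh : IsDelay hm hM h) {T : ℝ} (hT : 0 ≤ T) :
    IntervalIntegrable (fun t => c • Y (t - h t) + w t) volume 0 T := by
  have hN : ContinuousOn (fun t => N (Y t)) (Ici 0) :=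
    N.continuous.comp_continuousOn
      (hY.continuousOn.mono (Ici_subset_Ici.2 (neg_nonpos.2 hh.hM_pos.le)))
  simpa only [add_sub_cancel_left] using (hY.isPrimitiveOn T hT).intervalIntegrable.sub
    (intervalIntegrable_of_continuousOn_Ici hN hT)

variable [CompleteSpace E]

theorem IsDelaySolution.clm_comp [CompleteSpace F] {N' : F →L[ℝ] F} {w' : ℝ → F}
    (hY : IsDelaySolution N c hM h w Y) (L : E →L[ℝ] F)
    (hL : ∀ t, 0 ≤ t → L (N (Y t)) + L (w t) = N' (L (Y t)) + w' t) :
    IsDelaySolution N' c hM h w' fun t => L (Y t) where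
  continuousOn := L.continuous.comp_continuousOn hY.continuousOn
  isPrimitiveOn T hT := ((hY.isPrimitiveOn T hT).clm_comp L).congr (fun _ _ => rfl) fun t ht => by
    rw [uIcc_of_le hT] at ht
    simp only [map_add, map_smul]
    rw [add_left_comm, ← hL t ht.1, add_left_comm]

theorem IsDelaySolution.eq_variation_of_constants (hY : IsDelaySolution N c hM h w Y)
    (hh : IsDelay hm hM h) {t : ℝ} (ht : 0 ≤ t) :
    Y t = expFlow N t (Y 0) + ∫ s in (0 : ℝ)..t, expFlow N (t - s) (c • Y (s - h s) + w s) :=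
  (hY.isPrimitiveOn t ht).eq_variation_of_constants (hY.intervalIntegrable hh ht) right_mem_uIcc

theorem IsDelaySolution.eqOn {Y' : ℝ → E} (hh : IsDelay hm hM h)
    (hY : IsDelaySolution N c hM h w Y) (hY' : IsDelaySolution N c hM h w Y')
    (hhist : EqOn Y Y' (Icc (-hM) 0)) : EqOn Y Y' (Ici (-hM)) :=
  eqOn_of_delay hh.pos hhist fun t ht hpast => by
    rw [hY.eq_variation_of_constants hh ht, hY'.eq_variation_of_constants hh ht,
      hhist ⟨neg_nonpos.2 hh.hM_pos.le, le_rfl⟩,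
      hh.integral_congr (Ξ := fun s v => expFlow N (t - s) (c • v + w s)) ht
        (sub_add_cancel t hm).ge hpast]

theorem exists_isDelaySolution (hh : IsDelay hm hM h) (N : E →L[ℝ] E) (c : ℝ) {Ψ : ℝ → E}
    (hw : ∀ T, 0 ≤ T → IntervalIntegrable w volume 0 T) (hΨ : ContinuousOn Ψ (Icc (-hM) 0)) :
    ∃ Y : ℝ → E, IsDelaySolution N c hM h w Y ∧ EqOn Y Ψ (Icc (-hM) 0) := by
  have hexp (v : E) : Continuous fun t => expFlow N t v :=
    (continuous_expFlow N).clm_apply continuous_const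
  obtain ⟨Y, hYc, hYΨ, hY⟩ := exists_delay_volterra hh hexp
    (g := fun t => expFlow N t (Ψ 0) + ∫ s in (0 : ℝ)..t, expFlow N (t - s) (w s)) c
    ((hexp _).continuousOn.add (continuousOn_convolution hexp hw)) hΨ (by simp [expFlow_zero])
  refine ⟨Y, ⟨hYc, fun T hT => ?_⟩, hYΨ⟩
  have hdelay (t : ℝ) (ht : 0 ≤ t) := hh.intervalIntegrable_smul_comp hYc c ht
  have hY0 : Y 0 = Ψ 0 := by simpa [expFlow_zero] using hY 0 le_rfl
  refine isPrimitiveOn_of_eq_variation_of_constants ((hdelay T hT).add (hw T hT)) fun t ht => ?_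
  rw [uIcc_of_le hT] at ht
  rw [hY t ht.1, hY0, add_assoc, ← intervalIntegral.integral_add
    (intervalIntegrable_convolution hexp (hw t ht.1) t)
    (intervalIntegrable_convolution hexp (hdelay t ht.1) t)]
  simp only [map_add, add_comm]

end DelaySolution

/-! ### Exponential decay under a small delayed perturbation -/

/-- `κ` is an exponential decay rate of `z' = -α z + c z(t - h(t))` for all delays bounded by
`hM`. -/
structure IsDecayRate (α c hM κ : ℝ) : Prop where
  pos : 0 < κ
  lt : |c| * Real.exp (κ * hM) < α - κ

theorem exists_isDecayRate {α c : ℝ} (h : |c| < α) (hM : ℝ) : ∃ κ, IsDecayRate α c hM κ := by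
  have hcont : Continuous fun κ : ℝ => |c| * Real.exp (κ * hM) + κ := by fun_prop
  have hev : ∀ᶠ κ in 𝓝 (0 : ℝ), |c| * Real.exp (κ * hM) + κ < α :=
    hcont.continuousAt.eventually_lt continuousAt_const (by simpa using h)
  obtain ⟨κ, hκ, hpos⟩ := ((hev.filter_mono nhdsWithin_le_nhds).and
    (self_mem_nhdsWithin (a := (0 : ℝ)) (s := Ioi 0))).exists
  exact ⟨κ, hpos, lt_sub_iff_add_lt.2 hκ⟩

theorem IsDecayRate.sub_pos {α c hM κ : ℝ} (hr : IsDecayRate α c hM κ) : 0 < α - κ :=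
  lt_of_le_of_lt (by positivity) hr.lt

/-- The constant with which the history and the disturbance bound the solutions of
`z' = -α z + c z(t - h(t)) + w` in the norm weighted by `e^{κ t}`. -/
def delayGain (α c hM κ : ℝ) : ℝ :=
  (1 + 1 / (α - κ)) / (1 - |c| * Real.exp (κ * hM) / (α - κ))

theorem IsDecayRate.delayGain_nonneg {α c hM κ : ℝ} (hr : IsDecayRate α c hM κ) :
    0 ≤ delayGain α c hM κ := by
  have := hr.sub_pos
  have := (div_lt_one hr.sub_pos).2 hr.lt
  exact div_nonneg (by positivity) (by linarith)

theorem exp_mul_le_iff {κ t x m : ℝ} : Real.exp (κ * t) * x ≤ m ↔ x ≤ Real.exp (-κ * t) * m := by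
  rw [neg_mul, Real.exp_neg, le_inv_mul_iff₀ (Real.exp_pos _)]

section Decay
variable {E : Type*} [NormedAddCommGroup E] {h : ℝ → ℝ} {α c κ hm hM T : ℝ}

/-- `F` bounds the history of `Y` on `[-hM, 0]`, and `D` bounds the disturbance `w` up to time `T`
in the norm weighted by `e^{κ t}`. -/
structure IsDataBound (κ hM T : ℝ) (Y w : ℝ → E) (F D : ℝ) : Prop where
  time_nonneg : 0 ≤ T
  nonneg : 0 ≤ D
  history : ∀ t ∈ Icc (-hM) 0, ‖Y t‖ ≤ F
  disturbance : ∀ᵐ s, s ∈ Ioc 0 T → ‖w s‖ ≤ Real.exp (-κ * s) * D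

theorem IsDataBound.history_nonneg {Y w : ℝ → E} {F D : ℝ} (hD : IsDataBound κ hM T Y w F D)
    (hM0 : 0 ≤ hM) : 0 ≤ F :=
  (norm_nonneg (Y 0)).trans (hD.history 0 ⟨neg_nonpos.2 hM0, le_rfl⟩)

theorem norm_le_of_small_gain {z : ℝ → E} {m₀ q : ℝ} (hM0 : 0 ≤ hM) (hT : 0 ≤ T)
    (hz : ContinuousOn z (Icc (-hM) T)) (hq0 : 0 ≤ q) (hq : q < 1)
    (hhist : ∀ t ∈ Icc (-hM) 0, ‖z t‖ ≤ Real.exp (-κ * t) * m₀)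
    (hgain : ∀ t ∈ Icc 0 T, ∀ m, 0 ≤ m → (∀ s ∈ Icc (-hM) t, ‖z s‖ ≤ Real.exp (-κ * s) * m) →
      ‖z t‖ ≤ Real.exp (-κ * t) * (m₀ + q * m)) :
    ∀ t ∈ Icc (-hM) T, ‖z t‖ ≤ Real.exp (-κ * t) * (m₀ / (1 - q)) := by
  have hcont : ContinuousOn (fun t => Real.exp (κ * t) * ‖z t‖) (Icc (-hM) T) :=
    (by fun_prop : Continuous fun t => Real.exp (κ * t)).continuousOn.mul hz.norm
  obtain ⟨τ, hτ, hmax⟩ :=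
    isCompact_Icc.exists_isMaxOn ⟨0, neg_nonpos.2 hM0, hT⟩ hcont
  set m := Real.exp (κ * τ) * ‖z τ‖
  have hm0 : 0 ≤ m := by positivity
  have hself : m ≤ m₀ + q * m := by
    rcases le_total τ 0 with h0 | h0
    · exact (exp_mul_le_iff.2 (hhist τ ⟨hτ.1, h0⟩)).trans (le_add_of_nonneg_right (by positivity))
    · exact exp_mul_le_iff.2 (hgain τ ⟨h0, hτ.2⟩ m hm0 fun s hs =>
        exp_mul_le_iff.1 (hmax ⟨hs.1, hs.2.trans hτ.2⟩))
  have hbound : m ≤ m₀ / (1 - q) := (le_div_iff₀ (by linarith)).2 (by linarith)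
  exact fun t ht => exp_mul_le_iff.1 ((hmax ht).trans hbound)

theorem IsDelay.norm_comp_le (hh : IsDelay hm hM h) (hκ : 0 ≤ κ) {z : ℝ → E} {s t m : ℝ}
    (hs : s ∈ Icc 0 t) (hm0 : 0 ≤ m)
    (hz : ∀ s ∈ Icc (-hM) t, ‖z s‖ ≤ Real.exp (-κ * s) * m) :
    ‖z (s - h s)‖ ≤ Real.exp (-κ * s) * (Real.exp (κ * hM) * m) := by
  refine (hz _ (hh.sub_mem_Icc hs (le_add_of_nonneg_right hh.pos.le))).trans ?_
  rw [← mul_assoc, ← Real.exp_add]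
  gcongr
  nlinarith [hh.bounds s hs.1]

variable [NormedSpace ℝ E]

theorem norm_integral_le_of_exp_weight {g : ℝ → E} {t G : ℝ} (ht : 0 ≤ t) (hκ : κ < α)
    (hG : 0 ≤ G)
    (hg : ∀ᵐ s, s ∈ Ioc 0 t → ‖g s‖ ≤ Real.exp (-α * (t - s)) * (Real.exp (-κ * s) * G)) :
    ‖∫ s in (0 : ℝ)..t, g s‖ ≤ Real.exp (-κ * t) * (G / (α - κ)) := by
  have hδ : 0 < α - κ := sub_pos.2 hκ
  have hweight (s : ℝ) : Real.exp (-α * (t - s)) * (Real.exp (-κ * s) * G) =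
      Real.exp (-κ * t) * G * Real.exp ((α - κ) * s - (α - κ) * t) := by
    rw [mul_right_comm, ← mul_assoc, ← Real.exp_add, ← Real.exp_add]
    ring_nf
  have hexp : ∫ s in (0 : ℝ)..t, Real.exp ((α - κ) * s - (α - κ) * t) ≤ (α - κ)⁻¹ := by
    rw [intervalIntegral.integral_comp_mul_sub _ hδ.ne', integral_exp, sub_self, Real.exp_zero,
      smul_eq_mul]
    exact mul_le_of_le_one_right (by positivity) (sub_le_self _ (Real.exp_pos _).le)
  simp only [hweight] at hg
  calc ‖∫ s in (0 : ℝ)..t, g s‖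
      ≤ ∫ s in (0 : ℝ)..t, Real.exp (-κ * t) * G * Real.exp ((α - κ) * s - (α - κ) * t) :=
        intervalIntegral.norm_integral_le_of_norm_le ht hg
          ((by fun_prop : Continuous _).intervalIntegrable 0 t)
    _ ≤ Real.exp (-κ * t) * G * (α - κ)⁻¹ := by
        rw [intervalIntegral.integral_const_mul]
        gcongr
    _ = Real.exp (-κ * t) * (G / (α - κ)) := by rw [mul_assoc, div_eq_mul_inv]

theorem IsDelay.norm_le_of_duhamel (hh : IsDelay hm hM h) (hr : IsDecayRate α c hM κ)
    {V : ℝ → E →L[ℝ] E} (hV : ∀ t, 0 ≤ t → ‖V t‖ ≤ Real.exp (-α * t)) {z w : ℝ → E} {F D : ℝ}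
    (hz : ContinuousOn z (Ici (-hM)))
    (hrep : ∀ t, 0 ≤ t →
      z t = V t (z 0) + ∫ s in (0 : ℝ)..t, V (t - s) (c • z (s - h s) + w s))
    (hD : IsDataBound κ hM T z w F D) :
    ∀ t ∈ Icc (-hM) T, ‖z t‖ ≤ Real.exp (-κ * t) * (delayGain α c hM κ * (F + D)) := by
  have hακ := hr.sub_pos
  have hF0 : 0 ≤ F := hD.history_nonneg hh.hM_pos.le
  have hD0 := hD.nonneg
  set m₀ := (1 + 1 / (α - κ)) * (F + D) with hm₀
  have hFm₀ : F + D / (α - κ) ≤ m₀ := by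
    have : 0 ≤ D + F / (α - κ) := by positivity
    linear_combination this
  rw [delayGain, div_mul_eq_mul_div, ← hm₀]
  refine norm_le_of_small_gain hh.hM_pos.le hD.time_nonneg (hz.mono Icc_subset_Ici_self)
    (by positivity) ((div_lt_one hακ).2 hr.lt) (fun t ht => ?_) fun t ht m hm0 hzm => ?_
  · have hexp : 1 ≤ Real.exp (-κ * t) := Real.one_le_exp (by nlinarith [hr.pos, ht.2])
    have hFm : F ≤ m₀ := (le_add_of_nonneg_right (by positivity)).trans hFm₀
    nlinarith [hD.history t ht]
  · have hfree : ‖V t (z 0)‖ ≤ Real.exp (-κ * t) * F := by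
      refine ((V t).le_of_opNorm_le_of_le (hV t ht.1)
        (hD.history 0 ⟨neg_nonpos.2 hh.hM_pos.le, le_rfl⟩)).trans ?_
      gcongr
      · exact ht.1
      · linarith
    have hforced := norm_integral_le_of_exp_weight (κ := κ) (α := α) ht.1 (by linarith)
      (G := |c| * (Real.exp (κ * hM) * m) + D)
      (g := fun s => V (t - s) (c • z (s - h s) + w s)) (by positivity) (by
        filter_upwards [hD.disturbance] with s hs hst
        refine (V (t - s)).le_of_opNorm_le_of_le (hV _ (sub_nonneg.2 hst.2))
          ((norm_add_le _ _).trans ?_)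
        rw [norm_smul, Real.norm_eq_abs, mul_add, mul_left_comm]
        gcongr
        · exact hh.norm_comp_le hr.pos.le ⟨hst.1.le, hst.2⟩ hm0 hzm
        · exact hs ⟨hst.1, hst.2.trans ht.2⟩)
    rw [hrep t ht.1]
    refine ((norm_add_le _ _).trans (add_le_add hfree hforced)).trans ?_
    rw [← mul_add]
    refine mul_le_mul_of_nonneg_left ?_ (Real.exp_pos _).le
    linear_combination hFm₀

end Decay

section AlgebraicDecay
variable {E : Type*} [NormedAddCommGroup E] [NormedSpace ℝ E] [NormedSpace ℂ E]
  [IsScalarTower ℝ ℂ E] {h : ℝ → ℝ} {α c κ hm hM T : ℝ}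

/-- The images `G Y` of the solutions of `Y'(t) = N Y(t) + c Y(t - h(t)) + w(t)` decay at the rate
`κ`, uniformly over the data and over the delays `h` with values in `[hm, hM]`. -/
def IsDecayingImage (N : E →L[ℂ] E) (c κ hm hM : ℝ) (G : E →L[ℂ] E) : Prop :=
  ∃ C, 0 ≤ C ∧ ∀ ⦃h w Y T F D⦄, IsDelay hm hM h →
    IsDelaySolution (N.restrictScalars ℝ) c hM h w Y → IsDataBound κ hM T Y w F D →
    ∀ t ∈ Icc (-hM) T, ‖G (Y t)‖ ≤ Real.exp (-κ * t) * (C * (F + D))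

theorem norm_expFlow_lsmul_le {ν : ℂ} (hν : ν.re ≤ -α) {t : ℝ} (ht : 0 ≤ t) :
    ‖expFlow (ContinuousLinearMap.lsmul ℝ ℂ ν : E →L[ℝ] E) t‖ ≤ Real.exp (-α * t) := by
  refine ContinuousLinearMap.opNorm_le_bound _ (Real.exp_pos _).le fun v => ?_
  rw [expFlow_lsmul_apply, norm_smul, ← Complex.exp_eq_exp_ℂ, Complex.norm_exp, Complex.real_smul,
    Complex.re_ofReal_mul, mul_comm t]
  gcongr

variable [CompleteSpace E]

/- `z = G Y` solves `z' = ν z + c z(t - h(t)) + (G (N - ν) Y + G w)`, a scalar equation whose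
disturbance is already known to decay. -/
theorem IsDecayingImage.of_mul_sub {N G : E →L[ℂ] E} {ν : ℂ} (hr : IsDecayRate α c hM κ)
    (hν : ν.re ≤ -α) (hG : IsDecayingImage N c κ hm hM (G * (N - algebraMap ℂ _ ν))) :
    IsDecayingImage N c κ hm hM G := by
  obtain ⟨C, hC, hbound⟩ := hG
  have hgain := hr.delayGain_nonneg
  refine ⟨delayGain α c hM κ * (C + ‖G‖), by positivity, fun h w Y T F D hh hY hD t ht => ?_⟩
  set R := G * (N - algebraMap ℂ _ ν) with hR
  have hz : IsDelaySolution (ContinuousLinearMap.lsmul ℝ ℂ ν) c hM h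
      (fun t => R (Y t) + G (w t)) fun t => G (Y t) :=
    hY.clm_comp (G.restrictScalars ℝ) fun s _ => by
      simp [hR, mul_apply_eq_comp, Algebra.algebraMap_eq_smul_one, ← add_assoc]
  have hF := hD.history_nonneg hh.hM_pos.le
  have hzD : IsDataBound κ hM T (fun t => G (Y t)) (fun t => R (Y t) + G (w t))
      (‖G‖ * F) (C * (F + D) + ‖G‖ * D) :=
    { time_nonneg := hD.time_nonneg
      nonneg := by have := hD.nonneg; positivity
      history := fun s hs => G.le_opNorm_of_le (hD.history s hs)
      disturbance := by
        filter_upwards [hD.disturbance] with s hs hsT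
        have hRY := hbound hh hY hD s ⟨by linarith [hh.hM_pos, hsT.1], hsT.2⟩
        have hGw := G.le_opNorm_of_le (hs hsT)
        refine (norm_add_le_of_le hRY hGw).trans_eq ?_
        ring }
  refine (hh.norm_le_of_duhamel hr (fun s hs => norm_expFlow_lsmul_le hν hs) hz.continuousOn
    (fun s hs => hz.eq_variation_of_constants hh hs) hzD t ht).trans_eq ?_
  ring

theorem isDecayingImage_of_mul_aeval_eq_zero {N : E →L[ℂ] E} (hr : IsDecayRate α c hM κ)
    {s : Multiset ℂ} (hs : ∀ ν ∈ s, ν.re ≤ -α) {G : E →L[ℂ] E}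
    (hG : G * Polynomial.aeval N (s.map fun ν => Polynomial.X - Polynomial.C ν).prod = 0) :
    IsDecayingImage N c κ hm hM G := by
  induction s using Multiset.induction_on generalizing G with
  | empty =>
    obtain rfl : G = 0 := by simpa using hG
    exact ⟨0, le_rfl, by simp⟩
  | cons ν s ih =>
    refine .of_mul_sub hr (hs ν (Multiset.mem_cons_self ν s))
      (ih (fun μ hμ => hs μ (Multiset.mem_cons_of_mem hμ)) ?_)
    simpa [mul_assoc] using hG

end AlgebraicDecay

section MatrixDecay
variable {ι : Type*} [Fintype ι] [DecidableEq ι] {α c κ hm hM : ℝ}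

/-- The inclusion of `ℝ^ι` in `ℂ^ι`. -/
def complexify : EuclideanSpace ℝ ι →ₗᵢ[ℝ] EuclideanSpace ℂ ι where
  toFun v := WithLp.toLp 2 fun i => (v i : ℂ)
  map_add' _ _ := by ext; simp
  map_smul' _ _ := by ext; simp
  norm_map' v := by simp [EuclideanSpace.norm_eq]

theorem complexify_toEuclideanCLM (M : Matrix ι ι ℝ) (v : EuclideanSpace ℝ ι) :
    complexify (Matrix.toEuclideanCLM (𝕜 := ℝ) M v) =
      Matrix.toEuclideanCLM (𝕜 := ℂ) (M.map (algebraMap ℝ ℂ)) (complexify v) := by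
  ext i
  simp [complexify, Matrix.ofLp_toEuclideanCLM, Matrix.mulVec, dotProduct]

theorem isDecayingImage_one_toEuclideanCLM (hr : IsDecayRate α c hM κ) {M : Matrix ι ι ℂ}
    (hν : ∀ ν ∈ M.charpoly.roots, ν.re ≤ -α) :
    IsDecayingImage (Matrix.toEuclideanCLM (𝕜 := ℂ) M) c κ hm hM 1 :=
  isDecayingImage_of_mul_aeval_eq_zero hr hν <| by
    rw [← (IsAlgClosed.splits M.charpoly).eq_prod_roots_of_monic M.charpoly_monic, one_mul,
      Polynomial.aeval_algHom_apply, Matrix.aeval_self_charpoly, map_zero]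

theorem exists_norm_le_of_isDelaySolution_matrix (hr : IsDecayRate α c hM κ) {M : Matrix ι ι ℝ}
    (hν : ∀ ν ∈ (M.map (algebraMap ℝ ℂ)).charpoly.roots, ν.re ≤ -α) :
    ∃ C, 0 ≤ C ∧ ∀ ⦃h w Y T F D⦄, IsDelay hm hM h →
      IsDelaySolution (Matrix.toEuclideanCLM (𝕜 := ℝ) M) c hM h w Y →
      IsDataBound κ hM T Y w F D →
      ∀ t ∈ Icc (-hM) T, ‖Y t‖ ≤ Real.exp (-κ * t) * (C * (F + D)) := by
  obtain ⟨C, hC, hbound⟩ := isDecayingImage_one_toEuclideanCLM (hm := hm) hr hν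
  refine ⟨C, hC, fun h w Y T F D hh hY hD t ht => ?_⟩
  have hJY := hY.clm_comp complexify.toContinuousLinearMap
    (N' := (Matrix.toEuclideanCLM (𝕜 := ℂ) (M.map (algebraMap ℝ ℂ))).restrictScalars ℝ)
    (w' := fun t => complexify (w t)) fun s _ => by
      simp [complexify_toEuclideanCLM]
  simpa using hbound hh hJY ⟨hD.time_nonneg, hD.nonneg, by simpa using hD.history,
    by simpa using hD.disturbance⟩ t ht

end MatrixDecay

/-! ### Compact integral operators on `L²(0,1)` -/

section Kernel

variable {α E F G : Type*} [MeasurableSpace α] {μ : Measure α} [IsFiniteMeasure μ]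
  {p : ENNReal} [Fact (1 ≤ p)] [NormedAddCommGroup E] [NormedSpace ℝ E] [NormedAddCommGroup F]
  [NormedSpace ℝ F] [NormedAddCommGroup G] [NormedSpace ℝ G]

/-- The operator `g ↦ (x ↦ B (k x) g)` with kernel `k ∈ Lᵖ(μ; E)`, as a function of `k`. For
`B = innerSL ℝ` these are integral operators. -/
def kernelOp (B : E →L[ℝ] F →L[ℝ] G) : Lp E p μ →L[ℝ] F →L[ℝ] Lp G p μ :=
  (ContinuousLinearMap.compL ℝ F (Lp F ⊤ μ) (Lp G p μ)).flip (Lp.constL ⊤ μ ℝ) ∘L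
    B.holderL μ p ⊤ p

theorem coeFn_kernelOp (B : E →L[ℝ] F →L[ℝ] G) (k : Lp E p μ) (g : F) :
    kernelOp B k g =ᵐ[μ] fun x => B (k x) g := by
  filter_upwards [B.coeFn_holder (r := p) k (Lp.constL ⊤ μ ℝ g), Lp.coeFn_const (p := ⊤) (μ := μ) g]
    with x hB hconst
  exact hB.trans (congrArg (B (k x)) hconst)

theorem kernelOp_indicatorConst (B : E →L[ℝ] F →L[ℝ] G) (c : E) {s : Set α}
    (hs : MeasurableSet s) :
    kernelOp B (indicatorConstLp p hs (measure_ne_top μ s) c) =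
      (ContinuousLinearMap.lsmul ℝ ℝ).holderL μ p ⊤ p
        (indicatorConstLp p hs (measure_ne_top μ s) 1) ∘L Lp.constL ⊤ μ ℝ ∘L B c := by
  ext1 g
  refine Lp.ext ?_
  filter_upwards [coeFn_kernelOp B (indicatorConstLp p hs (measure_ne_top μ s) c) g,
    (ContinuousLinearMap.lsmul ℝ ℝ).coeFn_holder (r := p)
      (indicatorConstLp p hs (measure_ne_top μ s) (1 : ℝ)) (Lp.constL ⊤ μ ℝ (B c g)),
    indicatorConstLp_coeFn (p := p) (hs := hs) (hμs := measure_ne_top μ s) (c := c),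
    indicatorConstLp_coeFn (p := p) (hs := hs) (hμs := measure_ne_top μ s) (c := (1 : ℝ)),
    Lp.coeFn_const (p := ⊤) (μ := μ) (B c g)] with x hk hmul hc hone hconst
  refine hk.trans (.trans ?_ hmul.symm)
  rw [hc, hone, Lp.constL_apply, hconst]
  by_cases hx : x ∈ s <;> simp [hx]

theorem isCompactOperator_kernelOp [CompleteSpace G] {B : E →L[ℝ] F →L[ℝ] G}
    (hB : ∀ c, IsCompactOperator (B c)) (hp : p ≠ ⊤) (k : Lp E p μ) :
    IsCompactOperator (kernelOp B k) := by
  induction k using Lp.induction hp with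
  | indicatorConst c hs hμs =>
    rw [Lp.simpleFunc.coe_indicatorConst, kernelOp_indicatorConst]
    exact (hB c).clm_comp ((ContinuousLinearMap.lsmul ℝ ℝ).holderL μ p ⊤ p
      (indicatorConstLp p hs hμs.ne (1 : ℝ)) ∘L (Lp.constL ⊤ μ ℝ : G →L[ℝ] Lp G ⊤ μ))
  | add hf hg _ hkf hkg =>
    rw [map_add]
    exact hkf.add hkg
  | isClosed =>
    exact isClosed_setOfPred_isCompactOperator.preimage (kernelOp B).continuous

end Kernel

theorem memLp_unitMeasure_of_continuous {E : Type*} [NormedAddCommGroup E]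
    [SecondCountableTopologyEither ℝ E] {f : ℝ → E} (hf : Continuous f) (p : ENNReal) :
    MemLp f p unitMeasure := by
  obtain ⟨M, hM⟩ := isCompact_Icc.exists_bound_of_continuousOn (s := Icc (0 : ℝ) 1) hf.continuousOn
  refine MemLp.of_bound hf.aestronglyMeasurable M ?_
  filter_upwards [ae_restrict_mem measurableSet_Ioo] with x hx
  exact hM x (Ioo_subset_Icc_self hx)

theorem ae_unitMeasure_iff {p : ℝ → Prop} :
    (∀ᵐ x ∂unitMeasure, p x) ↔ ∀ᵐ x, x ∈ uIoc 0 1 → p x := by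
  rw [uIoc_of_le zero_le_one, unitMeasure, restrict_Ioo_eq_restrict_Ioc,
    ae_restrict_iff' measurableSet_Ioc]

theorem intervalIntegrable_L2 (g : L2) : IntervalIntegrable g volume 0 1 := by
  rw [intervalIntegrable_iff_integrableOn_Ioo_of_le zero_le_one]
  exact (Lp.memLp g).integrable (by norm_num)

theorem integral_unitMeasure (f : ℝ → ℝ) : ∫ x, f x ∂unitMeasure = ∫ x in (0 : ℝ)..1, f x := by
  rw [intervalIntegral.integral_of_le zero_le_one, unitMeasure, restrict_Ioo_eq_restrict_Ioc]

/-- Multiplication by a continuous function, as an operator on `L²(0,1)`. -/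
def mulOp (m : ℝ → ℝ) (hm : Continuous m) : L2 →L[ℝ] L2 :=
  (ContinuousLinearMap.mul ℝ ℝ).holderL unitMeasure ⊤ 2 2
    ((memLp_unitMeasure_of_continuous hm ⊤).toLp m)

theorem coeFn_mulOp {m : ℝ → ℝ} (hm : Continuous m) (g : L2) :
    mulOp m hm g =ᵐ[unitMeasure] fun x => m x * g x := by
  filter_upwards [(ContinuousLinearMap.mul ℝ ℝ).coeFn_holder (r := 2)
    ((memLp_unitMeasure_of_continuous hm ⊤).toLp m) g,
    (memLp_unitMeasure_of_continuous hm ⊤).coeFn_toLp] with x hmul hcoe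
  exact hmul.trans (by rw [hcoe]; rfl)

theorem inner_mulOp {m : ℝ → ℝ} (hm : Continuous m) (f g : L2) :
    inner ℝ (mulOp m hm f) g = inner ℝ f (mulOp m hm g) := by
  rw [L2.inner_def, L2.inner_def]
  refine integral_congr_ae ?_
  filter_upwards [coeFn_mulOp hm f, coeFn_mulOp hm g] with x hf hg
  simp only [hf, hg, RCLike.inner_apply, conj_trivial]
  ring

/-- The indicator function of `(-∞, x]`, the kernel of the Volterra operator. -/
def stepL2 (x : ℝ) : L2 :=
  indicatorConstLp 2 (measurableSet_Iic (a := x)) (measure_ne_top _ _) 1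

theorem unitMeasure_symmDiff_Iic_le (x y : ℝ) :
    unitMeasure (symmDiff (Iic y) (Iic x)) ≤ ENNReal.ofReal |y - x| := by
  have hsub : symmDiff (Iic y) (Iic x) ⊆ uIoc x y := by
    rintro z (⟨hzy, hzx⟩ | ⟨hzx, hzy⟩)
    · exact mem_uIoc.2 (Or.inl ⟨not_le.1 hzx, hzy⟩)
    · exact mem_uIoc.2 (Or.inr ⟨not_le.1 hzy, hzx⟩)
  calc unitMeasure (symmDiff (Iic y) (Iic x))
      ≤ volume (uIoc x y) := (Measure.restrict_apply_le _ _).trans (measure_mono hsub)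
    _ = ENNReal.ofReal |y - x| := by rw [uIoc, Real.volume_Ioc, max_sub_min_eq_abs]

theorem continuous_stepL2 : Continuous stepL2 := by
  refine continuous_indicatorConstLp_set (by norm_num) fun x => ?_
  have hlim : Tendsto (fun y => ENNReal.ofReal |y - x|) (𝓝 x) (𝓝 0) := by
    have hcont : Continuous fun y => ENNReal.ofReal |y - x| :=
      ENNReal.continuous_ofReal.comp (by fun_prop)
    simpa using hcont.tendsto x
  exact tendsto_of_tendsto_of_tendsto_of_le_of_le tendsto_const_nhds hlim (fun _ => zero_le)
    fun y => unitMeasure_symmDiff_Iic_le x y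

theorem inner_stepL2 (g : L2) {x : ℝ} (hx : x ∈ Icc (0 : ℝ) 1) :
    inner ℝ (stepL2 x) g = ∫ s in (0 : ℝ)..x, g s := by
  rw [stepL2, L2.inner_indicatorConstLp_one, Measure.restrict_restrict measurableSet_Iic,
    intervalIntegral.integral_of_le hx.1]
  refine setIntegral_congr_set ?_
  have hinter : (Iic x ∩ Ioc 0 1 : Set ℝ) = Ioc 0 x := by
    rw [inter_comm, Ioc_inter_Iic, min_eq_right hx.2]
  rw [← hinter]
  exact (ae_eq_refl _).inter Ioo_ae_eq_Ioc

/-- The Volterra operator `g ↦ (x ↦ ∫₀ˣ g)` on `L²(0,1)`. -/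
def volterra : L2 →L[ℝ] L2 :=
  kernelOp (innerSL ℝ) ((memLp_unitMeasure_of_continuous continuous_stepL2 2).toLp stepL2)

theorem coeFn_volterra (g : L2) :
    volterra g =ᵐ[unitMeasure] fun x => ∫ s in (0 : ℝ)..x, g s := by
  filter_upwards [coeFn_kernelOp (innerSL ℝ)
      ((memLp_unitMeasure_of_continuous continuous_stepL2 2).toLp stepL2) g,
    (memLp_unitMeasure_of_continuous continuous_stepL2 2).coeFn_toLp,
    ae_restrict_mem measurableSet_Ioo] with x hop hcoe hx
  rw [volterra, hop, hcoe, innerSL_apply_apply, inner_stepL2 g (Ioo_subset_Icc_self hx)]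

theorem isCompactOperator_volterra : IsCompactOperator volterra :=
  isCompactOperator_kernelOp (fun _ => isCompactOperator_of_locallyCompactSpace_dom _)
    (by norm_num) _

theorem inner_volterra_add_inner_volterra (f g : L2) :
    inner ℝ (volterra f) g + inner ℝ f (volterra g) =
      (∫ s in (0 : ℝ)..1, f s) * ∫ s in (0 : ℝ)..1, g s := by
  have hf := intervalIntegrable_L2 f
  have hg := intervalIntegrable_L2 g
  have hparts := (hf.absolutelyContinuousOnInterval_intervalIntegral left_mem_uIcc)
    |>.integral_deriv_mul_eq_sub (hg.absolutelyContinuousOnInterval_intervalIntegral left_mem_uIcc)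
  simp only [intervalIntegral.integral_same, mul_zero, sub_zero] at hparts
  rw [← hparts, L2.inner_def, L2.inner_def, ← integral_add (L2.integrable_inner _ _)
    (L2.integrable_inner _ _), integral_unitMeasure]
  refine intervalIntegral.integral_congr_ae ?_
  filter_upwards [ae_unitMeasure_iff.1 (coeFn_volterra f), ae_unitMeasure_iff.1 (coeFn_volterra g),
    hf.ae_hasDerivAt_integral, hg.ae_hasDerivAt_integral] with x hVf hVg hf' hg' hx
  have hx' := uIoc_subset_uIcc hx
  rw [(hf' hx' 0 left_mem_uIcc).deriv, (hg' hx' 0 left_mem_uIcc).deriv]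
  simp only [hVf hx, hVg hx, RCLike.inner_apply, conj_trivial]
  ring

/-- The adjoint Volterra operator `g ↦ (x ↦ ∫ₓ¹ g)` on `L²(0,1)`. -/
def backwardVolterra : L2 →L[ℝ] L2 :=
  kernelOp (innerSL ℝ) (Lp.const 2 unitMeasure (stepL2 1)) - volterra

theorem coeFn_backwardVolterra (g : L2) : backwardVolterra g =ᵐ[unitMeasure]
    fun x => (∫ s in (0 : ℝ)..1, g s) - ∫ s in (0 : ℝ)..x, g s := by
  have hsub := Lp.coeFn_sub
    (kernelOp (innerSL ℝ) (Lp.const 2 unitMeasure (stepL2 1)) g) (volterra g)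
  filter_upwards [hsub, coeFn_kernelOp (innerSL ℝ) (Lp.const 2 unitMeasure (stepL2 1)) g,
    Lp.coeFn_const (p := 2) (μ := unitMeasure) (stepL2 1), coeFn_volterra g]
    with x hsub hop hconst hV
  refine hsub.trans ?_
  rw [Pi.sub_apply, hop, hconst, hV, innerSL_apply_apply, Function.const_apply,
    inner_stepL2 g (right_mem_Icc.2 zero_le_one)]

theorem isCompactOperator_backwardVolterra : IsCompactOperator backwardVolterra :=
  (isCompactOperator_kernelOp (fun _ => isCompactOperator_of_locallyCompactSpace_dom _)
    (by norm_num) _).sub isCompactOperator_volterra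

theorem inner_volterra (f g : L2) :
    inner ℝ (volterra f) g = inner ℝ f (backwardVolterra g) := by
  have hconst : inner ℝ f (backwardVolterra g) =
      (∫ s in (0 : ℝ)..1, f s) * (∫ s in (0 : ℝ)..1, g s) - inner ℝ f (volterra g) := by
    rw [← integral_unitMeasure f, ← integral_mul_const, L2.inner_def, L2.inner_def,
      ← integral_sub (((Lp.memLp f).integrable (by norm_num)).mul_const _)
        (L2.integrable_inner _ _)]
    refine integral_congr_ae ?_
    filter_upwards [coeFn_backwardVolterra g, coeFn_volterra g] with x hB hV
    simp only [hB, hV, RCLike.inner_apply, conj_trivial]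
    ring
  rw [hconst, ← inner_volterra_add_inner_volterra, add_sub_cancel_right]

/-! ### The Robin operator -/

theorem forall_uIcc_eq_add_integral_iff {y φ : ℝ → ℝ} (hφ : IntervalIntegrable φ volume 0 1) :
    (∀ x ∈ Icc (0 : ℝ) 1, y x = y 0 + ∫ s in (0 : ℝ)..x, φ s) ↔ IsPrimitiveOn y φ 0 1 := by
  rw [← uIcc_of_le zero_le_one]
  exact ⟨fun h => ⟨hφ, h⟩, fun h => h.eq_add_integral⟩

theorem isH2_iff {f q : L2} {v w : ℝ → ℝ} :
    IsH2 f v w q ↔ f =ᵐ[unitMeasure] v ∧ IsPrimitiveOn v w 0 1 ∧ IsPrimitiveOn w q 0 1 := by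
  rw [IsH2, forall_uIcc_eq_add_integral_iff (intervalIntegrable_L2 q)]
  refine and_congr_right fun _ => and_congr_left fun hw => ?_
  exact forall_uIcc_eq_add_integral_iff hw.continuousOn.intervalIntegrable

theorem eqOn_of_ae_eq_unitMeasure {f g : ℝ → ℝ} (h : f =ᵐ[unitMeasure] g)
    (hf : ContinuousOn f (uIcc 0 1)) (hg : ContinuousOn g (uIcc 0 1)) : EqOn f g (uIcc 0 1) := by
  rw [uIcc_of_le zero_le_one] at *
  refine Measure.eqOn_Icc_of_ae_eq volume zero_ne_one ?_ hf hg
  rwa [← restrict_Ioo_eq_restrict_Icc]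

theorem IsPrimitiveOn.eqOn_zero {y φ : ℝ → ℝ} (hy : IsPrimitiveOn y φ 0 1)
    (hφ : ContinuousOn φ (uIcc 0 1)) (hy0 : EqOn y 0 (uIcc 0 1)) : EqOn φ 0 (uIcc 0 1) := by
  refine eqOn_of_ae_eq_unitMeasure (ae_unitMeasure_iff.2 ?_) hφ continuousOn_const
  have hzero : IsPrimitiveOn y 0 0 1 :=
    ⟨intervalIntegrable_const, fun t ht => by simp [hy0 ht, hy0 left_mem_uIcc]⟩
  filter_upwards [hy.ae_eq hzero] with t ht hmem using ht (uIoc_subset_uIcc hmem)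

theorem IsH2.eq_zero {q : L2} {v w : ℝ → ℝ} (h : IsH2 0 v w q) : q = 0 := by
  obtain ⟨hfv, hv, hw⟩ := isH2_iff.1 h
  have hv0 : EqOn v 0 (uIcc 0 1) := eqOn_of_ae_eq_unitMeasure
    (hfv.symm.trans (Lp.coeFn_zero ℝ 2 unitMeasure)) hv.continuousOn continuousOn_const
  have hw0 : EqOn w 0 (uIcc 0 1) := hv.eqOn_zero hw.continuousOn hv0
  have hzero : IsPrimitiveOn w 0 0 1 :=
    ⟨intervalIntegrable_const, fun t ht => by simp [hw0 ht, hw0 left_mem_uIcc]⟩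
  refine Lp.ext (.trans (ae_unitMeasure_iff.2 ?_) (Lp.coeFn_zero ℝ 2 unitMeasure).symm)
  filter_upwards [hw.ae_eq hzero] with t ht hmem using ht (uIoc_subset_uIcc hmem)

theorem IsH2.add {f₁ q₁ f₂ q₂ : L2} {v₁ w₁ v₂ w₂ : ℝ → ℝ} (h₁ : IsH2 f₁ v₁ w₁ q₁)
    (h₂ : IsH2 f₂ v₂ w₂ q₂) :
    IsH2 (f₁ + f₂) (fun x => v₁ x + v₂ x) (fun x => w₁ x + w₂ x) (q₁ + q₂) := by
  obtain ⟨hf₁, hv₁, hw₁⟩ := isH2_iff.1 h₁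
  obtain ⟨hf₂, hv₂, hw₂⟩ := isH2_iff.1 h₂
  refine isH2_iff.2 ⟨(Lp.coeFn_add f₁ f₂).trans (hf₁.add hf₂), hv₁.add hv₂,
    (hw₁.add hw₂).congr_ae (fun _ _ => rfl) (ae_unitMeasure_iff.1 (Lp.coeFn_add q₁ q₂))⟩

theorem IsH2.const_smul {f q : L2} {v w : ℝ → ℝ} (h : IsH2 f v w q) (s : ℝ) :
    IsH2 (s • f) (fun x => s * v x) (fun x => s * w x) (s • q) := by
  obtain ⟨hf, hv, hw⟩ := isH2_iff.1 h
  exact isH2_iff.2 ⟨(Lp.coeFn_smul s f).trans (hf.const_smul s),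
    hv.clm_comp (ContinuousLinearMap.lsmul ℝ ℝ s),
    (hw.clm_comp (ContinuousLinearMap.lsmul ℝ ℝ s)).congr_ae (fun _ _ => rfl)
      (ae_unitMeasure_iff.1 (Lp.coeFn_smul s q))⟩

theorem RobinGraph.eq_zero {P : Coeffs} {r : ℝ} {g : L2} (h : RobinGraph P r 0 g) : g = 0 := by
  obtain ⟨v, w, q, hH2, -, -, rfl⟩ := h
  rw [hH2.eq_zero, smul_zero, smul_zero, add_zero]

theorem RobinGraph.add {P : Coeffs} {r : ℝ} {f₁ g₁ f₂ g₂ : L2} (h₁ : RobinGraph P r f₁ g₁)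
    (h₂ : RobinGraph P r f₂ g₂) : RobinGraph P r (f₁ + f₂) (g₁ + g₂) := by
  obtain ⟨v₁, w₁, q₁, hH₁, hl₁, hr₁, rfl⟩ := h₁
  obtain ⟨v₂, w₂, q₂, hH₂, hl₂, hr₂, rfl⟩ := h₂
  exact ⟨_, _, _, hH₁.add hH₂, by linear_combination hl₁ + hl₂, by linear_combination hr₁ + hr₂,
    by module⟩

theorem RobinGraph.const_smul {P : Coeffs} {r : ℝ} {f g : L2} (h : RobinGraph P r f g) (s : ℝ) :
    RobinGraph P r (s • f) (s • g) := by
  obtain ⟨v, w, q, hH, hl, hr, rfl⟩ := h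
  exact ⟨_, _, _, hH.const_smul s, by linear_combination s * hl, by linear_combination s * hr,
    by module⟩

theorem RobinGraph.sub {P : Coeffs} {r : ℝ} {f₁ g₁ f₂ g₂ : L2} (h₁ : RobinGraph P r f₁ g₁)
    (h₂ : RobinGraph P r f₂ g₂) : RobinGraph P r (f₁ - f₂) (g₁ - g₂) := by
  rw [sub_eq_add_neg, sub_eq_add_neg, ← neg_one_smul ℝ f₂, ← neg_one_smul ℝ g₂]
  exact h₁.add (h₂.const_smul (-1))

theorem robinGraph_add_smul_iff {P : Coeffs} {r s : ℝ} {f g : L2} :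
    RobinGraph P (r + s) f (g + s • f) ↔ RobinGraph P r f g := by
  refine exists_congr fun v => exists_congr fun w => exists_congr fun q => and_congr_right fun _ =>
    and_congr_right fun _ => and_congr_right fun _ => ?_
  rw [add_smul, ← add_assoc, add_left_inj]

/-- The companion operator `(v, w) ↦ (w, ρ v)` of the equation `v'' = ρ v`. -/
def companion (ρ : ℝ) : ℝ × ℝ →L[ℝ] ℝ × ℝ :=
  (ContinuousLinearMap.snd ℝ ℝ ℝ).prod (ρ • ContinuousLinearMap.fst ℝ ℝ ℝ)

/-- The phase `(v, v')` at `x` of the solution of `v'' = ρ v` with data `(sin θ, cos θ)` at `0`,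
for which `cos θ v(0) = sin θ v'(0)`. -/
def robinFlow (ρ θ x : ℝ) : ℝ × ℝ := expFlow (companion ρ) x (Real.sin θ, Real.cos θ)

theorem robinFlow_zero (ρ θ : ℝ) : robinFlow ρ θ 0 = (Real.sin θ, Real.cos θ) := by
  rw [robinFlow, expFlow_zero, one_apply_eq_self]

theorem IsPrimitiveOn.eq_expFlow_companion {v w : ℝ → ℝ} {ρ : ℝ} (hv : IsPrimitiveOn v w 0 1)
    (hw : IsPrimitiveOn w (fun x => ρ * v x) 0 1) {x : ℝ} (hx : x ∈ uIcc (0 : ℝ) 1) :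
    (v x, w x) = expFlow (companion ρ) x (v 0, w 0) := by
  have hpair := (hv.clm_comp (ContinuousLinearMap.inl ℝ ℝ ℝ)).add
    (hw.clm_comp (ContinuousLinearMap.inr ℝ ℝ ℝ))
  have hphase : IsPrimitiveOn (fun x => (v x, w x)) (fun x => companion ρ (v x, w x) + 0) 0 1 :=
    hpair.congr (fun x _ => by simp) fun x _ => by simp [companion]
  simpa using hphase.eq_variation_of_constants intervalIntegrable_const hx

theorem IsH2.eq_expFlow_companion {f : L2} {v w : ℝ → ℝ} {ρ : ℝ} (h : IsH2 f v w (ρ • f)) {x : ℝ}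
    (hx : x ∈ uIcc (0 : ℝ) 1) : (v x, w x) = expFlow (companion ρ) x (v 0, w 0) := by
  obtain ⟨hf, hv, hw⟩ := isH2_iff.1 h
  refine hv.eq_expFlow_companion (hw.congr_ae (fun _ _ => rfl) ?_) hx
  filter_upwards [ae_unitMeasure_iff.1 ((Lp.coeFn_smul ρ f).trans (hf.const_smul ρ))]
    with x hx hmem using (hx hmem).symm

theorem RobinGraph.exists_eq_smul_robinFlow {P : Coeffs} {r μ : ℝ} {f : L2}
    (h : RobinGraph P r f (μ • f)) : ∃ t : ℝ,
      (f =ᵐ[unitMeasure] fun x => t * (robinFlow ((μ - r) / P.a) P.θ₁ x).1) ∧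
      t * (Real.cos P.θ₂ * (robinFlow ((μ - r) / P.a) P.θ₁ 1).1 +
        Real.sin P.θ₂ * (robinFlow ((μ - r) / P.a) P.θ₁ 1).2) = 0 := by
  obtain ⟨v, w, q, hH2, hl, hr, hg⟩ := h
  set ρ := (μ - r) / P.a with hρ
  obtain rfl : q = ρ • f := by
    rw [hρ, div_eq_inv_mul, mul_smul, sub_smul, hg, add_sub_cancel_right,
      inv_smul_smul₀ P.a_pos.ne']
  set t := Real.sin P.θ₁ * v 0 + Real.cos P.θ₁ * w 0 with ht
  have hinit : (v 0, w 0) = t • (Real.sin P.θ₁, Real.cos P.θ₁) := by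
    have hsq := Real.sin_sq_add_cos_sq P.θ₁
    refine Prod.ext ?_ ?_
    · change v 0 = t * Real.sin P.θ₁
      linear_combination (-v 0) * hsq + Real.cos P.θ₁ * hl - Real.sin P.θ₁ * ht
    · change w 0 = t * Real.cos P.θ₁
      linear_combination (-w 0) * hsq - Real.sin P.θ₁ * hl - Real.cos P.θ₁ * ht
  have hphase : ∀ x ∈ uIcc (0 : ℝ) 1, (v x, w x) = t • robinFlow ρ P.θ₁ x := fun x hx => by
    rw [hH2.eq_expFlow_companion hx, hinit, map_smul, robinFlow]
  refine ⟨t, hH2.1.trans (ae_unitMeasure_iff.2 (ae_of_all _ fun x hx => ?_)), ?_⟩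
  · exact congrArg Prod.fst (hphase x (uIoc_subset_uIcc hx))
  · have hv1 : v 1 = t * _ := congrArg Prod.fst (hphase 1 right_mem_uIcc)
    have hw1 : w 1 = t * _ := congrArg Prod.snd (hphase 1 right_mem_uIcc)
    rw [hv1, hw1] at hr
    linear_combination hr

theorem RobinGraph.exists_eq_smul {P : Coeffs} {r μ : ℝ} {f g : L2}
    (hf : RobinGraph P r f (μ • f)) (hg : RobinGraph P r g (μ • g)) (hf0 : f ≠ 0) :
    ∃ s : ℝ, g = s • f := by
  obtain ⟨t, hft, -⟩ := hf.exists_eq_smul_robinFlow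
  obtain ⟨t', hgt, -⟩ := hg.exists_eq_smul_robinFlow
  have ht : t ≠ 0 := by
    rintro rfl
    refine hf0 (Lp.ext ?_)
    filter_upwards [hft, Lp.coeFn_zero ℝ 2 unitMeasure] with x hx h0
    rw [hx, h0, zero_mul, Pi.zero_apply]
  refine ⟨t' / t, Lp.ext ?_⟩
  filter_upwards [hft, hgt, Lp.coeFn_smul (t' / t) f] with x hfx hgx hsmul
  rw [hsmul, Pi.smul_apply, hfx, hgx, smul_eq_mul, ← mul_assoc, div_mul_cancel₀ _ ht]

/-! ### The resolvent of the Robin operator -/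

/-- `v` solves `v'' = ρ v` on the line, with derivative `w`. -/
structure IsHelmholtz (ρ : ℝ) (v w : ℝ → ℝ) : Prop where
  hasDerivAt_fst : ∀ x, HasDerivAt v (w x) x
  hasDerivAt_snd : ∀ x, HasDerivAt w (ρ * v x) x

theorem IsHelmholtz.continuous_fst {ρ : ℝ} {v w : ℝ → ℝ} (h : IsHelmholtz ρ v w) : Continuous v :=
  continuous_iff_continuousAt.2 fun x => (h.hasDerivAt_fst x).continuousAt

theorem IsHelmholtz.continuous_snd {ρ : ℝ} {v w : ℝ → ℝ} (h : IsHelmholtz ρ v w) : Continuous w :=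
  continuous_iff_continuousAt.2 fun x => (h.hasDerivAt_snd x).continuousAt

theorem IsHelmholtz.comp_sub_const {ρ : ℝ} {v w : ℝ → ℝ} (h : IsHelmholtz ρ v w) (x₀ : ℝ) :
    IsHelmholtz ρ (fun x => v (x - x₀)) fun x => w (x - x₀) :=
  ⟨fun x => (h.hasDerivAt_fst (x - x₀)).comp_sub_const x x₀,
    fun x => (h.hasDerivAt_snd (x - x₀)).comp_sub_const x x₀⟩

theorem isHelmholtz_expFlow_companion (ρ : ℝ) (y : ℝ × ℝ) :
    IsHelmholtz ρ (fun x => (expFlow (companion ρ) x y).1)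
      fun x => (expFlow (companion ρ) x y).2 := by
  have hflow : ∀ x, HasDerivAt (fun x => expFlow (companion ρ) x y)
      (companion ρ (expFlow (companion ρ) x y)) x := fun x =>
    (ContinuousLinearMap.apply ℝ (ℝ × ℝ) y).hasFDerivAt.comp_hasDerivAt x
      (hasDerivAt_expFlow (companion ρ) x)
  exact ⟨fun x => (ContinuousLinearMap.fst ℝ ℝ ℝ).hasFDerivAt.comp_hasDerivAt x (hflow x),
    fun x => (ContinuousLinearMap.snd ℝ ℝ ℝ).hasFDerivAt.comp_hasDerivAt x (hflow x)⟩

theorem isHelmholtz_robinFlow (ρ θ : ℝ) :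
    IsHelmholtz ρ (fun x => (robinFlow ρ θ x).1) fun x => (robinFlow ρ θ x).2 :=
  isHelmholtz_expFlow_companion ρ _

theorem robinFlow_ne_zero (ρ θ x : ℝ) : robinFlow ρ θ x ≠ 0 := by
  intro h0
  have hinit := expFlow_neg_apply_expFlow (companion ρ) x (Real.sin θ, Real.cos θ)
  rw [← robinFlow, h0, map_zero, Prod.ext_iff] at hinit
  have hsq := Real.sin_sq_add_cos_sq θ
  simp [← show 0 = Real.sin θ from hinit.1, ← show 0 = Real.cos θ from hinit.2] at hsq

theorem IsHelmholtz.wronskian_eq {ρ : ℝ} {φ φ' ψ ψ' : ℝ → ℝ} (hφ : IsHelmholtz ρ φ φ')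
    (hψ : IsHelmholtz ρ ψ ψ') (x y : ℝ) :
    φ x * ψ' x - φ' x * ψ x = φ y * ψ' y - φ' y * ψ y := by
  have hderiv : ∀ x, HasDerivAt (fun x => φ x * ψ' x - φ' x * ψ x) 0 x := fun x =>
    (((hφ.hasDerivAt_fst x).mul (hψ.hasDerivAt_snd x)).sub
      ((hφ.hasDerivAt_snd x).mul (hψ.hasDerivAt_fst x))).congr_deriv (by ring)
  exact is_const_of_deriv_eq_zero (fun x => (hderiv x).differentiableAt)
    (fun x => (hderiv x).deriv) x y

theorem mul_add_mul_sq_nonneg_of_robin {θ K v w : ℝ} (hK : |Real.cos θ / Real.sin θ| ≤ K)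
    (h : Real.cos θ * v = Real.sin θ * w) : 0 ≤ v * w + K * v ^ 2 := by
  by_cases hsin : Real.sin θ = 0
  · have hcos : Real.cos θ ≠ 0 := fun hcos => by
      simpa [hsin, hcos] using Real.sin_sq_add_cos_sq θ
    obtain rfl : v = 0 := by simpa [hsin, hcos] using h
    simp
  · obtain rfl : w = Real.cos θ / Real.sin θ * v := by
      rw [div_mul_eq_mul_div, h, mul_div_cancel_left₀ _ hsin]
    nlinarith [sq_nonneg v, neg_le_of_abs_le hK]

theorem hasDerivAt_robinEnergy {ρ : ℝ} {v w : ℝ → ℝ} (h : IsHelmholtz ρ v w) (K x : ℝ) :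
    HasDerivAt (fun x => v x * w x - K * (2 * x - 1) * v x ^ 2)
      ((w x - K * (2 * x - 1) * v x) ^ 2 + (ρ - 2 * K - K ^ 2 * (2 * x - 1) ^ 2) * v x ^ 2) x := by
  have hlin : HasDerivAt (fun x : ℝ => K * (2 * x - 1)) (K * 2) x := by
    simpa using (((hasDerivAt_id x).const_mul 2).sub_const 1).const_mul K
  refine (((h.hasDerivAt_fst x).mul (h.hasDerivAt_snd x)).sub
    (hlin.mul ((h.hasDerivAt_fst x).pow 2))).congr_deriv ?_
  simp only [Pi.pow_apply]
  push_cast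
  ring

/-- The weight `K (1 - 2x)` makes the energy nonnegative at `0` and nonpositive at `1`, although it
is nondecreasing. -/
theorem IsHelmholtz.eq_zero_of_robin {ρ K θ₁ θ₂ : ℝ} {v w : ℝ → ℝ} (h : IsHelmholtz ρ v w)
    (h₁ : |Real.cos θ₁ / Real.sin θ₁| ≤ K) (h₂ : |Real.cos θ₂ / Real.sin θ₂| ≤ K)
    (hρ : 2 * K + K ^ 2 < ρ) (hl : Real.cos θ₁ * v 0 - Real.sin θ₁ * w 0 = 0)
    (hr : Real.cos θ₂ * v 1 + Real.sin θ₂ * w 1 = 0) : v (1 / 2) = 0 ∧ w (1 / 2) = 0 := by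
  set F : ℝ → ℝ := fun x => v x * w x - K * (2 * x - 1) * v x ^ 2 with hF
  have hderiv := hasDerivAt_robinEnergy h K
  have hmono : MonotoneOn F (Icc 0 1) := by
    refine monotoneOn_of_deriv_nonneg (convex_Icc 0 1)
      (fun x _ => (hderiv x).continuousAt.continuousWithinAt)
      (fun x _ => (hderiv x).differentiableAt.differentiableWithinAt) fun x hx => ?_
    rw [interior_Icc] at hx
    rw [(hderiv x).deriv]
    have hx1 : (2 * x - 1) ^ 2 ≤ 1 := by nlinarith [hx.1, hx.2]
    have hcoef : 0 ≤ ρ - 2 * K - K ^ 2 * (2 * x - 1) ^ 2 := by nlinarith [sq_nonneg K]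
    positivity
  have hF0 : 0 ≤ F 0 :=
    (mul_add_mul_sq_nonneg_of_robin h₁ (sub_eq_zero.1 hl)).trans_eq (by simp only [hF]; ring)
  have hF1 : F 1 ≤ 0 := by
    have hend := mul_add_mul_sq_nonneg_of_robin (v := v 1) (w := -w 1) h₂ (by linarith)
    simp only [hF]
    linarith
  have hzero : ∀ x ∈ Icc (0 : ℝ) 1, F x = 0 := fun x hx => le_antisymm
    ((hmono hx (right_mem_Icc.2 zero_le_one) hx.2).trans hF1)
    (hF0.trans (hmono (left_mem_Icc.2 zero_le_one) hx hx.1))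
  have hmid : (w (1 / 2)) ^ 2 + (ρ - 2 * K) * v (1 / 2) ^ 2 = 0 := by
    have hconst : HasDerivAt F 0 (1 / 2) := (hasDerivAt_const _ 0).congr_of_eventuallyEq
      (eventually_of_mem (Icc_mem_nhds (by norm_num) (by norm_num)) hzero)
    have heq := (hderiv (1 / 2)).unique hconst
    linear_combination heq
  have hρ' : 0 < ρ - 2 * K := by nlinarith [sq_nonneg K]
  constructor <;> refine pow_eq_zero_iff two_ne_zero |>.1 ?_ <;>
    nlinarith [hρ', sq_nonneg (w (1 / 2)), sq_nonneg (v (1 / 2))]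

/-- The operator on `L²(0,1)` with kernel `ψ(x) φ(s)` for `s ≤ x` and `φ(x) ψ(s)` for `x ≤ s`. -/
def greenOp (φ ψ : ℝ → ℝ) (hφ : Continuous φ) (hψ : Continuous ψ) : L2 →L[ℝ] L2 :=
  mulOp ψ hψ ∘L volterra ∘L mulOp φ hφ + mulOp φ hφ ∘L backwardVolterra ∘L mulOp ψ hψ

theorem isCompactOperator_greenOp {φ ψ : ℝ → ℝ} (hφ : Continuous φ) (hψ : Continuous ψ) :
    IsCompactOperator (greenOp φ ψ hφ hψ) :=
  ((isCompactOperator_volterra.comp_clm (mulOp φ hφ)).clm_comp (mulOp ψ hψ)).add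
    ((isCompactOperator_backwardVolterra.comp_clm (mulOp ψ hψ)).clm_comp (mulOp φ hφ))

theorem inner_greenOp {φ ψ : ℝ → ℝ} (hφ : Continuous φ) (hψ : Continuous ψ) (f g : L2) :
    inner ℝ (greenOp φ ψ hφ hψ f) g = inner ℝ f (greenOp φ ψ hφ hψ g) := by
  have hadj : ∀ f g : L2, inner ℝ (backwardVolterra f) g = inner ℝ f (volterra g) := fun f g => by
    rw [real_inner_comm, ← inner_volterra, real_inner_comm]
  simp only [greenOp, _root_.add_apply, ContinuousLinearMap.comp_apply, inner_add_left,
    inner_add_right, inner_mulOp, inner_volterra, hadj]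
  ring

theorem IsPrimitiveOn.mul {m m' y φ : ℝ → ℝ} {a b : ℝ} (hy : IsPrimitiveOn y φ a b)
    (hm : ∀ x, HasDerivAt m (m' x) x) (hm' : Continuous m') :
    IsPrimitiveOn (fun x => m x * y x) (fun x => m' x * y x + m x * φ x) a b :=
  hy.clm_apply (G := fun x => ContinuousLinearMap.mul ℝ ℝ (m x))
    (G' := fun x => ContinuousLinearMap.mul ℝ ℝ (m' x))
    (fun x => (ContinuousLinearMap.mul ℝ ℝ).hasFDerivAt.comp_hasDerivAt x (hm x))
    ((ContinuousLinearMap.mul ℝ ℝ).continuous.comp hm')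

theorem coeFn_greenOp {φ ψ : ℝ → ℝ} (hφ : Continuous φ) (hψ : Continuous ψ) (g : L2) :
    greenOp φ ψ hφ hψ g =ᵐ[unitMeasure] fun x => ψ x * (∫ s in (0 : ℝ)..x, mulOp φ hφ g s) +
      φ x * ((∫ s in (0 : ℝ)..1, mulOp ψ hψ g s) - ∫ s in (0 : ℝ)..x, mulOp ψ hψ g s) := by
  filter_upwards [Lp.coeFn_add (mulOp ψ hψ (volterra (mulOp φ hφ g)))
      (mulOp φ hφ (backwardVolterra (mulOp ψ hψ g))),
    coeFn_mulOp hψ (volterra (mulOp φ hφ g)), coeFn_volterra (mulOp φ hφ g),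
    coeFn_mulOp hφ (backwardVolterra (mulOp ψ hψ g)), coeFn_backwardVolterra (mulOp ψ hψ g)]
    with x hadd hψV hV hφV hV'
  refine hadd.trans ?_
  rw [Pi.add_apply, hψV, hV, hφV, hV']

theorem isPrimitiveOn_integral_add_integral {m₁ m₂ m₁' m₂' : ℝ → ℝ}
    (hm₁ : ∀ x, HasDerivAt m₁ (m₁' x) x) (hm₂ : ∀ x, HasDerivAt m₂ (m₂' x) x)
    (hm₁' : Continuous m₁') (hm₂' : Continuous m₂') (f g : L2) :
    IsPrimitiveOn (fun x => m₁ x * (∫ s in (0 : ℝ)..x, f s) +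
        m₂ x * ((∫ s in (0 : ℝ)..1, g s) - ∫ s in (0 : ℝ)..x, g s))
      (fun x => m₁' x * (∫ s in (0 : ℝ)..x, f s) +
        m₂' x * ((∫ s in (0 : ℝ)..1, g s) - ∫ s in (0 : ℝ)..x, g s) +
        (m₁ x * f x - m₂ x * g x)) 0 1 := by
  have hf := isPrimitiveOn_const_add_integral (intervalIntegrable_L2 f) 0
  have hg := isPrimitiveOn_const_add_integral (intervalIntegrable_L2 g).neg
    (∫ s in (0 : ℝ)..1, g s)
  refine ((hf.mul hm₁ hm₁').add (hg.mul hm₂ hm₂')).congr (fun x _ => ?_) fun x _ => ?_ <;>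
    simp only [zero_add, intervalIntegral.integral_neg, Pi.neg_apply] <;> ring

theorem isH2_greenOp {ρ D : ℝ} {φ φ' ψ ψ' : ℝ → ℝ} (hφ : IsHelmholtz ρ φ φ')
    (hψ : IsHelmholtz ρ ψ ψ') (hD : ∀ x, φ x * ψ' x - φ' x * ψ x = D) (g : L2) :
    IsH2 (greenOp φ ψ hφ.continuous_fst hψ.continuous_fst g)
      (fun x => ψ x * (∫ s in (0 : ℝ)..x, mulOp φ hφ.continuous_fst g s) +
        φ x * ((∫ s in (0 : ℝ)..1, mulOp ψ hψ.continuous_fst g s) -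
          ∫ s in (0 : ℝ)..x, mulOp ψ hψ.continuous_fst g s))
      (fun x => ψ' x * (∫ s in (0 : ℝ)..x, mulOp φ hφ.continuous_fst g s) +
        φ' x * ((∫ s in (0 : ℝ)..1, mulOp ψ hψ.continuous_fst g s) -
          ∫ s in (0 : ℝ)..x, mulOp ψ hψ.continuous_fst g s))
      (ρ • greenOp φ ψ hφ.continuous_fst hψ.continuous_fst g + D • g) := by
  set G := greenOp φ ψ hφ.continuous_fst hψ.continuous_fst g
  have hGv := coeFn_greenOp hφ.continuous_fst hψ.continuous_fst g
  have hφg := coeFn_mulOp hφ.continuous_fst g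
  have hψg := coeFn_mulOp hψ.continuous_fst g
  refine isH2_iff.2 ⟨hGv, ?_, ?_⟩
  · refine (isPrimitiveOn_integral_add_integral hψ.hasDerivAt_fst hφ.hasDerivAt_fst
      hψ.continuous_snd hφ.continuous_snd _ _).congr_ae (fun _ _ => rfl) ?_
    filter_upwards [ae_unitMeasure_iff.1 hφg, ae_unitMeasure_iff.1 hψg] with x hφx hψx hx
    rw [hφx hx, hψx hx]
    ring
  · refine (isPrimitiveOn_integral_add_integral hψ.hasDerivAt_snd hφ.hasDerivAt_snd
      (hψ.continuous_fst.const_mul ρ) (hφ.continuous_fst.const_mul ρ) _ _).congr_ae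
      (fun _ _ => rfl) (ae_unitMeasure_iff.1 ?_)
    filter_upwards [hφg, hψg, hGv, Lp.coeFn_add (ρ • G) (D • g), Lp.coeFn_smul ρ G,
      Lp.coeFn_smul D g] with x hφx hψx hGx hadd hsmulG hsmulg
    rw [hadd, Pi.add_apply, hsmulG, hsmulg, Pi.smul_apply, Pi.smul_apply, hGx, hφx, hψx, ← hD x]
    simp only [smul_eq_mul]
    ring

theorem robinGraph_greenOp {P : Coeffs} {r ρ D : ℝ} {φ φ' ψ ψ' : ℝ → ℝ} (hφ : IsHelmholtz ρ φ φ')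
    (hψ : IsHelmholtz ρ ψ ψ') (hD : ∀ x, φ x * ψ' x - φ' x * ψ x = D)
    (hl : Real.cos P.θ₁ * φ 0 - Real.sin P.θ₁ * φ' 0 = 0)
    (hr : Real.cos P.θ₂ * ψ 1 + Real.sin P.θ₂ * ψ' 1 = 0) (g : L2) :
    RobinGraph P r (greenOp φ ψ hφ.continuous_fst hψ.continuous_fst g)
      ((P.a * ρ + r) • greenOp φ ψ hφ.continuous_fst hψ.continuous_fst g + (P.a * D) • g) := by
  refine ⟨_, _, _, isH2_greenOp hφ hψ hD g, ?_, ?_, by module⟩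
  · simp only [intervalIntegral.integral_same, mul_zero, zero_add, sub_zero]
    linear_combination (∫ s in (0 : ℝ)..1, mulOp ψ hψ.continuous_fst g s) * hl
  · simp only [sub_self, mul_zero, add_zero]
    linear_combination (∫ s in (0 : ℝ)..1, mulOp φ hφ.continuous_fst g s) * hr

theorem exists_large_robin_parameter (P : Coeffs) : ∃ ρ₀ : ℝ, ∀ ρ, ρ₀ ≤ ρ → ∀ v w : ℝ → ℝ,
    IsHelmholtz ρ v w → Real.cos P.θ₁ * v 0 - Real.sin P.θ₁ * w 0 = 0 →
    Real.cos P.θ₂ * v 1 + Real.sin P.θ₂ * w 1 = 0 → v (1 / 2) = 0 ∧ w (1 / 2) = 0 := by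
  set K := max |Real.cos P.θ₁ / Real.sin P.θ₁| |Real.cos P.θ₂ / Real.sin P.θ₂|
  exact ⟨2 * K + K ^ 2 + 1, fun ρ hρ v w h hl hr => h.eq_zero_of_robin (le_max_left _ _)
    (le_max_right _ _) (by linarith) hl hr⟩

theorem exists_helmholtz_wronskian_ne_zero (P : Coeffs) {ρ : ℝ}
    (hρ : ∀ v w : ℝ → ℝ, IsHelmholtz ρ v w → Real.cos P.θ₁ * v 0 - Real.sin P.θ₁ * w 0 = 0 →
      Real.cos P.θ₂ * v 1 + Real.sin P.θ₂ * w 1 = 0 → v (1 / 2) = 0 ∧ w (1 / 2) = 0) :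
    ∃ (φ φ' ψ ψ' : ℝ → ℝ) (D : ℝ), IsHelmholtz ρ φ φ' ∧ IsHelmholtz ρ ψ ψ' ∧ D ≠ 0 ∧
      (∀ x, φ x * ψ' x - φ' x * ψ x = D) ∧
      Real.cos P.θ₁ * φ 0 - Real.sin P.θ₁ * φ' 0 = 0 ∧
      Real.cos P.θ₂ * ψ 1 + Real.sin P.θ₂ * ψ' 1 = 0 := by
  have hφ := isHelmholtz_robinFlow ρ P.θ₁
  have hψ := (isHelmholtz_robinFlow ρ (-P.θ₂)).comp_sub_const 1
  have hr : Real.cos P.θ₂ * (robinFlow ρ (-P.θ₂) (1 - 1)).1 +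
      Real.sin P.θ₂ * (robinFlow ρ (-P.θ₂) (1 - 1)).2 = 0 := by
    simp only [sub_self, robinFlow_zero, Real.sin_neg, Real.cos_neg]
    ring
  refine ⟨_, _, _, _, _, hφ, hψ, fun hD => ?_, fun x => hφ.wronskian_eq hψ x 0, ?_, hr⟩
  · rw [robinFlow_zero] at hD
    obtain ⟨hv, hw⟩ := hρ _ _ hψ (by linear_combination -hD) hr
    exact robinFlow_ne_zero ρ (-P.θ₂) (1 / 2 - 1) (Prod.ext hv hw)
  · rw [robinFlow_zero]
    ring

theorem exists_resolvent (P : Coeffs) (r : ℝ) : ∃ (σ : ℝ) (R : L2 →L[ℝ] L2),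
    IsCompactOperator R ∧ (∀ f g : L2, inner ℝ (R f) g = inner ℝ f (R g)) ∧
    (∀ g, RobinGraph P r (R g) (σ • R g - g)) ∧
    ∀ μ f, σ ≤ μ → RobinGraph P r f (μ • f) → f = 0 := by
  obtain ⟨ρ₀, hρ₀⟩ := exists_large_robin_parameter P
  obtain ⟨φ, φ', ψ, ψ', D, hφ, hψ, hD0, hD, hl, hr⟩ :=
    exists_helmholtz_wronskian_ne_zero P (hρ₀ ρ₀ le_rfl)
  have haD : P.a * D ≠ 0 := mul_ne_zero P.a_pos.ne' hD0
  set G := greenOp φ ψ hφ.continuous_fst hψ.continuous_fst with hG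
  refine ⟨P.a * ρ₀ + r, (-(P.a * D)⁻¹) • G,
    (isCompactOperator_greenOp hφ.continuous_fst hψ.continuous_fst).smul (-(P.a * D)⁻¹),
    fun f g => ?_, fun g => ?_, fun μ f hμ hf => ?_⟩
  · simp only [_root_.smul_apply, real_inner_smul_left, real_inner_smul_right, hG, inner_greenOp]
  · have hgraph := (robinGraph_greenOp (P := P) (r := r) hφ hψ hD hl hr g).const_smul (-(P.a * D)⁻¹)
    have hg : (-(P.a * D)⁻¹) • (P.a * D) • g = -g := by rw [neg_smul, inv_smul_smul₀ haD]
    rwa [smul_add, hg, ← sub_eq_add_neg, smul_comm] at hgraph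
  · obtain ⟨t, hft, ht⟩ := hf.exists_eq_smul_robinFlow
    have hρ : ρ₀ ≤ (μ - r) / P.a := by rw [le_div_iff₀ P.a_pos]; linarith
    obtain rfl : t = 0 := (mul_eq_zero.1 ht).resolve_right fun hr => by
      obtain ⟨hv, hw⟩ := hρ₀ _ hρ _ _ (isHelmholtz_robinFlow _ P.θ₁)
        (by rw [robinFlow_zero]; ring) hr
      exact robinFlow_ne_zero _ P.θ₁ (1 / 2) (Prod.ext hv hw)
    have hzero : (0 : ℝ → ℝ) =ᵐ[unitMeasure] (0 : L2) := (Lp.coeFn_zero ℝ 2 unitMeasure).symm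
    refine Lp.ext (hft.trans (.trans (ae_of_all _ fun x => ?_) hzero))
    exact zero_mul _

universe u

/-! ### Operators that are diagonal in an orthonormal basis -/

section Diagonal

variable {ι E : Type*} [NormedAddCommGroup E] [InnerProductSpace ℝ E] (b : HilbertBasis ι ℝ E)

theorem hasSum_coord_sq (x : E) : HasSum (fun j => inner ℝ (b j) x ^ 2) (‖x‖ ^ 2) := by
  have h := b.hasSum_inner_mul_inner x x
  rw [real_inner_self_eq_norm_sq] at h
  refine h.congr_fun fun j => ?_
  rw [real_inner_comm x, sq]

variable {b} in
theorem ext_coord {x y : E} (h : ∀ j, inner ℝ (b j) x = inner ℝ (b j) y) : x = y :=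
  b.repr.injective (lp.ext (funext fun j => by
    rw [b.repr_apply_apply, b.repr_apply_apply, h]))

theorem norm_le_of_coord_le {x y : E} {C : ℝ} (hC : 0 ≤ C)
    (h : ∀ j, |inner ℝ (b j) x| ≤ C * |inner ℝ (b j) y|) : ‖x‖ ≤ C * ‖y‖ := by
  refine le_of_sq_le_sq ?_ (by positivity)
  rw [mul_pow]
  refine hasSum_le (fun j => ?_) (hasSum_coord_sq b x) ((hasSum_coord_sq b y).mul_left (C ^ 2))
  rw [← sq_abs, ← sq_abs (inner ℝ (b j) y), ← mul_pow]
  gcongr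
  exact h j

theorem tendsto_of_coord {α : Type*} {l : Filter α} {x : α → E} {y g : E} {C : ℝ}
    (hlim : ∀ j, Tendsto (fun t => inner ℝ (b j) (x t)) l (𝓝 (inner ℝ (b j) y)))
    (hbound : ∀ᶠ t in l, ∀ j, |inner ℝ (b j) (x t - y)| ≤ C * |inner ℝ (b j) g|) :
    Tendsto x l (𝓝 y) := by
  have hsum : Tendsto (fun t => ∑' j, inner ℝ (b j) (x t - y) ^ 2) l (𝓝 (∑' _ : ι, (0 : ℝ))) := by
    refine tendsto_tsum_of_dominated_convergence
      (bound := fun j => C ^ 2 * inner ℝ (b j) g ^ 2)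
      ((hasSum_coord_sq b g).summable.mul_left _) (fun j => ?_) ?_
    · simp only [inner_sub_right]
      simpa using ((hlim j).sub_const (inner ℝ (b j) y)).pow 2
    · filter_upwards [hbound] with t ht j
      rw [Real.norm_of_nonneg (sq_nonneg _), ← sq_abs, ← sq_abs (inner ℝ (b j) g), ← mul_pow]
      gcongr
      exact ht j
  simp only [(hasSum_coord_sq b _).tsum_eq, tsum_zero] at hsum
  rw [tendsto_iff_norm_sub_tendsto_zero]
  simpa using hsum.sqrt

/-- The operator with entries `m`, bounded by `C`, on the diagonal in the basis `b`. -/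
def diagOp {m : ι → ℝ} {C : ℝ} (hC : 0 ≤ C) (hm : ∀ j, |m j| ≤ C) : E →L[ℝ] E :=
  b.repr.symm.toContinuousLinearEquiv.toContinuousLinearMap ∘L
    lp.mapCLM 2 (fun j => ContinuousLinearMap.lsmul ℝ ℝ (m j)) hC
      (fun j => (ContinuousLinearMap.opNorm_lsmul_apply_le (m j)).trans (hm j)) ∘L
    b.repr.toContinuousLinearEquiv.toContinuousLinearMap

theorem inner_diagOp {m : ι → ℝ} {C : ℝ} (hC : 0 ≤ C) (hm : ∀ j, |m j| ≤ C) (f : E) (j : ι) :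
    inner ℝ (b j) (diagOp b hC hm f) = m j * inner ℝ (b j) f := by
  rw [← b.repr_apply_apply, ← b.repr_apply_apply]
  simp [diagOp]

theorem inner_diagOp_comm {m : ι → ℝ} {C : ℝ} (hC : 0 ≤ C) (hm : ∀ j, |m j| ≤ C) (f g : E) :
    inner ℝ (diagOp b hC hm f) g = inner ℝ f (diagOp b hC hm g) := by
  rw [← b.tsum_inner_mul_inner, ← b.tsum_inner_mul_inner]
  refine tsum_congr fun j => ?_
  rw [real_inner_comm, real_inner_comm (b j) f, inner_diagOp, inner_diagOp, mul_right_comm]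
  ring

variable {ν : ι → ℝ} {σ : ℝ}

/-- The semigroup with exponents `ν`, bounded above by `σ`, on the diagonal in the basis `b`; it
is the identity at negative times. -/
def diagSemigroup (hν : ∀ j, ν j ≤ σ) (t : ℝ) : E →L[ℝ] E :=
  diagOp b (m := fun j => Real.exp (ν j * max t 0)) (Real.exp_pos (σ * max t 0)).le fun j => by
    rw [Real.abs_exp]
    gcongr
    exact hν j

variable (hν : ∀ j, ν j ≤ σ)

theorem inner_diagSemigroup (t : ℝ) (f : E) (j : ι) :
    inner ℝ (b j) (diagSemigroup b hν t f) = Real.exp (ν j * max t 0) * inner ℝ (b j) f :=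
  inner_diagOp b _ _ f j

theorem inner_diagSemigroup_of_nonneg {t : ℝ} (ht : 0 ≤ t) (f : E) (j : ι) :
    inner ℝ (b j) (diagSemigroup b hν t f) = Real.exp (ν j * t) * inner ℝ (b j) f := by
  rw [inner_diagSemigroup, max_eq_left ht]

theorem inner_diagSemigroup_comm (t : ℝ) (f g : E) :
    inner ℝ (diagSemigroup b hν t f) g = inner ℝ f (diagSemigroup b hν t g) :=
  inner_diagOp_comm b _ _ f g

theorem diagSemigroup_zero : diagSemigroup b hν 0 = ContinuousLinearMap.id ℝ E := by
  ext1 f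
  refine ext_coord (b := b) fun j => ?_
  rw [inner_diagSemigroup_of_nonneg b hν le_rfl, mul_zero, Real.exp_zero, one_mul,
    ContinuousLinearMap.id_apply]

theorem diagSemigroup_add {s t : ℝ} (hs : 0 ≤ s) (ht : 0 ≤ t) :
    diagSemigroup b hν (s + t) = (diagSemigroup b hν s).comp (diagSemigroup b hν t) := by
  ext1 f
  refine ext_coord (b := b) fun j => ?_
  rw [ContinuousLinearMap.comp_apply, inner_diagSemigroup_of_nonneg b hν hs,
    inner_diagSemigroup_of_nonneg b hν ht, inner_diagSemigroup_of_nonneg b hν (add_nonneg hs ht),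
    mul_add, Real.exp_add, mul_assoc]

theorem continuous_diagSemigroup (f : E) : Continuous fun t => diagSemigroup b hν t f := by
  rw [continuous_iff_continuousAt]
  intro t₀
  set M := Real.exp (|σ| * (|t₀| + 1)) with hM
  have hexp : ∀ j, ∀ t < |t₀| + 1, Real.exp (ν j * max t 0) ≤ M := fun j t ht => by
    have hmax : max t 0 ≤ |t₀| + 1 := max_le ht.le (by positivity)
    have hνj : ν j ≤ |σ| := (hν j).trans (le_abs_self σ)
    rw [hM]
    gcongr
  have ht₀ : t₀ < |t₀| + 1 := (le_abs_self t₀).trans_lt (lt_add_one _)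
  refine tendsto_of_coord b (g := f) (C := M) (fun j => ?_) ?_
  · simp only [inner_diagSemigroup]
    exact Continuous.tendsto (by fun_prop) t₀
  · filter_upwards [Iio_mem_nhds ht₀] with t ht j
    rw [inner_sub_right, inner_diagSemigroup, inner_diagSemigroup, ← sub_mul, abs_mul]
    gcongr
    exact abs_sub_le_of_nonneg_of_le (Real.exp_pos _).le (hexp j t ht) (Real.exp_pos _).le
      (hexp j t₀ ht₀)

end Diagonal

theorem mem_orthogonal_of_forall_inner_eq_zero {ι E : Type*} [NormedAddCommGroup E]
    [InnerProductSpace ℝ E] {V : Submodule ℝ E} [V.HasOrthogonalProjection]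
    (b : HilbertBasis ι ℝ V) {x : E} (h : ∀ j, inner ℝ (b j : E) x = 0) : x ∈ Vᗮ := by
  rw [← Submodule.orthogonalProjectionOnto_eq_zero_iff]
  refine ext_coord (b := b) fun j => ?_
  rw [inner_zero_right, Submodule.inner_orthogonalProjectionOnto_eq_of_mem_left, h j]

theorem exists_hilbertBasis_eigenvectors {E : Type u} [NormedAddCommGroup E]
    [InnerProductSpace ℝ E] [CompleteSpace E] {T : E →L[ℝ] E} (hT : IsCompactOperator T)
    (hTs : (T : E →ₗ[ℝ] E).IsSymmetric) :
    ∃ (ι : Type u) (b : HilbertBasis ι ℝ E) (ev : ι → ℝ), ∀ j, T (b j) = ev j • b j := by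
  set V : ℝ → Submodule ℝ E := fun μ => Module.End.eigenspace (T : E →ₗ[ℝ] E) μ
  have hcomplete : ∀ μ, CompleteSpace (V μ) := fun μ => inferInstance
  choose w bw _ using fun μ => exists_hilbertBasis ℝ (V μ)
  have horth : Orthonormal ℝ fun j : Σ μ, w μ => (bw j.1 j.2 : E) :=
    hTs.orthogonalFamily_eigenspaces.orthonormal_sigma_orthonormal fun μ => (bw μ).orthonormal
  have hbot : (Submodule.span ℝ (range fun j : Σ μ, w μ => (bw j.1 j.2 : E)))ᗮ = ⊥ := by
    rw [eq_bot_iff, ← ContinuousLinearMap.orthogonalComplement_iSup_eigenspaces_eq_bot hT hTs,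
      ← Submodule.iInf_orthogonal]
    intro x hx
    rw [Submodule.mem_iInf]
    intro μ
    refine mem_orthogonal_of_forall_inner_eq_zero (bw μ) fun j => ?_
    exact (Submodule.mem_orthogonal _ _).1 hx _ (Submodule.subset_span ⟨⟨μ, j⟩, rfl⟩)
  refine ⟨_, HilbertBasis.mkOfOrthogonalEqBot horth hbot, fun j => j.1, fun j => ?_⟩
  rw [HilbertBasis.coe_mkOfOrthogonalEqBot]
  exact Module.End.mem_eigenspace_iff.1 (bw j.1 j.2).2

/-! ### Semigroups generated by diagonal operators -/

theorem abs_exp_sub_one_le_mul_exp {x s : ℝ} (hx : x ≤ s) (hs : 0 ≤ s) :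
    |Real.exp x - 1| ≤ |x| * Real.exp s := by
  have hexp : Real.exp x ≤ Real.exp s := Real.exp_le_exp.2 hx
  rcases le_total 0 x with h | h
  · have hneg : 1 - x ≤ Real.exp (-x) := Real.one_sub_le_exp_neg x
    have hmul : Real.exp x * Real.exp (-x) = 1 := by rw [← Real.exp_add]; simp
    rw [abs_of_nonneg h, abs_of_nonneg (by linarith [Real.add_one_le_exp x])]
    nlinarith [Real.exp_pos x]
  · rw [abs_of_nonpos h, abs_of_nonpos (by linarith [Real.exp_le_one_iff.2 h])]
    nlinarith [Real.add_one_le_exp x, Real.one_le_exp hs]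

theorem hasDerivAt_exp_const_mul (ν t : ℝ) :
    HasDerivAt (fun t => Real.exp (ν * t)) (ν * Real.exp (ν * t)) t := by
  simpa [mul_comm] using ((hasDerivAt_id t).const_mul ν).exp

theorem tendsto_inv_mul_exp_sub_one (ν : ℝ) :
    Tendsto (fun t => t⁻¹ * (Real.exp (ν * t) - 1)) (𝓝[>] 0) (𝓝 ν) := by
  have h := (hasDerivAt_iff_tendsto_slope_zero.1 (hasDerivAt_exp_const_mul ν 0)).mono_left
    (nhdsGT_le_nhdsNE 0)
  simpa using h

section DiagSemigroup

variable {ι : Type*} (b : HilbertBasis ι ℝ L2) {ν : ι → ℝ} {σ : ℝ} (hν : ∀ j, ν j ≤ σ)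
  {S : ℝ → L2 →L[ℝ] L2} {G : L2 → L2 → Prop}

theorem isC0Semigroup_diagSemigroup : IsC0Semigroup (diagSemigroup b hν) where
  zero := diagSemigroup_zero b hν
  add _ _ hs ht := diagSemigroup_add b hν hs ht
  cont f := (continuous_diagSemigroup b hν f).continuousOn

theorem inner_diagSemigroup_difference_quotient {t : ℝ} (ht : 0 ≤ t) (f : L2) (j : ι) :
    inner ℝ (b j) (t⁻¹ • (diagSemigroup b hν t f - f)) =
      t⁻¹ * (Real.exp (ν j * t) - 1) * inner ℝ (b j) f := by
  rw [inner_smul_right, inner_sub_right, inner_diagSemigroup_of_nonneg b hν ht, ← sub_one_mul,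
    mul_assoc]

theorem tendsto_diagSemigroup_difference_quotient {f g : L2}
    (hfg : ∀ j, inner ℝ (b j) g = ν j * inner ℝ (b j) f) :
    Tendsto (fun t : ℝ => t⁻¹ • (diagSemigroup b hν t f - f)) (𝓝[>] 0) (𝓝 g) := by
  refine tendsto_of_coord b (g := g) (C := Real.exp |σ| + 1) (fun j => ?_) ?_
  · rw [hfg]
    refine ((tendsto_inv_mul_exp_sub_one (ν j)).mul_const _).congr' ?_
    filter_upwards [self_mem_nhdsWithin] with t ht
    rw [inner_diagSemigroup_difference_quotient b hν (le_of_lt ht)]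
  · filter_upwards [Ioc_mem_nhdsGT one_pos] with t ht j
    have hνt : ν j * t ≤ |σ| :=
      calc ν j * t ≤ |σ| * t := by
            have := ht.1.le
            gcongr
            exact (hν j).trans (le_abs_self σ)
        _ ≤ |σ| := mul_le_of_le_one_right (abs_nonneg σ) ht.2
    have hquot : |t⁻¹ * (Real.exp (ν j * t) - 1)| ≤ Real.exp |σ| * |ν j| := by
      rw [abs_mul, abs_inv, abs_of_pos ht.1, inv_mul_le_iff₀ ht.1]
      refine (abs_exp_sub_one_le_mul_exp hνt (abs_nonneg σ)).trans_eq ?_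
      rw [abs_mul, abs_of_pos ht.1]
      ring
    rw [inner_sub_right, inner_diagSemigroup_difference_quotient b hν ht.1.le, hfg, ← sub_mul,
      abs_mul, abs_mul, ← mul_assoc, add_one_mul]
    gcongr
    exact (abs_sub _ _).trans (by gcongr)

theorem isGeneratedBy_diagSemigroup
    (hG : ∀ f g, G f g ↔ ∀ j, inner ℝ (b j) g = ν j * inner ℝ (b j) f) :
    IsGeneratedBy (diagSemigroup b hν) G := by
  refine ⟨isC0Semigroup_diagSemigroup b hν, fun f g => ?_⟩
  rw [hG]
  refine ⟨tendsto_diagSemigroup_difference_quotient b hν, fun h j => ?_⟩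
  refine tendsto_nhds_unique (((innerSL ℝ (b j)).continuous.tendsto g).comp h) ?_
  refine ((tendsto_inv_mul_exp_sub_one (ν j)).mul_const (inner ℝ (b j) f)).congr' ?_
  filter_upwards [self_mem_nhdsWithin] with t ht
  exact (inner_diagSemigroup_difference_quotient b hν (le_of_lt ht) f j).symm

theorem IsGeneratedBy.hasDerivWithinAt {f g : L2} (hS : IsGeneratedBy S G) (hfg : G f g)
    {x : ℝ} (hx : 0 ≤ x) : HasDerivWithinAt (fun t => S t f) (S x g) (Ici x) x := by
  rw [← hasDerivWithinAt_Ioi_iff_Ici, hasDerivWithinAt_iff_tendsto_slope' self_notMem_Ioi]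
  have hshift : Tendsto (fun y : ℝ => y - x) (𝓝[>] x) (𝓝[>] 0) := by
    rw [← sub_self x]
    exact (continuous_sub_right x).continuousWithinAt.tendsto_nhdsWithin
      fun y hy => sub_lt_sub_right hy x
  refine (((S x).continuous.tendsto g).comp (((hS.2 f g).1 hfg).comp hshift)).congr' ?_
  filter_upwards [self_mem_nhdsWithin] with y hy
  have hadd := hS.1.add x (y - x) hx (sub_pos.2 hy).le
  rw [add_sub_cancel] at hadd
  rw [slope, vsub_eq_sub, hadd, ContinuousLinearMap.comp_apply, Function.comp_apply,
    Function.comp_apply, map_smul, map_sub]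

theorem IsGeneratedBy.apply_eigenvector (hS : IsGeneratedBy S G) {f : L2} {μ : ℝ}
    (hf : G f (μ • f)) {t : ℝ} (ht : 0 ≤ t) : S t f = Real.exp (μ * t) • f := by
  have hconst := constant_of_has_deriv_right_zero (f := fun s => Real.exp (-μ * s) • S s f)
    (a := 0) (b := t)
    (((by fun_prop : Continuous fun s => Real.exp (-μ * s)).continuousOn).smul
      ((hS.1.cont f).mono Icc_subset_Ici_self))
    (fun x hx => by
      refine ((hasDerivAt_exp_const_mul (-μ) x).hasDerivWithinAt.smul
        (hS.hasDerivWithinAt hf hx.1)).congr_deriv ?_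
      rw [map_smul]
      module)
    t ⟨ht, le_rfl⟩
  simp only [mul_zero, Real.exp_zero, one_smul, hS.1.zero, ContinuousLinearMap.id_apply]
    at hconst
  conv_rhs => rw [← hconst]
  rw [smul_smul, ← Real.exp_add, neg_mul, add_neg_cancel, Real.exp_zero, one_smul]

theorem IsGeneratedBy.eq_diagSemigroup (hS : IsGeneratedBy S G)
    (hG : ∀ f g, G f g ↔ ∀ j, inner ℝ (b j) g = ν j * inner ℝ (b j) f)
    (hb : ∀ j, G (b j) (ν j • b j)) {t : ℝ} (ht : 0 ≤ t) : S t = diagSemigroup b hν t := by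
  have hdense : Dense (Submodule.span ℝ (range b) : Set L2) :=
    Submodule.dense_iff_topologicalClosure_eq_top.2 b.dense_span
  refine ContinuousLinearMap.ext_on hdense ?_
  rintro _ ⟨j, rfl⟩
  rw [hS.apply_eigenvector (hb j) ht,
    (isGeneratedBy_diagSemigroup b hν hG).apply_eigenvector (hb j) ht]

end DiagSemigroup

/-! ### Eigenbases of the Robin operator -/

/-- The Robin operator `f ↦ a f'' + r f` is diagonal in the Hilbert basis `b`, with eigenvalues `ev`
bounded above by `σ`. -/
structure IsEigenbasis (P : Coeffs) (r : ℝ) {ι : Type} (b : HilbertBasis ι ℝ L2) (ev : ι → ℝ)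
    (σ : ℝ) : Prop where
  le : ∀ j, ev j ≤ σ
  graph_iff : ∀ f g, RobinGraph P r f g ↔ ∀ j, inner ℝ (b j) g = ev j * inner ℝ (b j) f

theorem exists_isEigenbasis (P : Coeffs) (r : ℝ) :
    ∃ (ι : Type) (b : HilbertBasis ι ℝ L2) (ev : ι → ℝ) (σ : ℝ), IsEigenbasis P r b ev σ := by
  obtain ⟨σ, R, hRcompact, hRsymm, hRgraph, hσ⟩ := exists_resolvent P r
  obtain ⟨ι, b, κ, hκ⟩ := exists_hilbertBasis_eigenvectors hRcompact hRsymm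
  have hcoord : ∀ j g, inner ℝ (b j) (R g) = κ j * inner ℝ (b j) g := fun j g => by
    rw [← hRsymm, hκ, inner_smul_left, conj_trivial]
  have hκ0 : ∀ j, κ j ≠ 0 := fun j h0 => by
    have h := hRgraph (b j)
    rw [hκ, h0, zero_smul, smul_zero, zero_sub] at h
    exact b.orthonormal.ne_zero j (neg_eq_zero.1 h.eq_zero)
  have hresolvent : ∀ f g, RobinGraph P r f g ↔ R (σ • f - g) = f := fun f g => by
    refine ⟨fun h => (sub_eq_zero.1 (hσ σ _ le_rfl ?_)).symm, fun h => ?_⟩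
    · convert! h.sub (hRgraph (σ • f - g)) using 1
      module
    · simpa only [h, sub_sub_cancel] using hRgraph (σ • f - g)
  have hgraph : ∀ f g, RobinGraph P r f g ↔
      ∀ j, inner ℝ (b j) g = (σ - (κ j)⁻¹) * inner ℝ (b j) f := fun f g => by
    rw [hresolvent]
    refine ⟨fun h j => ?_, fun h => ext_coord (b := b) fun j => ?_⟩
    · have hj := hcoord j (σ • f - g)
      rw [h, inner_sub_right, inner_smul_right] at hj
      have := hκ0 j
      field_simp
      linear_combination hj
    · have := hκ0 j
      rw [hcoord, inner_sub_right, inner_smul_right, h j]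
      field_simp
      ring
  refine ⟨ι, b, fun j => σ - (κ j)⁻¹, σ, fun j => ?_, hgraph⟩
  by_contra! hlt
  refine b.orthonormal.ne_zero j (hσ _ _ hlt.le ((hgraph _ _).2 fun i => ?_))
  rcases eq_or_ne i j with rfl | hij
  · rw [inner_smul_right]
  · rw [inner_smul_right, b.orthonormal.2 hij, mul_zero, mul_zero]

namespace IsEigenbasis

variable {P : Coeffs} {r : ℝ} {ι : Type} {b : HilbertBasis ι ℝ L2} {ev : ι → ℝ} {σ : ℝ}
  (hB : IsEigenbasis P r b ev σ)
include hB

theorem graph (j : ι) : RobinGraph P r (b j) (ev j • b j) := by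
  refine (hB.graph_iff _ _).2 fun i => ?_
  rcases eq_or_ne i j with rfl | hij
  · rw [inner_smul_right]
  · rw [inner_smul_right, b.orthonormal.2 hij, mul_zero, mul_zero]

theorem eigenvalue_le {μ : ℝ} {f : L2} (hf : RobinGraph P r f (μ • f)) (hf0 : f ≠ 0) : μ ≤ σ := by
  obtain ⟨j, hj⟩ : ∃ j, inner ℝ (b j) f ≠ 0 := by
    by_contra! h
    exact hf0 (ext_coord (b := b) fun j => by rw [h j, inner_zero_right])
  have hμ := (hB.graph_iff _ _).1 hf j
  rw [inner_smul_right] at hμ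
  exact (mul_right_cancel₀ hj hμ).trans_le (hB.le j)

theorem isGeneratedBy : IsGeneratedBy (diagSemigroup b hB.le) (RobinGraph P r) :=
  isGeneratedBy_diagSemigroup b hB.le hB.graph_iff

theorem eq_diagSemigroup {S : ℝ → L2 →L[ℝ] L2} (hS : IsGeneratedBy S (RobinGraph P r)) {t : ℝ}
    (ht : 0 ≤ t) : S t = diagSemigroup b hB.le t :=
  hS.eq_diagSemigroup b hB.le hB.graph_iff hB.graph ht

theorem inner_diagSemigroup_eigenvector {μ : ℝ} {e : L2} (he : RobinGraph P r e (μ • e)) {t : ℝ}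
    (ht : 0 ≤ t) (f : L2) :
    inner ℝ e (diagSemigroup b hB.le t f) = Real.exp (μ * t) * inner ℝ e f := by
  rw [← inner_diagSemigroup_comm, hB.isGeneratedBy.apply_eigenvector he ht, real_inner_smul_left]

end IsEigenbasis

/-! ### Lifting, output and gain as bounded operators -/

theorem liftFun_add (P : Coeffs) (k : ℕ) (u v : EuclideanSpace ℝ (Fin 2)) :
    liftFun P k (u + v) = liftFun P k u + liftFun P k v := by
  ext x
  simp only [liftFun, PiLp.add_apply, Pi.add_apply]
  ring

theorem liftFun_smul (P : Coeffs) (k : ℕ) (s : ℝ) (u : EuclideanSpace ℝ (Fin 2)) :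
    liftFun P k (s • u) = s • liftFun P k u := by
  ext x
  simp only [liftFun, PiLp.smul_apply, Pi.smul_apply, smul_eq_mul]
  ring

theorem lift_add (P : Coeffs) (k : ℕ) (u v : EuclideanSpace ℝ (Fin 2)) :
    lift P k (u + v) = lift P k u + lift P k v := by
  simp only [lift, liftFun_add]
  rfl

theorem lift_smul (P : Coeffs) (k : ℕ) (s : ℝ) (u : EuclideanSpace ℝ (Fin 2)) :
    lift P k (s • u) = s • lift P k u := by
  simp only [lift, liftFun_smul]
  rfl

theorem opLift_add_left (P : Coeffs) (r s : ℝ) (k : ℕ) (u : EuclideanSpace ℝ (Fin 2)) :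
    opLift P (r + s) k u = opLift P r k u + s • lift P k u := by
  simp only [opLift, add_mul, ← add_assoc]
  rfl

theorem opLift_add (P : Coeffs) (r : ℝ) (k : ℕ) (u v : EuclideanSpace ℝ (Fin 2)) :
    opLift P r k (u + v) = opLift P r k u + opLift P r k v := by
  have hfun : (fun x => P.a * iteratedDeriv 2 (liftFun P k (u + v)) x
        + r * liftFun P k (u + v) x) =
      (fun x => P.a * iteratedDeriv 2 (liftFun P k u) x + r * liftFun P k u x) +
        fun x => P.a * iteratedDeriv 2 (liftFun P k v) x + r * liftFun P k v x := by
    ext x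
    rw [liftFun_add, iteratedDeriv_add (contDiff_liftFun P k u).contDiffAt
      (contDiff_liftFun P k v).contDiffAt]
    simp only [Pi.add_apply]
    ring
  simp only [opLift, hfun]
  rfl

theorem opLift_smul (P : Coeffs) (r : ℝ) (k : ℕ) (s : ℝ) (u : EuclideanSpace ℝ (Fin 2)) :
    opLift P r k (s • u) = s • opLift P r k u := by
  have hfun : (fun x => P.a * iteratedDeriv 2 (liftFun P k (s • u)) x
        + r * liftFun P k (s • u) x) =
      s • fun x => P.a * iteratedDeriv 2 (liftFun P k u) x + r * liftFun P k u x := by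
    ext x
    rw [liftFun_smul, iteratedDeriv_const_smul_field]
    simp only [Pi.smul_apply, smul_eq_mul]
    ring
  simp only [opLift, hfun]
  rfl

/-- The lifting operator `L_k` as a bounded operator. -/
def liftL (P : Coeffs) (k : ℕ) : EuclideanSpace ℝ (Fin 2) →L[ℝ] L2 :=
  LinearMap.toContinuousLinearMap
    { toFun := lift P k
      map_add' := lift_add P k
      map_smul' := lift_smul P k }

/-- `u ↦ a (L_k u)'' + r L_k u` as a bounded operator. -/
def opLiftL (P : Coeffs) (r : ℝ) (k : ℕ) : EuclideanSpace ℝ (Fin 2) →L[ℝ] L2 :=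
  LinearMap.toContinuousLinearMap
    { toFun := opLift P r k
      map_add' := opLift_add P r k
      map_smul' := opLift_smul P r k }

/-- The output operator `f ↦ (⟨f, e₁⟩, …, ⟨f, e_{N₀}⟩)`. -/
def outputL {N₀ : ℕ} (e : Fin N₀ → L2) : L2 →L[ℝ] EuclideanSpace ℝ (Fin N₀) :=
  (EuclideanSpace.equiv (Fin N₀) ℝ).symm.toContinuousLinearMap ∘L
    ContinuousLinearMap.pi fun i => innerSL ℝ (e i)

theorem outputL_apply {N₀ : ℕ} (e : Fin N₀ → L2) (f : L2) (i : Fin N₀) :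
    outputL e f i = inner ℝ (e i) f :=
  rfl

/-- A real matrix as a bounded operator between Euclidean spaces. -/
def matL {m n : Type*} [Fintype m] [Fintype n] [DecidableEq n] (K : Matrix m n ℝ) :
    EuclideanSpace ℝ n →L[ℝ] EuclideanSpace ℝ m :=
  LinearMap.toContinuousLinearMap (Matrix.toEuclideanLin K)

theorem matL_apply {m n : Type*} [Fintype m] [Fintype n] [DecidableEq n] (K : Matrix m n ℝ)
    (v : EuclideanSpace ℝ n) (i : m) : matL K v i = K.mulVec v i :=
  rfl

theorem norm_matL_apply_le {m n : Type*} [Fintype m] [Fintype n] [DecidableEq n]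
    (K : Matrix m n ℝ) (v : EuclideanSpace ℝ n) : ‖matL K v‖ ≤ ‖K‖ * ‖v‖ :=
  Matrix.l2_opNorm_mulVec K v

theorem feedback_eq {N₀ : ℕ} (e : Fin N₀ → L2) (K : Matrix (Fin 2) (Fin N₀) ℝ) (X : ℝ → L2)
    (t : ℝ) : feedback e K X t = matL K (outputL e (X t)) := by
  simp only [feedback, real_inner_comm]
  rfl

theorem matL_matB_apply (P : Coeffs) (k : ℕ) {N₀ : ℕ} (e : Fin N₀ → L2)
    (u : EuclideanSpace ℝ (Fin 2)) (i : Fin N₀) :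
    matL (matB P k e) u i = inner ℝ (e i) (opLiftL P (P.b + P.c) k u) -
      lam P i * inner ℝ (e i) (liftL P k u) := by
  have hu : u = u 0 • EuclideanSpace.single 0 (1 : ℝ) + u 1 • EuclideanSpace.single 1 (1 : ℝ) := by
    ext j
    fin_cases j <;> simp
  rw [matL_apply, Matrix.mulVec_apply_eq_sum, Fin.sum_univ_two]
  conv_rhs => rw [hu]
  simp only [map_add, map_smul, inner_add_right, real_inner_smul_right]
  simp only [matB, Matrix.of_apply, real_inner_comm, liftL, opLiftL,
    LinearMap.coe_toContinuousLinearMap', LinearMap.coe_mk, AddHom.coe_mk]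
  ring

/-! ### Mild solutions -/

/-- The data of the delayed control problem: a delay with values in `[hm, hM]`, a continuous
history `Φ` and a locally essentially bounded disturbance `p`. -/
structure IsAdmissible (hm hM : ℝ) (h : ℝ → ℝ) (Φ p : ℝ → L2) : Prop where
  isDelay : IsDelay hm hM h
  history : ContinuousOn Φ (Icc (-hM) 0)
  disturbance : ∀ T, 0 ≤ T → MemLp p ⊤ (volume.restrict (Icc 0 T))

/-- The part `𝒜 L_k u - L_k u' + p` of the forcing in the equation of `X - L_k u` which does not
involve the state `X`. -/
def source (P : Coeffs) (k : ℕ) (u : ℝ → EuclideanSpace ℝ (Fin 2)) (p : ℝ → L2) (s : ℝ) : L2 :=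
  opLiftL P P.b k (u s) - liftL P k (deriv u s) + p s

section Mild
variable {P : Coeffs} {k : ℕ} {hm hM : ℝ} {h : ℝ → ℝ} {Φ p : ℝ → L2}
  {u : ℝ → EuclideanSpace ℝ (Fin 2)} {X : ℝ → L2}

theorem IsAdmissible.intervalIntegrable (hA : IsAdmissible hm hM h Φ p) {T : ℝ} (hT : 0 ≤ T) :
    IntervalIntegrable p volume 0 T :=
  (intervalIntegrable_iff_integrableOn_Icc_of_le hT).2
    ((hA.disturbance T hT).integrable le_top)

theorem intervalIntegrable_source (P : Coeffs) (k : ℕ) {T : ℝ}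
    (hu : AbsolutelyContinuousOnInterval u 0 T) (hp : IntervalIntegrable p volume 0 T) :
    IntervalIntegrable (source P k u p) volume 0 T := by
  have hop : IntervalIntegrable (fun s => opLiftL P P.b k (u s)) volume 0 T :=
    ((opLiftL P P.b k).continuous.comp_continuousOn hu.continuousOn).intervalIntegrable
  have hlift := (isPrimitiveOn_deriv_of_absolutelyContinuousOnInterval hu).clm_comp (liftL P k)
  exact (hop.sub hlift.intervalIntegrable).add hp

theorem continuousOn_Ici_of_absolutelyContinuousOnInterval {E : Type*}
    [SeminormedAddCommGroup E] {y : ℝ → E}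
    (hy : ∀ T, 0 ≤ T → AbsolutelyContinuousOnInterval y 0 T) : ContinuousOn y (Ici 0) := by
  intro t ht
  rw [mem_Ici] at ht
  have ht' : 0 ≤ t + 1 := by linarith
  have hcont : ContinuousOn y (Icc 0 (t + 1)) := uIcc_of_le ht' ▸ (hy _ ht').continuousOn
  refine (hcont t ⟨ht, (lt_add_one t).le⟩).mono_of_mem_nhdsWithin ?_
  rw [← Ici_inter_Iic]
  exact inter_mem_nhdsWithin _ (Iic_mem_nhds (lt_add_one t))

theorem IsMildSolution.continuousOn (hX : IsMildSolution P k hM h Φ p u X)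
    (hΦ : ContinuousOn Φ (Icc (-hM) 0)) : ContinuousOn X (Ici (-hM)) := by
  refine ((hΦ.congr hX.2.1).union_of_isClosed hX.1 isClosed_Icc isClosed_Ici).mono fun t ht => ?_
  exact (le_total t 0).imp (fun h0 => ⟨ht, h0⟩) id

variable {ι : Type} {b : HilbertBasis ι ℝ L2} {ev : ι → ℝ} {σ : ℝ}

theorem IsEigenbasis.isMildSolution_iff (hB : IsEigenbasis P P.b b ev σ) :
    IsMildSolution P k hM h Φ p u X ↔
      ContinuousOn X (Ici 0) ∧ EqOn X Φ (Icc (-hM) 0) ∧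
      (∀ T, 0 ≤ T → AbsolutelyContinuousOnInterval u 0 T) ∧ ∀ t, 0 ≤ t →
        X t = diagSemigroup b hB.le t (Φ 0 - liftL P k (u 0)) + liftL P k (u t) +
          ∫ s in (0 : ℝ)..t,
            diagSemigroup b hB.le (t - s) (P.c • X (s - h s) + source P k u p s) := by
  have hforcing (s : ℝ) : P.c • X (s - h s) + source P k u p s =
      opLift P P.b k (u s) - lift P k (deriv u s) + P.c • X (s - h s) + p s := by
    change P.c • X (s - h s) + (opLift P P.b k (u s) - lift P k (deriv u s) + p s) = _
    abel
  simp only [hforcing]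
  refine and_congr_right fun _ => and_congr_right fun _ => and_congr_right fun _ => ⟨?_, fun hX =>
    ⟨diagSemigroup b hB.le, hB.isGeneratedBy, hX⟩⟩
  rintro ⟨S, hS, hX⟩ t ht
  rw [hX t ht, hB.eq_diagSemigroup hS ht]
  refine congrArg _ (intervalIntegral.integral_congr fun s hs => ?_)
  rw [uIcc_of_le ht] at hs
  exact congrArg (fun U : L2 →L[ℝ] L2 => U _) (hB.eq_diagSemigroup hS (sub_nonneg.2 hs.2))

theorem exists_isMildSolution (hA : IsAdmissible hm hM h Φ p)
    (hu : ∀ T, 0 ≤ T → AbsolutelyContinuousOnInterval u 0 T) :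
    ∃ X, IsMildSolution P k hM h Φ p u X := by
  obtain ⟨ι, b, ev, σ, hB⟩ := exists_isEigenbasis P P.b
  have hsource (T : ℝ) (hT : 0 ≤ T) :=
    intervalIntegrable_source P k (hu T hT) (hA.intervalIntegrable hT)
  have hU := continuous_diagSemigroup b hB.le
  obtain ⟨X, hXc, hXΦ, hX⟩ := exists_delay_volterra hA.isDelay hU
    (g := fun t => diagSemigroup b hB.le t (Φ 0 - liftL P k (u 0)) + liftL P k (u t) +
      ∫ s in (0 : ℝ)..t, diagSemigroup b hB.le (t - s) (source P k u p s)) P.c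
    (((hU _).continuousOn.add ((liftL P k).continuous.comp_continuousOn
      (continuousOn_Ici_of_absolutelyContinuousOnInterval hu))).add
        (continuousOn_convolution hU hsource)) hA.history (by simp [diagSemigroup_zero])
  refine ⟨X, hB.isMildSolution_iff.2 ⟨hXc.mono (Ici_subset_Ici.2 (neg_nonpos.2
    hA.isDelay.hM_pos.le)), hXΦ, hu, fun t ht => ?_⟩⟩
  rw [hX t ht, add_assoc, ← intervalIntegral.integral_add
    (intervalIntegrable_convolution hU (hsource t ht) t)
    (intervalIntegrable_convolution hU (hA.isDelay.intervalIntegrable_smul_comp hXc P.c ht) t)]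
  simp only [map_add, add_comm]

theorem IsMildSolution.eqOn (hh : IsDelay hm hM h) {X' : ℝ → L2}
    (hX : IsMildSolution P k hM h Φ p u X) (hX' : IsMildSolution P k hM h Φ p u X') :
    EqOn X X' (Ici (-hM)) := by
  obtain ⟨ι, b, ev, σ, hB⟩ := exists_isEigenbasis P P.b
  rw [hB.isMildSolution_iff] at hX hX'
  refine eqOn_of_delay hh.pos (hX.2.1.trans hX'.2.1.symm) fun t ht hpast => ?_
  rw [hX.2.2.2 t ht, hX'.2.2.2 t ht, hh.integral_congr (Ξ := fun s f =>
    diagSemigroup b hB.le (t - s) (P.c • f + source P k u p s)) ht (sub_add_cancel t hm).ge hpast]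

theorem IsMildSolution.congr_input (hX : IsMildSolution P k hM h Φ p u X)
    {u' : ℝ → EuclideanSpace ℝ (Fin 2)} (hu : EqOn u' u (Ici 0)) :
    IsMildSolution P k hM h Φ p u' X := by
  obtain ⟨ι, b, ev, σ, hB⟩ := exists_isEigenbasis P P.b
  rw [hB.isMildSolution_iff] at hX ⊢
  obtain ⟨hXc, hXΦ, hAC, hduhamel⟩ := hX
  refine ⟨hXc, hXΦ, fun T hT => ?_, fun t ht => ?_⟩
  · refine absolutelyContinuousOnInterval_of_dist_le (hAC T hT) fun s hs t ht => ?_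
    rw [uIcc_of_le hT] at hs ht
    rw [hu hs.1, hu ht.1]
  · rw [hduhamel t ht, hu self_mem_Ici, hu ht]
    refine congrArg _ (intervalIntegral.integral_congr_Ioo_of_le ht fun s hs => ?_)
    have hderiv : deriv u' s = deriv u s :=
      (hu.eventuallyEq_of_mem (Ici_mem_nhds hs.1)).deriv_eq
    simp only [source, hu hs.1.le, hderiv]

end Mild

/-! ### The output equation and the closed loop -/

/-- The matrix `A - c` of the output equation in open loop, from which the delayed term
`c Y(t - h(t))` is kept apart. -/
def openLoopMatrix (P : Coeffs) (N₀ : ℕ) : Matrix (Fin N₀) (Fin N₀) ℝ :=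
  matA P N₀ - Matrix.scalar _ P.c

/-- The matrix `A + B K - c` of the output equation in closed loop. -/
def closedLoopMatrix (P : Coeffs) (k : ℕ) {N₀ : ℕ} (e : Fin N₀ → L2)
    (K : Matrix (Fin 2) (Fin N₀) ℝ) : Matrix (Fin N₀) (Fin N₀) ℝ :=
  matA P N₀ + matB P k e * K - Matrix.scalar _ P.c

theorem openLoopMatrix_mulVec (P : Coeffs) {N₀ : ℕ} (y : EuclideanSpace ℝ (Fin N₀)) (i : Fin N₀) :
    (openLoopMatrix P N₀).mulVec y i = (lam P i - P.c) * y i := by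
  rw [openLoopMatrix, matA, Matrix.scalar_apply, Matrix.diagonal_sub, Matrix.mulVec_diagonal]

theorem toEuclideanCLM_closedLoopMatrix (P : Coeffs) (k : ℕ) {N₀ : ℕ} (e : Fin N₀ → L2)
    (K : Matrix (Fin 2) (Fin N₀) ℝ) (y : EuclideanSpace ℝ (Fin N₀)) :
    Matrix.toEuclideanCLM (𝕜 := ℝ) (closedLoopMatrix P k e K) y =
      Matrix.toEuclideanCLM (𝕜 := ℝ) (openLoopMatrix P N₀) y + matL (matB P k e) (matL K y) := by
  rw [closedLoopMatrix, add_sub_right_comm, map_add, ← openLoopMatrix, _root_.add_apply]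
  refine congrArg _ (PiLp.ext fun i => ?_)
  rw [matL_apply, Matrix.ofLp_toEuclideanCLM, ← Matrix.mulVec_mulVec]
  rfl

theorem IsUnitEigenvector.robinGraph {P : Coeffs} {μ : ℝ} {f : L2}
    (hf : IsUnitEigenvector P μ f) : RobinGraph P P.b f ((μ - P.c) • f) := by
  rw [← robinGraph_add_smul_iff (s := P.c), ← add_smul, sub_add_cancel]
  exact hf.2

section Loop
variable {P : Coeffs} {k : ℕ} {hm hM : ℝ} {h : ℝ → ℝ} {Φ p : ℝ → L2}
  {u : ℝ → EuclideanSpace ℝ (Fin 2)} {X : ℝ → L2}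

/-- An eigenmode of `X - L_k u` obeys a scalar variation of constants formula, and adding back the
mode of `L_k u` replaces `u'` by `u`. -/
theorem IsMildSolution.isPrimitiveOn_inner (hA : IsAdmissible hm hM h Φ p)
    (hX : IsMildSolution P k hM h Φ p u X) {ν : ℝ} {f : L2} (hf : RobinGraph P P.b f (ν • f))
    {T : ℝ} (hT : 0 ≤ T) :
    IsPrimitiveOn (fun t => inner ℝ f (X t))
      (fun t => ν * inner ℝ f (X t) + (P.c * inner ℝ f (X (t - h t)) + (inner ℝ f (p t) +
        (inner ℝ f (opLiftL P P.b k (u t)) - ν * inner ℝ f (liftL P k (u t)))))) 0 T := by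
  obtain ⟨ι, b, ev, σ, hB⟩ := exists_isEigenbasis P P.b
  have hXc := hX.continuousOn hA.history
  obtain ⟨-, hXΦ, hu, hduhamel⟩ := hB.isMildSolution_iff.1 hX
  have hX0 : X 0 = Φ 0 := hXΦ ⟨neg_nonpos.2 hA.isDelay.hM_pos.le, le_rfl⟩
  have hforcing (t : ℝ) (ht : 0 ≤ t) :
      IntervalIntegrable (fun s => P.c • X (s - h s) + source P k u p s) volume 0 t :=
    (hA.isDelay.intervalIntegrable_smul_comp hXc P.c ht).add
      (intervalIntegrable_source P k (hu t ht) (hA.intervalIntegrable ht))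
  have hmode : IsPrimitiveOn (fun t => innerSL ℝ f (X t - liftL P k (u t)))
      (fun t => ContinuousLinearMap.lsmul ℝ ℝ ν (innerSL ℝ f (X t - liftL P k (u t))) +
        innerSL ℝ f (P.c • X (t - h t) + source P k u p t)) 0 T := by
    refine isPrimitiveOn_of_eq_variation_of_constants
      ⟨(innerSL ℝ f).integrable_comp (hforcing T hT).1,
        (innerSL ℝ f).integrable_comp (hforcing T hT).2⟩ fun t ht => ?_
    rw [uIcc_of_le hT] at ht
    have hS (s : ℝ) (hs : 0 ≤ s) (g : L2) : innerSL ℝ f (diagSemigroup b hB.le s g) =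
        expFlow (ContinuousLinearMap.lsmul ℝ ℝ ν) s (innerSL ℝ f g) := by
      rw [expFlow_lsmul_apply, ← Real.exp_eq_exp_ℝ, smul_eq_mul, smul_eq_mul, mul_comm s]
      exact hB.inner_diagSemigroup_eigenvector hf hs g
    rw [hduhamel t ht.1, add_right_comm, add_sub_cancel_right, map_add, hS t ht.1, hX0,
      ← (innerSL ℝ f).intervalIntegral_comp_comm (intervalIntegrable_convolution
        (continuous_diagSemigroup b hB.le) (hforcing t ht.1) t)]
    refine congrArg _ (intervalIntegral.integral_congr fun s hs => ?_)
    rw [uIcc_of_le ht.1] at hs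
    exact hS _ (sub_nonneg.2 hs.2) _
  have hlift := ((isPrimitiveOn_deriv_of_absolutelyContinuousOnInterval (hu T hT)).clm_comp
    (liftL P k)).clm_comp (innerSL ℝ f)
  refine (hmode.add hlift).congr (fun t _ => ?_) fun t _ => ?_
  · simp only [map_sub, innerSL_apply_apply, sub_add_cancel]
  · simp only [source, map_add, map_sub, map_smul, innerSL_apply_apply,
      ContinuousLinearMap.lsmul_apply, smul_eq_mul]
    ring

variable {N₀ : ℕ} {e : Fin N₀ → L2}

theorem IsMildSolution.isDelaySolution_output (hA : IsAdmissible hm hM h Φ p)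
    (hX : IsMildSolution P k hM h Φ p u X)
    (he : ∀ i : Fin N₀, IsUnitEigenvector P (lam P i) (e i)) :
    IsDelaySolution (Matrix.toEuclideanCLM (𝕜 := ℝ) (openLoopMatrix P N₀)) P.c hM h
      (fun t => outputL e (p t) + matL (matB P k e) (u t)) fun t => outputL e (X t) where
  continuousOn := (outputL e).continuous.comp_continuousOn (hX.continuousOn hA.history)
  isPrimitiveOn T hT := isPrimitiveOn_euclideanSpace fun i =>
    (hX.isPrimitiveOn_inner hA (he i).robinGraph hT).congr (fun _ _ => rfl) fun t _ => by
      simp only [PiLp.add_apply, PiLp.smul_apply, Matrix.ofLp_toEuclideanCLM,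
        openLoopMatrix_mulVec, outputL_apply, matL_matB_apply, smul_eq_mul]
      have hop : opLiftL P (P.b + P.c) k (u t) =
          opLiftL P P.b k (u t) + P.c • liftL P k (u t) := opLift_add_left P P.b P.c k (u t)
      rw [hop, inner_add_right, real_inner_smul_right]
      ring

theorem isDelaySolution_closedLoop_iff {K : Matrix (Fin 2) (Fin N₀) ℝ} {c : ℝ}
    {w Y : ℝ → EuclideanSpace ℝ (Fin N₀)} :
    IsDelaySolution (Matrix.toEuclideanCLM (𝕜 := ℝ) (closedLoopMatrix P k e K)) c hM h w Y ↔
      IsDelaySolution (Matrix.toEuclideanCLM (𝕜 := ℝ) (openLoopMatrix P N₀)) c hM h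
        (fun t => w t + matL (matB P k e) (matL K (Y t))) Y := by
  refine ⟨fun hY => hY.clm_comp (.id ℝ _) fun t _ => ?_, fun hY =>
    hY.clm_comp (.id ℝ _) fun t _ => ?_⟩ <;>
  · simp only [ContinuousLinearMap.id_apply, toEuclideanCLM_closedLoopMatrix]
    abel

variable {K : Matrix (Fin 2) (Fin N₀) ℝ}

theorem IsMildSolution.isDelaySolution_feedback (hA : IsAdmissible hm hM h Φ p)
    (he : ∀ i : Fin N₀, IsUnitEigenvector P (lam P i) (e i))
    (hX : IsMildSolution P k hM h Φ p (feedback e K X) X) :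
    IsDelaySolution (Matrix.toEuclideanCLM (𝕜 := ℝ) (closedLoopMatrix P k e K)) P.c hM h
      (fun t => outputL e (p t)) fun t => outputL e (X t) :=
  isDelaySolution_closedLoop_iff.2 <| by
    simpa only [feedback_eq] using hX.isDelaySolution_output hA he

theorem intervalIntegrable_output (hA : IsAdmissible hm hM h Φ p) (e : Fin N₀ → L2) {T : ℝ}
    (hT : 0 ≤ T) : IntervalIntegrable (fun t => outputL e (p t)) volume 0 T :=
  ⟨(outputL e).integrable_comp (hA.intervalIntegrable hT).1,
    (outputL e).integrable_comp (hA.intervalIntegrable hT).2⟩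

/-- The closed-loop output is determined by a delay differential equation of its own, whose
solution provides the boundary input. -/
theorem exists_isMildSolution_feedback (hA : IsAdmissible hm hM h Φ p)
    (he : ∀ i : Fin N₀, IsUnitEigenvector P (lam P i) (e i)) (K : Matrix (Fin 2) (Fin N₀) ℝ) :
    ∃ X, IsMildSolution P k hM h Φ p (feedback e K X) X := by
  obtain ⟨Y, hY, hYΦ⟩ := exists_isDelaySolution hA.isDelay
    (Matrix.toEuclideanCLM (𝕜 := ℝ) (closedLoopMatrix P k e K)) P.c
    (fun T hT => intervalIntegrable_output hA e hT)
    ((outputL e).continuous.comp_continuousOn hA.history)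
  obtain ⟨X, hX⟩ := exists_isMildSolution (P := P) (k := k) (u := fun t => matL K (Y t)) hA
    fun T hT => ((hY.isPrimitiveOn T hT).clm_comp (matL K)).absolutelyContinuousOnInterval
  have hXY : EqOn (fun t => outputL e (X t)) Y (Ici (-hM)) :=
    (hX.isDelaySolution_output hA he).eqOn hA.isDelay (isDelaySolution_closedLoop_iff.1 hY)
      fun t ht => (congrArg (outputL e) (hX.2.1 ht)).trans (hYΦ ht).symm
  refine ⟨X, hX.congr_input fun t ht => ?_⟩
  rw [feedback_eq]
  exact congrArg (matL K) (hXY (Ici_subset_Ici.2 (neg_nonpos.2 hA.isDelay.hM_pos.le) ht))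

theorem IsMildSolution.eqOn_feedback (hA : IsAdmissible hm hM h Φ p)
    (he : ∀ i : Fin N₀, IsUnitEigenvector P (lam P i) (e i)) {X' : ℝ → L2}
    (hX : IsMildSolution P k hM h Φ p (feedback e K X) X)
    (hX' : IsMildSolution P k hM h Φ p (feedback e K X') X') : EqOn X X' (Ici (-hM)) := by
  have houtput : EqOn (fun t => outputL e (X t)) (fun t => outputL e (X' t)) (Ici (-hM)) :=
    (hX.isDelaySolution_feedback hA he).eqOn hA.isDelay (hX'.isDelaySolution_feedback hA he)
      fun t ht => congrArg (outputL e) ((hX.2.1 ht).trans (hX'.2.1 ht).symm)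
  refine hX.eqOn hA.isDelay (hX'.congr_input fun t ht => ?_)
  rw [feedback_eq, feedback_eq]
  exact congrArg (matL K) (houtput (Ici_subset_Ici.2 (neg_nonpos.2 hA.isDelay.hM_pos.le) ht))

end Loop

/-! ### Spectral splitting -/

section CoordProj
variable {ι E : Type*} [NormedAddCommGroup E] [InnerProductSpace ℝ E] (b : HilbertBasis ι ℝ E)
  (s : Set ι)

theorem abs_indicator_one_le (j : ι) : |s.indicator (1 : ι → ℝ) j| ≤ 1 := by
  by_cases hj : j ∈ s <;> simp [hj]

/-- The orthogonal projection onto the closed span of the basis vectors `b j` with `j ∈ s`. -/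
def coordProj : E →L[ℝ] E :=
  diagOp b zero_le_one (abs_indicator_one_le s)

theorem inner_coordProj (f : E) (j : ι) :
    inner ℝ (b j) (coordProj b s f) = s.indicator (fun j => inner ℝ (b j) f) j := by
  rw [coordProj, inner_diagOp]
  by_cases hj : j ∈ s <;> simp [hj]

theorem norm_coordProj_apply_le (f : E) : ‖coordProj b s f‖ ≤ ‖f‖ := by
  refine (norm_le_of_coord_le b zero_le_one fun j => ?_).trans_eq (one_mul _)
  rw [coordProj, inner_diagOp, abs_mul]
  gcongr
  exact abs_indicator_one_le s j

theorem coordProj_add_coordProj_compl (f : E) : coordProj b s f + coordProj b sᶜ f = f :=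
  ext_coord (b := b) fun j => by
    rw [inner_add_right, inner_coordProj, inner_coordProj, indicator_self_add_compl_apply]

theorem norm_coordProj_le_of_injective {n : Type*} [Fintype n] {f : E} {y : EuclideanSpace ℝ n}
    {g : s → n} (hg : Function.Injective g) (hcoord : ∀ j : s, |inner ℝ (b j) f| ≤ |y (g j)|) :
    ‖coordProj b s f‖ ≤ ‖y‖ := by
  have hsum := hasSum_coord_sq b (coordProj b s f)
  rw [← hasSum_subtype_iff_of_support_subset (s := s) (Function.support_subset_iff'.2 fun j hj => by
    rw [inner_coordProj, indicator_of_notMem hj, sq, zero_mul])] at hsum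
  have hy := hasSum_fintype fun i => ‖y i‖ ^ 2
  rw [← EuclideanSpace.norm_sq_eq] at hy
  refine le_of_sq_le_sq (hasSum_le_inj g hg (fun _ _ => sq_nonneg _) (fun j => ?_) hsum hy)
    (norm_nonneg _)
  rw [Function.comp_apply, inner_coordProj, indicator_of_mem j.2, Real.norm_eq_abs, sq_abs]
  exact sq_le_sq.2 (hcoord j)

variable {ν : ι → ℝ} {σ : ℝ} (hν : ∀ j, ν j ≤ σ)

theorem coordProj_diagSemigroup_coordProj (t : ℝ) (f : E) :
    coordProj b s (diagSemigroup b hν t (coordProj b s f)) =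
      coordProj b s (diagSemigroup b hν t f) :=
  ext_coord (b := b) fun j => by
    rw [inner_coordProj, inner_coordProj]
    by_cases hj : j ∈ s <;> simp [hj, inner_diagSemigroup, inner_coordProj]

theorem norm_coordProj_comp_diagSemigroup_le {α t : ℝ} (hα : ∀ j ∈ s, ν j ≤ -α) (ht : 0 ≤ t) :
    ‖coordProj b s ∘L diagSemigroup b hν t‖ ≤ Real.exp (-α * t) := by
  refine ContinuousLinearMap.opNorm_le_bound _ (Real.exp_nonneg _) fun f =>
    norm_le_of_coord_le b (Real.exp_nonneg _) fun j => ?_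
  rw [ContinuousLinearMap.comp_apply, inner_coordProj]
  by_cases hj : j ∈ s
  · rw [indicator_of_mem hj, inner_diagSemigroup_of_nonneg b hν ht, abs_mul, Real.abs_exp]
    gcongr
    exact hα j hj
  · rw [indicator_of_notMem hj, abs_zero]
    positivity

end CoordProj

theorem bddAbove_eigenvalues (P : Coeffs) : BddAbove (eigenvalues P) := by
  obtain ⟨ι, b, ev, σ, hB⟩ := exists_isEigenbasis P (P.b + P.c)
  exact ⟨σ, fun μ ⟨f, hf0, hf⟩ => hB.eigenvalue_le hf hf0⟩

theorem exists_eq_lam_or_le_lam {P : Coeffs} {μ : ℝ} (hμ : μ ∈ eigenvalues P) (n : ℕ) :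
    (∃ i < n, μ = lam P i) ∨ μ ≤ lam P n := by
  induction n with
  | zero => exact .inr (le_csSup (bddAbove_eigenvalues P) hμ)
  | succ n ih =>
    obtain ⟨i, hi, rfl⟩ | hle := ih
    · exact .inl ⟨i, hi.trans n.lt_succ_self, rfl⟩
    obtain rfl | hlt := hle.eq_or_lt
    · exact .inl ⟨n, n.lt_succ_self, rfl⟩
    · exact .inr (le_csSup ((bddAbove_eigenvalues P).mono fun _ h => h.1) ⟨hμ, hlt⟩)

namespace IsEigenbasis

variable {P : Coeffs} {ι : Type} {b : HilbertBasis ι ℝ L2} {ev : ι → ℝ} {σ : ℝ}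
  (hB : IsEigenbasis P P.b b ev σ) {N₀ : ℕ} {e : Fin N₀ → L2}
  (he : ∀ i : Fin N₀, IsUnitEigenvector P (lam P i) (e i))
include hB he

theorem exists_eq_smul_of_lam_lt {j : ι} (hj : lam P N₀ - P.c < ev j) :
    ∃ (i : Fin N₀) (s : ℝ), |s| = 1 ∧ b j = s • e i := by
  have hgraph : RobinGraph P (P.b + P.c) (b j) ((ev j + P.c) • b j) := by
    rw [add_smul, robinGraph_add_smul_iff]
    exact hB.graph j
  obtain ⟨i, hi, hev⟩ | hle :=
    exists_eq_lam_or_le_lam ⟨b j, b.orthonormal.ne_zero j, hgraph⟩ N₀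
  · obtain ⟨hunit, hei⟩ := he ⟨i, hi⟩
    rw [hev] at hgraph
    obtain ⟨s, hs⟩ := hei.exists_eq_smul hgraph (norm_ne_zero_iff.1 (hunit.trans_ne one_ne_zero))
    refine ⟨⟨i, hi⟩, s, ?_, hs⟩
    have hnorm := b.orthonormal.1 j
    rwa [hs, norm_smul, hunit, mul_one, Real.norm_eq_abs] at hnorm
  · linarith

theorem norm_coordProj_le_norm_outputL (f : L2) :
    ‖coordProj b {j | ev j ≤ lam P N₀ - P.c}ᶜ f‖ ≤ ‖outputL e f‖ := by
  have hmode (j : ↥{j | ev j ≤ lam P N₀ - P.c}ᶜ) := hB.exists_eq_smul_of_lam_lt he (not_le.1 j.2)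
  choose g s hs hgs using hmode
  refine norm_coordProj_le_of_injective b _ (g := g) (fun j j' hjj' => ?_) fun j => ?_
  · by_contra hne
    have horth : inner ℝ (b j) (b j') = 0 := b.orthonormal.2 (Subtype.coe_ne_coe.2 hne)
    rw [hgs j, hgs j', hjj', real_inner_smul_left, real_inner_smul_right,
      real_inner_self_eq_norm_sq, (he _).1, one_pow, mul_one] at horth
    have habs := congrArg abs horth
    rw [abs_mul, hs, hs, mul_one, abs_zero] at habs
    exact one_ne_zero habs
  · rw [hgs j, real_inner_smul_left, abs_mul, hs, one_mul, outputL_apply]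

end IsEigenbasis

/-! ### The a priori estimate -/

section Estimate
variable {P : Coeffs} {k : ℕ} {hm hM α κ T F D : ℝ} {h : ℝ → ℝ} {Φ p X : ℝ → L2} {N₀ : ℕ}
  {e : Fin N₀ → L2} {K : Matrix (Fin 2) (Fin N₀) ℝ}

/-- The operator `f ↦ f - L_k K (⟨f, e₁⟩, …, ⟨f, e_{N₀}⟩)`, which turns a closed-loop state into a
state with homogeneous boundary conditions. -/
def homogenizer (P : Coeffs) (k : ℕ) (e : Fin N₀ → L2) (K : Matrix (Fin 2) (Fin N₀) ℝ) :
    L2 →L[ℝ] L2 :=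
  .id ℝ L2 - (liftL P k ∘L matL K) ∘L outputL e

theorem homogenizer_apply (f : L2) :
    homogenizer P k e K f = f - liftL P k (matL K (outputL e f)) :=
  rfl

/-- The operator through which the closed-loop output forces the homogenized state. -/
def outputForcing (P : Coeffs) (k : ℕ) (e : Fin N₀ → L2) (K : Matrix (Fin 2) (Fin N₀) ℝ) :
    EuclideanSpace ℝ (Fin N₀) →L[ℝ] L2 :=
  opLiftL P P.b k ∘L matL K -
    (liftL P k ∘L matL K) ∘L Matrix.toEuclideanCLM (𝕜 := ℝ) (closedLoopMatrix P k e K)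

theorem outputForcing_apply (y : EuclideanSpace ℝ (Fin N₀)) :
    outputForcing P k e K y = opLiftL P P.b k (matL K y) -
      liftL P k (matL K (Matrix.toEuclideanCLM (𝕜 := ℝ) (closedLoopMatrix P k e K) y)) :=
  rfl

theorem IsMildSolution.ae_smul_add_source_eq (hA : IsAdmissible hm hM h Φ p)
    (he : ∀ i : Fin N₀, IsUnitEigenvector P (lam P i) (e i))
    (hX : IsMildSolution P k hM h Φ p (feedback e K X) X) (hT : 0 ≤ T) :
    ∀ᵐ t, t ∈ uIoc 0 T → P.c • X (t - h t) + source P k (feedback e K X) p t =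
      P.c • homogenizer P k e K (X (t - h t)) +
        (outputForcing P k e K (outputL e (X t)) + homogenizer P k e K (p t)) := by
  have hfeedback : feedback e K X = fun t => matL K (outputL e (X t)) :=
    funext (feedback_eq e K X)
  have hu := (((hX.isDelaySolution_feedback hA he).isPrimitiveOn T hT).clm_comp
    (matL K)).ae_hasDerivAt
  filter_upwards [hu] with t hut ht
  rw [source, hfeedback, (hut (uIoc_subset_uIcc ht)).deriv, homogenizer_apply, homogenizer_apply,
    outputForcing_apply]
  simp only [map_add, map_smul]
  module

theorem IsAdmissible.intervalIntegrable_homogenized (hA : IsAdmissible hm hM h Φ p)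
    (hX : ContinuousOn X (Ici (-hM))) (hT : 0 ≤ T) :
    IntervalIntegrable (fun t => P.c • homogenizer P k e K (X (t - h t)) +
      (outputForcing P k e K (outputL e (X t)) + homogenizer P k e K (p t))) volume 0 T := by
  have hdelay := hA.isDelay.intervalIntegrable_smul_comp
    ((homogenizer P k e K).continuous.comp_continuousOn hX) P.c hT
  have hout : ContinuousOn (fun t => outputForcing P k e K (outputL e (X t))) (Ici 0) :=
    (outputForcing P k e K ∘L outputL e).continuous.comp_continuousOn
      (hX.mono (Ici_subset_Ici.2 (neg_nonpos.2 hA.isDelay.hM_pos.le)))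
  have hp : IntervalIntegrable (fun t => homogenizer P k e K (p t)) volume 0 T :=
    ⟨(homogenizer P k e K).integrable_comp (hA.intervalIntegrable hT).1,
      (homogenizer P k e K).integrable_comp (hA.intervalIntegrable hT).2⟩
  exact hdelay.add ((intervalIntegrable_of_continuousOn_Ici hout hT).add hp)

variable {ι : Type} {b : HilbertBasis ι ℝ L2} {ev : ι → ℝ} {σ : ℝ}

theorem IsMildSolution.coordProj_homogenizer_eq (hB : IsEigenbasis P P.b b ev σ) (s : Set ι)
    (hA : IsAdmissible hm hM h Φ p) (he : ∀ i : Fin N₀, IsUnitEigenvector P (lam P i) (e i))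
    (hX : IsMildSolution P k hM h Φ p (feedback e K X) X) {t : ℝ} (ht : 0 ≤ t) :
    coordProj b s (homogenizer P k e K (X t)) =
      (coordProj b s ∘L diagSemigroup b hB.le t) (coordProj b s (homogenizer P k e K (X 0))) +
        ∫ r in (0 : ℝ)..t, (coordProj b s ∘L diagSemigroup b hB.le (t - r))
          (P.c • coordProj b s (homogenizer P k e K (X (r - h r))) +
            coordProj b s (outputForcing P k e K (outputL e (X r)) +
              homogenizer P k e K (p r))) := by
  have hX0 : X 0 = Φ 0 := hX.2.1 ⟨neg_nonpos.2 hA.isDelay.hM_pos.le, le_rfl⟩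
  have hint := intervalIntegrable_convolution (continuous_diagSemigroup b hB.le)
    (hA.intervalIntegrable_homogenized (P := P) (k := k) (e := e) (K := K)
      (hX.continuousOn hA.history) ht) t
  have hZ : homogenizer P k e K (X t) = diagSemigroup b hB.le t (homogenizer P k e K (X 0)) +
      ∫ r in (0 : ℝ)..t, diagSemigroup b hB.le (t - r)
        (P.c • homogenizer P k e K (X (r - h r)) +
          (outputForcing P k e K (outputL e (X r)) + homogenizer P k e K (p r))) := by
    rw [homogenizer_apply, ← feedback_eq, (hB.isMildSolution_iff.1 hX).2.2.2 t ht,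
      homogenizer_apply, ← feedback_eq, hX0, add_right_comm, add_sub_cancel_right]
    refine congrArg _ (intervalIntegral.integral_congr_ae ?_)
    filter_upwards [hX.ae_smul_add_source_eq hA he ht] with r hr hrt
    rw [hr hrt]
  simp only [ContinuousLinearMap.comp_apply, ← map_smul (coordProj b s),
    ← map_add (coordProj b s), coordProj_diagSemigroup_coordProj]
  rw [(coordProj b s).intervalIntegral_comp_comm hint, ← map_add, ← hZ]

theorem IsMildSolution.norm_coordProj_homogenizer_le (hB : IsEigenbasis P P.b b ev σ) {s : Set ι}
    (hs : ∀ j ∈ s, ev j ≤ -α) (hr : IsDecayRate α P.c hM κ) (hA : IsAdmissible hm hM h Φ p)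
    (he : ∀ i : Fin N₀, IsUnitEigenvector P (lam P i) (e i))
    (hX : IsMildSolution P k hM h Φ p (feedback e K X) X) (hD : IsDataBound κ hM T X p F D)
    {m : ℝ} (hm0 : 0 ≤ m) (hY : ∀ t ∈ Icc 0 T, ‖outputL e (X t)‖ ≤ Real.exp (-κ * t) * m) :
    ∀ t ∈ Icc (-hM) T, ‖coordProj b s (homogenizer P k e K (X t))‖ ≤
      Real.exp (-κ * t) * (delayGain α P.c hM κ * (‖homogenizer P k e K‖ * F +
        (‖outputForcing P k e K‖ * m + ‖homogenizer P k e K‖ * D))) := by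
  have hD0 := hD.nonneg
  refine hA.isDelay.norm_le_of_duhamel hr
    (V := fun t => coordProj b s ∘L diagSemigroup b hB.le t)
    (fun t ht => norm_coordProj_comp_diagSemigroup_le b s hB.le hs ht)
    ((coordProj b s ∘L homogenizer P k e K).continuous.comp_continuousOn
      (hX.continuousOn hA.history))
    (fun t ht => hX.coordProj_homogenizer_eq hB s hA he ht)
    ⟨hD.time_nonneg, by positivity, fun t ht => ?_, ?_⟩
  · exact (norm_coordProj_apply_le b s _).trans
      ((homogenizer P k e K).le_opNorm_of_le (hD.history t ht))
  · filter_upwards [hD.disturbance] with t hpt ht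
    calc _ ≤ ‖outputForcing P k e K (outputL e (X t)) + homogenizer P k e K (p t)‖ :=
          norm_coordProj_apply_le b s _
      _ ≤ ‖outputForcing P k e K‖ * (Real.exp (-κ * t) * m) +
          ‖homogenizer P k e K‖ * (Real.exp (-κ * t) * D) :=
        norm_add_le_of_le (ContinuousLinearMap.le_opNorm_of_le _ (hY t (Ioc_subset_Icc_self ht)))
          (ContinuousLinearMap.le_opNorm_of_le _ (hpt ht))
      _ = _ := by ring

theorem IsEigenbasis.norm_le_tail_add_output (hB : IsEigenbasis P P.b b ev σ)
    (he : ∀ i : Fin N₀, IsUnitEigenvector P (lam P i) (e i)) (f : L2) :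
    ‖f‖ ≤ ‖coordProj b {j | ev j ≤ lam P N₀ - P.c} (homogenizer P k e K f)‖ +
      (‖liftL P k ∘L matL K‖ + 1) * ‖outputL e f‖ := by
  set s := {j | ev j ≤ lam P N₀ - P.c}
  have hsplit : f = coordProj b s (homogenizer P k e K f) +
      (coordProj b s ((liftL P k ∘L matL K) (outputL e f)) + coordProj b sᶜ f) := by
    rw [← add_assoc, ← map_add, homogenizer_apply, ContinuousLinearMap.comp_apply,
      sub_add_cancel, coordProj_add_coordProj_compl]
  have hlift : ‖coordProj b s ((liftL P k ∘L matL K) (outputL e f))‖ ≤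
      ‖liftL P k ∘L matL K‖ * ‖outputL e f‖ :=
    (norm_coordProj_apply_le b s _).trans (ContinuousLinearMap.le_opNorm _ _)
  rw [add_one_mul]
  nth_rewrite 1 [hsplit]
  exact norm_add_le_of_le le_rfl
    (norm_add_le_of_le hlift (hB.norm_coordProj_le_norm_outputL he f))

theorem IsDataBound.clm_comp {E F : Type*} [NormedAddCommGroup E] [NormedSpace ℝ E]
    [NormedAddCommGroup F] [NormedSpace ℝ F] {Y w : ℝ → E} {f d : ℝ}
    (hD : IsDataBound κ hM T Y w f d) (L : E →L[ℝ] F) :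
    IsDataBound κ hM T (fun t => L (Y t)) (fun t => L (w t)) (‖L‖ * f) (‖L‖ * d) where
  time_nonneg := hD.time_nonneg
  nonneg := mul_nonneg (norm_nonneg L) hD.nonneg
  history t ht := L.le_opNorm_of_le (hD.history t ht)
  disturbance := by
    filter_upwards [hD.disturbance] with s hs hst
    rw [mul_left_comm]
    exact L.le_opNorm_of_le (hs hst)

theorem exists_norm_le_of_isMildSolution_feedback (hr : IsDecayRate α P.c hM κ)
    (hlam : lam P N₀ ≤ P.c - α) (he : ∀ i : Fin N₀, IsUnitEigenvector P (lam P i) (e i))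
    (hstable : ∀ ν ∈ ((closedLoopMatrix P k e K).map (algebraMap ℝ ℂ)).charpoly.roots,
      ν.re ≤ -α) :
    ∃ C, 0 ≤ C ∧ ∀ ⦃h Φ p X T F D⦄, IsAdmissible hm hM h Φ p →
      IsMildSolution P k hM h Φ p (feedback e K X) X → IsDataBound κ hM T X p F D →
      ∀ t ∈ Icc (-hM) T, ‖X t‖ ≤ Real.exp (-κ * t) * (C * (F + D)) ∧
        ‖outputL e (X t)‖ ≤ Real.exp (-κ * t) * (C * (F + D)) := by
  obtain ⟨ι, b, ev, σ, hB⟩ := exists_isEigenbasis P P.b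
  obtain ⟨C, hC0, hC⟩ := exists_norm_le_of_isDelaySolution_matrix (hm := hm) hr hstable
  have hgain := hr.delayGain_nonneg
  set A := delayGain α P.c hM κ *
    (‖homogenizer P k e K‖ + ‖outputForcing P k e K‖ * (C * ‖outputL e‖)) with hA
  set B := ‖liftL P k ∘L matL K‖ * (C * ‖outputL e‖) with hB'
  refine ⟨A + B + C * ‖outputL e‖, by positivity, fun h Φ p X T F D hadm hX hD t ht => ?_⟩
  have hF0 := hD.history_nonneg hadm.isDelay.hM_pos.le
  have hD0 := hD.nonneg
  have hY (t : ℝ) (ht : t ∈ Icc (-hM) T) :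
      ‖outputL e (X t)‖ ≤ Real.exp (-κ * t) * (C * ‖outputL e‖ * (F + D)) := by
    rw [mul_assoc C, mul_add]
    exact hC hadm.isDelay (hX.isDelaySolution_feedback hadm he) (hD.clm_comp (outputL e)) t ht
  have htail := hX.norm_coordProj_homogenizer_le hB (s := {j | ev j ≤ lam P N₀ - P.c})
    (fun j hj => hj.trans (by linarith)) hr hadm he hD (by positivity)
    (fun t ht => hY t ⟨(neg_nonpos.2 hadm.isDelay.hM_pos.le).trans ht.1, ht.2⟩) t ht
  refine ⟨?_, (hY t ht).trans ?_⟩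
  · calc ‖X t‖ ≤ _ := hB.norm_le_tail_add_output (k := k) (K := K) he (X t)
      _ ≤ _ := add_le_add htail (mul_le_mul_of_nonneg_left (hY t ht) (by positivity))
      _ = _ := by rw [hA, hB']; ring
  · gcongr
    exact le_add_of_nonneg_left (by positivity)

end Estimate

/-! ### The stability estimate -/

theorem add_mem_charpoly_roots_of_mem_sub_scalar {n R : Type*} [Fintype n] [DecidableEq n]
    [CommRing R] [IsDomain R] {M : Matrix n n R} {μ ν : R}
    (hν : ν ∈ (M - Matrix.scalar n μ).charpoly.roots) : ν + μ ∈ M.charpoly.roots := by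
  rw [Polynomial.mem_roots (Matrix.charpoly_monic _).ne_zero, Matrix.charpoly_sub_scalar] at hν
  rw [Polynomial.mem_roots (Matrix.charpoly_monic _).ne_zero]
  simpa using hν

theorem add_mem_roots_of_mem_closedLoopMatrix {P : Coeffs} {k N₀ : ℕ} {e : Fin N₀ → L2}
    {K : Matrix (Fin 2) (Fin N₀) ℝ} {ν : ℂ}
    (hν : ν ∈ ((closedLoopMatrix P k e K).map (algebraMap ℝ ℂ)).charpoly.roots) :
    ν + P.c ∈ ((matA P N₀ + matB P k e * K).map (algebraMap ℝ ℂ)).charpoly.roots := by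
  refine add_mem_charpoly_roots_of_mem_sub_scalar ?_
  rwa [closedLoopMatrix, Matrix.map_sub _ (map_sub _), Matrix.scalar_apply,
    Matrix.diagonal_map (map_zero _)] at hν

theorem exists_lt_forall_re_le {S : Multiset ℂ} {x m : ℝ} (hx : x < m)
    (hS : ∀ z ∈ S, z.re < m) : ∃ m' < m, x ≤ m' ∧ ∀ z ∈ S, z.re ≤ m' := by
  have hev {y : ℝ} (hy : y < m) : ∀ᶠ m' in 𝓝[<] m, y ≤ m' :=
    (eventually_ge_nhds hy).filter_mono nhdsWithin_le_nhds
  have hall : ∀ᶠ m' in 𝓝[<] m, ∀ z ∈ S.toFinset, z.re ≤ m' :=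
    (Finset.eventually_all _).2 fun z hz => hev (hS z (Multiset.mem_toFinset.1 hz))
  obtain ⟨m', hm', hxm', hSm'⟩ :=
    (eventually_mem_nhdsWithin.and ((hev hx).and hall)).exists
  exact ⟨m', hm', hxm', fun z hz => hSm' z (Multiset.mem_toFinset.2 hz)⟩

theorem norm_le_supHistory {hM : ℝ} {Φ : ℝ → L2} (hΦ : ContinuousOn Φ (Icc (-hM) 0)) {τ : ℝ}
    (hτ : τ ∈ Icc (-hM) 0) : ‖Φ τ‖ ≤ supHistory hM Φ :=
  le_csSup (isCompact_Icc.bddAbove_image hΦ.norm) ⟨τ, hτ, rfl⟩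

theorem ae_norm_le_fadingEssSup {κ t : ℝ} (hκ : 0 ≤ κ) {p : ℝ → L2}
    (hp : MemLp p ⊤ (volume.restrict (Icc 0 t))) :
    ∀ᵐ s, s ∈ Icc 0 t → ‖Real.exp (-κ * (t - s)) • p s‖ ≤ fadingEssSup κ p t := by
  have hf : MemLp (fun τ => Real.exp (-κ * (t - τ)) • p τ) ⊤ (volume.restrict (Icc 0 t)) := by
    have hexp : Continuous fun τ => Real.exp (-κ * (t - τ)) := by fun_prop
    refine hp.of_le (hexp.aestronglyMeasurable.smul hp.1) ?_
    filter_upwards [ae_restrict_mem measurableSet_Icc] with s hs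
    rw [norm_smul, Real.norm_eq_abs, Real.abs_exp]
    refine mul_le_of_le_one_left (norm_nonneg _) (Real.exp_le_one_iff.2 ?_)
    nlinarith [hs.2]
  have hle := ae_le_eLpNormEssSup (f := fun τ => Real.exp (-κ * (t - τ)) • p τ)
    (μ := volume.restrict (Icc 0 t))
  rw [← eLpNorm_exponent_top, ae_restrict_iff' measurableSet_Icc] at hle
  filter_upwards [hle] with s hs hst
  simpa only [toReal_enorm, fadingEssSup] using ENNReal.toReal_mono hf.2.ne (hs hst)

section Stability
variable {P : Coeffs} {k : ℕ} {hm hM κ t : ℝ} {h : ℝ → ℝ} {Φ p X : ℝ → L2} {N₀ : ℕ}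
  {e : Fin N₀ → L2} {K : Matrix (Fin 2) (Fin N₀) ℝ}

theorem IsAdmissible.isDataBound (hA : IsAdmissible hm hM h Φ p)
    (hX : EqOn X Φ (Icc (-hM) 0)) (hκ : 0 ≤ κ) (ht : 0 ≤ t) :
    IsDataBound κ hM t X p (supHistory hM Φ) (Real.exp (κ * t) * fadingEssSup κ p t) where
  time_nonneg := ht
  nonneg := mul_nonneg (Real.exp_nonneg _) ENNReal.toReal_nonneg
  history τ hτ := by
    rw [hX hτ]
    exact norm_le_supHistory hA.history hτ
  disturbance := by
    filter_upwards [ae_norm_le_fadingEssSup hκ (hA.disturbance t ht)] with s hs hst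
    rw [← exp_mul_le_iff]
    calc Real.exp (κ * s) * ‖p s‖ = Real.exp (κ * t) * ‖Real.exp (-κ * (t - s)) • p s‖ := by
          rw [norm_smul, Real.norm_eq_abs, Real.abs_exp, ← mul_assoc, ← Real.exp_add]
          ring_nf
      _ ≤ _ := mul_le_mul_of_nonneg_left (hs (Ioc_subset_Icc_self hst)) (Real.exp_nonneg _)

theorem exists_fading_bound (hlam : lam P N₀ < P.c - |P.c|)
    (he : ∀ i : Fin N₀, IsUnitEigenvector P (lam P i) (e i))
    (hstable : ∀ μ ∈ ((matA P N₀ + matB P k e * K).map (algebraMap ℝ ℂ)).charpoly.roots,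
      μ.re < P.c - |P.c|) :
    ∃ κ C : ℝ, 0 < κ ∧ 0 < C ∧ ∀ ⦃h Φ p X⦄, IsAdmissible hm hM h Φ p →
      IsMildSolution P k hM h Φ p (feedback e K X) X → ∀ t, 0 ≤ t →
      ‖X t‖ ≤ C * (Real.exp (-κ * t) * supHistory hM Φ + fadingEssSup κ p t) ∧
        ‖outputL e (X t)‖ ≤ C * (Real.exp (-κ * t) * supHistory hM Φ + fadingEssSup κ p t) := by
  obtain ⟨m, hm', hlam', hstable'⟩ := exists_lt_forall_re_le hlam hstable
  obtain ⟨κ, hr⟩ := exists_isDecayRate (α := P.c - m) (c := P.c) (by linarith) hM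
  obtain ⟨C, hC0, hC⟩ := exists_norm_le_of_isMildSolution_feedback (hm := hm) hr (by linarith) he
    (fun ν hν => by
      have := hstable' _ (add_mem_roots_of_mem_closedLoopMatrix hν)
      rw [Complex.add_re, Complex.ofReal_re] at this
      linarith)
  refine ⟨κ, C + 1, hr.pos, by positivity, fun h Φ p X hA hX t ht => ?_⟩
  have hD := hA.isDataBound hX.2.1 hr.pos.le ht
  have hle : Real.exp (-κ * t) * (C * (supHistory hM Φ + Real.exp (κ * t) * fadingEssSup κ p t)) ≤
      (C + 1) * (Real.exp (-κ * t) * supHistory hM Φ + fadingEssSup κ p t) := by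
    have hF := hD.history_nonneg hA.isDelay.hM_pos.le
    have hG : 0 ≤ fadingEssSup κ p t := ENNReal.toReal_nonneg
    calc _ = C * (Real.exp (-κ * t) * supHistory hM Φ + fadingEssSup κ p t) := by
          rw [mul_left_comm, mul_add, ← mul_assoc (Real.exp _) (Real.exp _), ← Real.exp_add,
            neg_mul, neg_add_cancel, Real.exp_zero, one_mul]
      _ ≤ _ := by
          gcongr
          linarith
  obtain ⟨hstate, houtput⟩ := hC hA hX hD t ⟨by linarith [hA.isDelay.hM_pos], le_rfl⟩
  exact ⟨hstate.trans hle, houtput.trans hle⟩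

end Stability

end

end DelayRD

open DelayRD in
theorem theorem1_general (P : Coeffs) (k : ℕ) (_hk : IsLiftExponent P k)
    (hm hM : ℝ) (hm_pos : 0 < hm) (N₀ : ℕ) (hlam : lam P N₀ < P.c - |P.c|) (e : Fin N₀ → L2)
    (he : ∀ i : Fin N₀, IsUnitEigenvector P (lam P i) (e i)) (K : Matrix (Fin 2) (Fin N₀) ℝ)
    (hstable : ∀ μ ∈ ((matA P N₀ + matB P k e * K).map (algebraMap ℝ ℂ)).charpoly.roots,
      μ.re < P.c - |P.c|) :
    ∃ κ C₀ C₁ : ℝ, 0 < κ ∧ 0 < C₀ ∧ 0 < C₁ ∧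
      ∀ Φ : ℝ → L2, ContinuousOn Φ (Icc (-hM) 0) →
      ∀ p : ℝ → L2, (∀ T : ℝ, 0 ≤ T → MemLp p ⊤ (volume.restrict (Icc 0 T))) →
      ∀ h : ℝ → ℝ, ContinuousOn h (Ici 0) → (∀ t, 0 ≤ t → hm ≤ h t ∧ h t ≤ hM) →
      ∃ X : ℝ → L2,
        IsMildSolution P k hM h Φ p (feedback e K X) X ∧
        (∀ X' : ℝ → L2, IsMildSolution P k hM h Φ p (feedback e K X') X' →
          EqOn X' X (Ici (-hM))) ∧
        ∀ t, 0 ≤ t →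
          ‖X t‖ ≤ C₀ * Real.exp (-κ * t) * supHistory hM Φ + C₁ * fadingEssSup κ p t ∧
          ‖feedback e K X t‖ ≤
            C₀ * ‖K‖ * Real.exp (-κ * t) * supHistory hM Φ +
              C₁ * ‖K‖ * fadingEssSup κ p t := by
  obtain ⟨κ, C, hκ, hC, hbound⟩ := exists_fading_bound (hm := hm) (hM := hM) hlam he hstable
  refine ⟨κ, C, C, hκ, hC, hC, fun Φ hΦ p hp h hh hb => ?_⟩
  have hA : IsAdmissible hm hM h Φ p := ⟨⟨hm_pos, hh, hb⟩, hΦ, hp⟩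
  obtain ⟨X, hX⟩ := exists_isMildSolution_feedback (k := k) hA he K
  refine ⟨X, hX, fun X' hX' => hX'.eqOn_feedback hA he hX, fun t ht => ?_⟩
  obtain ⟨hstate, houtput⟩ := hbound hA hX t ht
  refine ⟨hstate.trans_eq (by ring), ?_⟩
  calc ‖feedback e K X t‖ ≤ ‖K‖ * ‖outputL e (X t)‖ := by
        rw [feedback_eq]
        exact norm_matL_apply_le K _
    _ ≤ ‖K‖ * _ := mul_le_mul_of_nonneg_left houtput (norm_nonneg K)
    _ = _ := by ring

theorem theorem1 (P : DelayRD.Coeffs) (k : ℕ) (hk : DelayRD.IsLiftExponent P k)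
    (hm hM : ℝ) (hm_pos : 0 < hm) (hmM : hm < hM)
    (N₀ : ℕ) (hN₀ : 1 ≤ N₀) (hlam : DelayRD.lam P N₀ < -2 * √5 * |P.c|)
    (e : Fin N₀ → DelayRD.L2)
    (he : ∀ i : Fin N₀, DelayRD.IsUnitEigenvector P (DelayRD.lam P i) (e i))
    (K : Matrix (Fin 2) (Fin N₀) ℝ)
    (hsimple : ((DelayRD.matA P N₀ + DelayRD.matB P k e * K).map
      (algebraMap ℝ ℂ)).charpoly.roots.Nodup)
    (hstable : ∀ μ ∈ ((DelayRD.matA P N₀ + DelayRD.matB P k e * K).map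
      (algebraMap ℝ ℂ)).charpoly.roots, μ.re < -3 * |P.c|) :
    ∃ κ C₀ C₁ : ℝ, 0 < κ ∧ 0 < C₀ ∧ 0 < C₁ ∧
      ∀ Φ : ℝ → DelayRD.L2, ContinuousOn Φ (Icc (-hM) 0) →
      ∀ p : ℝ → DelayRD.L2, (∀ T : ℝ, 0 ≤ T → MemLp p ⊤ (volume.restrict (Icc 0 T))) →
      ∀ h : ℝ → ℝ, ContinuousOn h (Ici 0) → (∀ t, 0 ≤ t → hm ≤ h t ∧ h t ≤ hM) →
      ∃ X : ℝ → DelayRD.L2,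
        DelayRD.IsMildSolution P k hM h Φ p (DelayRD.feedback e K X) X ∧
        (∀ X' : ℝ → DelayRD.L2,
          DelayRD.IsMildSolution P k hM h Φ p (DelayRD.feedback e K X') X' →
          EqOn X' X (Ici (-hM))) ∧
        ∀ t, 0 ≤ t →
          ‖X t‖ ≤ C₀ * Real.exp (-κ * t) * DelayRD.supHistory hM Φ +
            C₁ * DelayRD.fadingEssSup κ p t ∧
          ‖DelayRD.feedback e K X t‖ ≤
            C₀ * ‖K‖ * Real.exp (-κ * t) * DelayRD.supHistory hM Φ +
              C₁ * ‖K‖ * DelayRD.fadingEssSup κ p t := by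
  have hsqrt : (1 : ℝ) ≤ √5 := Real.one_le_sqrt.2 (by norm_num)
  have hc := neg_abs_le P.c
  exact theorem1_general P k hk hm hM hm_pos N₀ (by nlinarith [abs_nonneg P.c]) e he K
    fun μ hμ => by linarith [hstable μ hμ, abs_nonneg P.c]
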